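/- Let $G$ be a Carnot group, i.e. a simply connected Lie group whose (finite-dimensional, real) Lie algebra has a decomposition $\mathfrak g=V_1\oplus\dots\oplus V_s$ with $[V_i,V_j]\subset V_{i+j}$ (where $V_k=\{0\}$ for $k>s$) and with $V_1$ generating $\mathfrak g$. Fix an inner product on $V_1$, let $d$ be the associated Carnot–Carathéodory distance on $G$ (the infimal length of $C^1$ paths tangent to the left-invariant subbundle determined by $V_1$), let $B(x,r)$ be its open balls, and for $t>0$ let $\delta_t:G\to G$ be the Carnot dilation, the automorphism of $G$ which acts on $V_i$ as multiplication by $t^i$. Let $W$ be a linear subspace with $\{0\}\neq W\subsetneq V_1$ and $$[W,V_i]=\{0\}\quad\text{for all } i\ge 2 .$$ Let $\mathfrak h$ be the Lie subalgebra of $\mathfrak g$ generated by $W$, and let $H$ be the subgroup of $G$ generated by $\exp\mathfrak h$. Let $\eta:[0,\infty)\to[0,\infty)$ be a homeomorphism. Then there is a constant $L\ge 1$, depending only on $\eta$ (and on $G$, $d$ and $W$), with the following property. Let $x\in G$ and $0<r<\infty$, and let $f:B(x,r)\to U$ be a homeomorphism onto an open subset $U\subset G$ such that * $f$ is $\eta$-quasisymmetric: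 $\dfrac{d(f(p),f(y))}{d(f(p),f(z))}\le\eta\!\left(\dfrac{d(p,y)}{d(p,z)}\right)$ for all distinct points $p,y,z\in B(x,r)$; * $f$ preserves the coset foliation of $H$: for every $g\in G$ there is a $g'\in G$ with $f(B(x,r)\cap gH)=U\cap g'H$. Then there is a $t>0$ such that $\delta_t\circ f$ is $L$-bilipschitz on $B(x,r/L)$, i.e. $$L^{-1}d(y,z)\le d\big(\delta_t(f(y)),\delta_t(f(z))\big)\le L\,d(y,z)\qquad\text{for all } y,z\in B(x,r/L).$$ -/

import Mathlib

open Set Topology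
open scoped Nat NNReal Pointwise

noncomputable section

/-- A stratification `𝔤 = V₁ ⊕ ⋯ ⊕ V_s` of a real Lie algebra: `[V_i, V_j] ⊆ V_{i+j}` and `V₁`
generates `𝔤`. The layers are indexed by `ℕ`, with `V_i = 0` for `i = 0` and for `i > s`. -/
structure Stratification (𝔤 : Type*) [LieRing 𝔤] [LieAlgebra ℝ 𝔤] where
  /-- the number `s` of layers -/
  step : ℕ
  /-- the layers `V_i` -/
  layer : ℕ → Submodule ℝ 𝔤
  layer_zero : layer 0 = ⊥
  layer_of_lt : ∀ i, step < i → layer i = ⊥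
  isInternal : DirectSum.IsInternal layer
  lie_mem : ∀ i j x y, x ∈ layer i → y ∈ layer j → ⁅x, y⁆ ∈ layer (i + j)
  lieSpan_eq_top : LieSubalgebra.lieSpan ℝ 𝔤 (layer 1 : Set 𝔤) = ⊤

/-- The exponential `∑_{k < N} a ^ k / k!` of an element with `a ^ N = 0`. -/
def nilExp (N : ℕ) {A : Type*} [Ring A] [Algebra ℝ A] (a : A) : A :=
  ∑ k ∈ Finset.range N, ((k ! : ℝ))⁻¹ • a ^ k

section Exponential

variable {A : Type*} [Ring A] [Algebra ℝ A]

theorem sum_range_mul_range_eq {M : Type*} [AddCommMonoid M] (N : ℕ) (f : ℕ → ℕ → M)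
    (hf : ∀ k m, N ≤ k + m → f k m = 0) :
    ∑ k ∈ Finset.range N, ∑ m ∈ Finset.range N, f k m
      = ∑ n ∈ Finset.range N, ∑ k ∈ Finset.range (n + 1), f k (n - k) := by
  rw [Finset.sum_range_diag_flip]
  refine Finset.sum_congr rfl fun k _ => ?_
  symm
  apply Finset.sum_subset
  · intro m hm
    simp only [Finset.mem_range] at hm ⊢
    omega
  · intro m _ hm
    simp only [Finset.mem_range] at hm
    exact hf k m (by omega)

theorem pow_mul_eq_sum (a : A) (c : ℕ → A) (hc : ∀ k, c (k + 1) = a * c k - c k * a) (n : ℕ) :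
    a ^ n * c 0 = ∑ k ∈ Finset.range (n + 1), (n.choose k : ℝ) • (c k * a ^ (n - k)) := by
  induction n with
  | zero => simp
  | succ n ih =>
    have h1 : a ^ (n + 1) * c 0
        = ∑ k ∈ Finset.range (n + 1), (n.choose k : ℝ) • (c (k + 1) * a ^ (n - k))
          + ∑ k ∈ Finset.range (n + 1), (n.choose k : ℝ) • (c k * a ^ (n + 1 - k)) := by
      rw [pow_succ', mul_assoc, ih, Finset.mul_sum, ← Finset.sum_add_distrib]
      refine Finset.sum_congr rfl fun k hk => ?_
      have hk' : n + 1 - k = (n - k) + 1 := by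
        simp only [Finset.mem_range] at hk; omega
      rw [hc, hk', pow_succ', mul_smul_comm, ← smul_add]
      congr 1
      noncomm_ring
    rw [h1]
    have h2 : ∑ k ∈ Finset.range (n + 1), (n.choose k : ℝ) • (c k * a ^ (n + 1 - k))
        = ∑ k ∈ Finset.range (n + 2), (n.choose k : ℝ) • (c k * a ^ (n + 1 - k)) := by
      rw [Finset.sum_range_succ _ (n + 1)]
      simp
    rw [h2, Finset.sum_range_succ' _ (n + 1), Finset.sum_range_succ' _ (n + 1), ← add_assoc,
      ← Finset.sum_add_distrib]
    congr 1
    · refine Finset.sum_congr rfl fun k _ => ?_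
      rw [Nat.choose_succ_succ, Nat.add_sub_add_right]
      push_cast
      rw [add_smul]
    · simp

theorem inv_factorial_mul_choose {n k : ℕ} (h : k ≤ n) :
    ((n ! : ℝ))⁻¹ * (n.choose k : ℝ) = ((k ! : ℝ))⁻¹ * (((n - k)! : ℝ))⁻¹ := by
  have h1 : (n.choose k : ℝ) * k ! * (n - k)! = n ! := by
    exact_mod_cast Nat.choose_mul_factorial_mul_factorial h
  have h2 : (n ! : ℝ) ≠ 0 := by positivity
  have h3 : (k ! : ℝ) ≠ 0 := by positivity
  have h4 : ((n - k)! : ℝ) ≠ 0 := by positivity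
  field_simp
  linarith

theorem nilExp_mul_eq (N : ℕ) (a : A) (c : ℕ → A) (hc : ∀ k, c (k + 1) = a * c k - c k * a)
    (hN : ∀ k m, N ≤ k + m → c k * a ^ m = 0) :
    nilExp N a * c 0 = (∑ k ∈ Finset.range N, ((k ! : ℝ))⁻¹ • c k) * nilExp N a := by
  unfold nilExp
  rw [Finset.sum_mul_sum, sum_range_mul_range_eq N, Finset.sum_mul]
  · refine Finset.sum_congr rfl fun n _ => ?_
    rw [smul_mul_assoc, pow_mul_eq_sum a c hc, Finset.smul_sum]
    refine Finset.sum_congr rfl fun k hk => ?_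
    rw [smul_smul, inv_factorial_mul_choose (by simp only [Finset.mem_range] at hk; omega),
      smul_mul_smul_comm]
  · intro k m h
    rw [smul_mul_smul_comm, hN k m h, smul_zero]

theorem nilExp_mul_nilExp_neg (N : ℕ) (a : A) (ha : a ^ (N + 1) = 0) :
    nilExp (N + 1) a * nilExp (N + 1) (-a) = 1 := by
  unfold nilExp
  rw [Finset.sum_mul_sum, sum_range_mul_range_eq (N + 1)]
  · have h : ∀ n ∈ Finset.range (N + 1), (∑ k ∈ Finset.range (n + 1),
        ((k ! : ℝ)⁻¹ • a ^ k) * (((n - k)! : ℝ)⁻¹ • (-a) ^ (n - k)))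
        = ((n ! : ℝ))⁻¹ • (a + -a) ^ n := by
      intro n _
      rw [(Commute.neg_right (Commute.refl a)).add_pow, Finset.smul_sum]
      refine Finset.sum_congr rfl fun k hk => ?_
      rw [smul_mul_smul_comm,
        ← inv_factorial_mul_choose (by simp only [Finset.mem_range] at hk; omega), mul_smul,
        ← Nat.cast_comm, ← nsmul_eq_mul, Nat.cast_smul_eq_nsmul]
    rw [Finset.sum_congr rfl h, Finset.sum_range_succ']
    simp
  · intro k m h
    rw [smul_mul_smul_comm, neg_pow, ((Commute.neg_one_left a).pow_pow m m).eq, ← mul_assoc,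
      ← pow_add, pow_eq_zero_of_le h ha, zero_mul, smul_zero]

end Exponential

namespace Stratification

attribute [local instance] LieRing.ofAssociativeRing

variable {𝔤 : Type*} [LieRing 𝔤] [LieAlgebra ℝ 𝔤] (S : Stratification 𝔤)

/-- The projection of `𝔤` to the layer `V_i`. -/
def proj (i : ℕ) : 𝔤 →ₗ[ℝ] 𝔤 :=
  (S.layer i).subtype ∘ₗ DirectSum.component ℝ ℕ (fun i => S.layer i) i ∘ₗ
    (LinearEquiv.ofBijective (DirectSum.coeLinearMap S.layer) S.isInternal).symm.toLinearMap

/-- The linear map which multiplies `V_i` by `c i`, for every `i`. -/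
def weightMap (c : ℕ → ℝ) : 𝔤 →ₗ[ℝ] 𝔤 :=
  ∑ i ∈ Finset.range (S.step + 1), c i • S.proj i

/-- The grading derivation: multiplication by `i` on `V_i`. -/
def degree : 𝔤 →ₗ[ℝ] 𝔤 := S.weightMap fun i => (i : ℝ)

theorem proj_mem (i : ℕ) (x : 𝔤) : S.proj i x ∈ S.layer i := by
  simp [proj]

theorem proj_of_mem {i : ℕ} {x : 𝔤} (hx : x ∈ S.layer i) (j : ℕ) :
    S.proj j x = if i = j then x else 0 := by
  have h : (LinearEquiv.ofBijective (DirectSum.coeLinearMap S.layer) S.isInternal).symm x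
      = DirectSum.lof ℝ ℕ (fun i => S.layer i) i ⟨x, hx⟩ := by
    rw [LinearEquiv.symm_apply_eq]
    exact (DirectSum.coeLinearMap_lof S.layer i ⟨x, hx⟩).symm
  simp only [proj, LinearMap.comp_apply, LinearEquiv.coe_coe, h, DirectSum.component.of]
  split_ifs with hij
  · subst hij; simp
  · simp

theorem proj_zero (x : 𝔤) : S.proj 0 x = 0 := by
  have := S.proj_mem 0 x
  rwa [S.layer_zero, Submodule.mem_bot] at this

theorem proj_of_lt {i : ℕ} (hi : S.step < i) (x : 𝔤) : S.proj i x = 0 := by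
  have := S.proj_mem i x
  rwa [S.layer_of_lt i hi, Submodule.mem_bot] at this

theorem layer_induction {p : 𝔤 → Prop} (h0 : p 0) (hadd : ∀ x y, p x → p y → p (x + y))
    (hl : ∀ i, ∀ x ∈ S.layer i, p x) (x : 𝔤) : p x := by
  have hx : x ∈ ⨆ i, S.layer i := by
    rw [S.isInternal.submodule_iSup_eq_top]; trivial
  exact Submodule.iSup_induction S.layer (motive := p) hx hl h0 hadd

theorem sum_proj (x : 𝔤) : ∑ i ∈ Finset.range (S.step + 1), S.proj i x = x := by
  refine S.layer_induction (p := fun x => ∑ i ∈ Finset.range (S.step + 1), S.proj i x = x)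
    (by simp) (fun x y hx hy => ?_) (fun i x hx => ?_) x
  · simp only [map_add, Finset.sum_add_distrib, hx, hy]
  · simp only [S.proj_of_mem hx]
    by_cases hi : i ≤ S.step
    · rw [Finset.sum_ite_eq, if_pos (by simp; omega)]
    · rw [S.layer_of_lt i (by omega), Submodule.mem_bot] at hx
      simp [hx]

theorem weightMap_of_mem (c : ℕ → ℝ) {i : ℕ} {x : 𝔤} (hx : x ∈ S.layer i) :
    S.weightMap c x = c i • x := by
  simp only [weightMap, LinearMap.sum_apply, LinearMap.smul_apply, S.proj_of_mem hx]
  by_cases hi : i ≤ S.step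
  · simp only [smul_ite, smul_zero]
    rw [Finset.sum_ite_eq, if_pos (by simp; omega)]
  · rw [S.layer_of_lt i (by omega), Submodule.mem_bot] at hx
    simp [hx]

theorem proj_weightMap (c : ℕ → ℝ) (i : ℕ) (x : 𝔤) :
    S.proj i (S.weightMap c x) = c i • S.proj i x := by
  refine S.layer_induction (p := fun x => S.proj i (S.weightMap c x) = c i • S.proj i x)
    (by simp) (fun x y hx hy => ?_) (fun j x hx => ?_) x
  · simp only [map_add, smul_add, hx, hy]
  · rw [S.weightMap_of_mem c hx, map_smul, S.proj_of_mem hx]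
    split_ifs with h
    · rw [h]
    · simp

theorem degree_lie (x y : 𝔤) : S.degree ⁅x, y⁆ = ⁅S.degree x, y⁆ + ⁅x, S.degree y⁆ := by
  refine S.layer_induction
    (p := fun x => S.degree ⁅x, y⁆ = ⁅S.degree x, y⁆ + ⁅x, S.degree y⁆)
    (by simp) (fun x x' hx hx' => ?_) (fun i x hx => ?_) x
  · simp only [map_add, add_lie, hx, hx']; abel
  · refine S.layer_induction
      (p := fun y => S.degree ⁅x, y⁆ = ⁅S.degree x, y⁆ + ⁅x, S.degree y⁆)
      (by simp) (fun y y' hy hy' => ?_) (fun j y hy => ?_) y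
    · simp only [map_add, lie_add, hy, hy']; abel
    · rw [degree, S.weightMap_of_mem _ hx, S.weightMap_of_mem _ hy,
        S.weightMap_of_mem _ (S.lie_mem i j x y hx hy), smul_lie, lie_smul, ← add_smul]
      push_cast; rfl

/-- The filtration `⊕_{i ≥ n} V_i`. -/
def filt (n : ℕ) : Submodule ℝ 𝔤 := ⨅ i ∈ Finset.range n, LinearMap.ker (S.proj i)

theorem mem_filt {n : ℕ} {x : 𝔤} : x ∈ S.filt n ↔ ∀ i < n, S.proj i x = 0 := by
  simp [filt]

theorem mem_filt_one (x : 𝔤) : x ∈ S.filt 1 := by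
  rw [mem_filt]
  intro i hi
  obtain rfl : i = 0 := by omega
  exact S.proj_zero x

theorem filt_anti {m n : ℕ} (h : m ≤ n) {x : 𝔤} (hx : x ∈ S.filt n) : x ∈ S.filt m := by
  rw [mem_filt] at *
  exact fun i hi => hx i (by omega)

theorem eq_zero_of_mem_filt {n : ℕ} (h : S.step < n) {x : 𝔤} (hx : x ∈ S.filt n) : x = 0 := by
  rw [mem_filt] at hx
  rw [← S.sum_proj x]
  exact Finset.sum_eq_zero fun i hi => hx i (by simp only [Finset.mem_range] at hi; omega)

theorem mem_filt_of_mem_layer {m n : ℕ} (h : n ≤ m) {x : 𝔤} (hx : x ∈ S.layer m) :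
    x ∈ S.filt n := by
  rw [mem_filt]
  intro i hi
  rw [S.proj_of_mem hx, if_neg (by omega)]

theorem lie_mem_filt {m n : ℕ} {x y : 𝔤} (hx : x ∈ S.filt m) (hy : y ∈ S.filt n) :
    ⁅x, y⁆ ∈ S.filt (m + n) := by
  have key : ∀ i j, ⁅S.proj i x, S.proj j y⁆ ∈ S.filt (m + n) := by
    intro i j
    by_cases hi : i < m
    · rw [S.mem_filt.1 hx i hi, zero_lie]; exact zero_mem _
    by_cases hj : j < n
    · rw [S.mem_filt.1 hy j hj, lie_zero]; exact zero_mem _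
    exact S.mem_filt_of_mem_layer (by omega)
      (S.lie_mem i j _ _ (S.proj_mem i x) (S.proj_mem j y))
  rw [← S.sum_proj x, ← S.sum_proj y]
  simp only [sum_lie, lie_sum]
  exact sum_mem fun j _ => sum_mem fun i _ => key i j

theorem proj_degree (i : ℕ) (x : 𝔤) : S.proj i (S.degree x) = (i : ℝ) • S.proj i x :=
  S.proj_weightMap _ i x

theorem degree_mem_filt {n : ℕ} {x : 𝔤} : S.degree x ∈ S.filt n ↔ x ∈ S.filt n := by
  simp only [mem_filt, proj_degree, smul_eq_zero, Nat.cast_eq_zero]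
  refine forall₂_congr fun i _ => ⟨?_, Or.inr⟩
  rintro (rfl | h)
  · exact S.proj_zero x
  · exact h

/-- The inverse of the grading derivation. -/
def degreeInv : 𝔤 →ₗ[ℝ] 𝔤 := S.weightMap fun i => (i : ℝ)⁻¹

theorem eq_of_proj_eq {x y : 𝔤} (h : ∀ i, S.proj i x = S.proj i y) : x = y := by
  rw [← S.sum_proj x, ← S.sum_proj y]
  exact Finset.sum_congr rfl fun i _ => h i

theorem degree_degreeInv (x : 𝔤) : S.degree (S.degreeInv x) = x := by
  refine S.eq_of_proj_eq fun i => ?_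
  rw [proj_degree, degreeInv, proj_weightMap, smul_smul]
  rcases Nat.eq_zero_or_pos i with rfl | hi
  · rw [S.proj_zero, smul_zero]
  · rw [mul_inv_cancel₀ (by positivity), one_smul]

/-- `e ^ (ad X)` -/
def expAd (X : 𝔤) : Module.End ℝ 𝔤 := nilExp (S.step + 1) (LieAlgebra.ad ℝ 𝔤 X)

theorem ad_pow_mem_filt (X : 𝔤) (k : ℕ) {n : ℕ} {y : 𝔤} (hy : y ∈ S.filt n) :
    ((LieAlgebra.ad ℝ 𝔤 X) ^ k) y ∈ S.filt (k + n) := by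
  induction k with
  | zero => simpa using hy
  | succ k ih =>
    rw [pow_succ', Module.End.mul_apply, LieAlgebra.ad_apply]
    have := S.lie_mem_filt (S.mem_filt_one X) ih
    rwa [show k + 1 + n = 1 + (k + n) by ring]

theorem ad_pow_eq_zero (X : 𝔤) {k : ℕ} (hk : S.step < k) : (LieAlgebra.ad ℝ 𝔤 X) ^ k = 0 := by
  ext y
  exact S.eq_zero_of_mem_filt hk (S.ad_pow_mem_filt X k (n := 0) (by simp [mem_filt]))

theorem expAd_mul_ad (X y : 𝔤) :
    S.expAd X * LieAlgebra.ad ℝ 𝔤 y = LieAlgebra.ad ℝ 𝔤 (S.expAd X y) * S.expAd X := by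
  have h := nilExp_mul_eq (S.step + 1) (LieAlgebra.ad ℝ 𝔤 X)
    (fun k => LieAlgebra.ad ℝ 𝔤 (((LieAlgebra.ad ℝ 𝔤 X) ^ k) y)) (fun k => ?_) (fun k m hkm => ?_)
  · simp only [pow_zero, Module.End.one_apply] at h
    rw [expAd, h]
    congr 1
    simp only [nilExp, LinearMap.sum_apply, LinearMap.smul_apply, map_sum, map_smul]
  · rw [pow_succ', Module.End.mul_apply, LieAlgebra.ad_apply, LieHom.map_lie, Ring.lie_def]
  · ext z
    rw [Module.End.mul_apply, LieAlgebra.ad_apply, LinearMap.zero_apply]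
    refine S.eq_zero_of_mem_filt (n := k + 1 + (m + 0)) (by omega) (S.lie_mem_filt
      (S.ad_pow_mem_filt X k (S.mem_filt_one y))
      (S.ad_pow_mem_filt X m (by simp [mem_filt])))

/-- `∑_k (ad X) ^ k (D X) / (k + 1)!`, where `D` is the grading derivation. -/
def logDer (X : 𝔤) : 𝔤 :=
  ∑ k ∈ Finset.range S.step, (((k + 1)! : ℝ))⁻¹ • ((LieAlgebra.ad ℝ 𝔤 X) ^ k) (S.degree X)

theorem degree_mul_ad (x : 𝔤) : S.degree * LieAlgebra.ad ℝ 𝔤 x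
    = LieAlgebra.ad ℝ 𝔤 x * S.degree + LieAlgebra.ad ℝ 𝔤 (S.degree x) := by
  ext y
  simp [degree_lie, add_comm]

theorem degree_mul_expAd (X : 𝔤) : S.degree * S.expAd X
    = S.expAd X * S.degree + LieAlgebra.ad ℝ 𝔤 (S.logDer X) * S.expAd X := by
  have h := nilExp_mul_eq (S.step + 1) (LieAlgebra.ad ℝ 𝔤 X)
    (fun k => Nat.casesOn k S.degree
      fun k => - LieAlgebra.ad ℝ 𝔤 (((LieAlgebra.ad ℝ 𝔤 X) ^ k) (S.degree X)))
    (fun k => ?_) (fun k m hkm => ?_)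
  · rw [Finset.sum_range_succ'] at h
    simp only [Nat.factorial_zero, Nat.cast_one, inv_one, one_smul] at h
    change nilExp (S.step + 1) (LieAlgebra.ad ℝ 𝔤 X) * S.degree = (_ + S.degree) * _ at h
    rw [expAd, h, add_mul, add_right_comm, ← add_mul]
    rw [right_eq_add]
    convert zero_mul _
    simp only [logDer, map_sum, map_smul, smul_neg, Finset.sum_neg_distrib, neg_add_cancel]
  · cases k with
    | zero =>
      change - LieAlgebra.ad ℝ 𝔤 (S.degree X)
        = LieAlgebra.ad ℝ 𝔤 X * S.degree - S.degree * LieAlgebra.ad ℝ 𝔤 X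
      rw [degree_mul_ad]
      abel
    | succ k =>
      simp only
      rw [pow_succ', Module.End.mul_apply, LieAlgebra.ad_apply, LieHom.map_lie, Ring.lie_def]
      noncomm_ring
  · cases k with
    | zero =>
      rw [S.ad_pow_eq_zero X (by omega), mul_zero]
    | succ k =>
      ext z
      simp only [Module.End.mul_apply, LinearMap.neg_apply, LieAlgebra.ad_apply,
        LinearMap.zero_apply, neg_eq_zero]
      refine S.eq_zero_of_mem_filt (n := k + 1 + (m + 0)) (by omega) (S.lie_mem_filt
        (S.ad_pow_mem_filt X k (S.mem_filt_one _))
        (S.ad_pow_mem_filt X m (by simp [mem_filt])))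

theorem expAd_sub_mem_filt (X : 𝔤) {n : ℕ} {y : 𝔤} (hy : y ∈ S.filt n) :
    S.expAd X y - y ∈ S.filt (n + 1) := by
  simp only [expAd, nilExp, Finset.sum_range_succ', LinearMap.add_apply, LinearMap.sum_apply,
    LinearMap.smul_apply, pow_zero, Nat.factorial_zero, Nat.cast_one, inv_one, one_smul,
    Module.End.one_apply, add_sub_cancel_right]
  exact sum_mem fun k _ => Submodule.smul_mem _ _
    (S.filt_anti (by omega) (S.ad_pow_mem_filt X (k + 1) hy))

theorem expAd_mem_filt (X : 𝔤) {n : ℕ} {y : 𝔤} (hy : y ∈ S.filt n) :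
    S.expAd X y ∈ S.filt n := by
  have := add_mem (S.filt_anti (Nat.le_succ n) (S.expAd_sub_mem_filt X hy)) hy
  rwa [sub_add_cancel] at this

theorem expAd_eq_mul {X Y Z : 𝔤} (h : S.logDer Z = S.logDer X + S.expAd X (S.logDer Y)) :
    S.expAd Z = S.expAd X * S.expAd Y := by
  set w : Module.End ℝ 𝔤 := S.expAd Z - S.expAd X * S.expAd Y with hw
  have hD : S.degree * w = w * S.degree + LieAlgebra.ad ℝ 𝔤 (S.logDer Z) * w := by
    have h1 : S.degree * (S.expAd X * S.expAd Y) = S.expAd X * S.expAd Y * S.degree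
        + LieAlgebra.ad ℝ 𝔤 (S.logDer Z) * (S.expAd X * S.expAd Y) := by
      rw [← mul_assoc, degree_mul_expAd, add_mul, mul_assoc, degree_mul_expAd, mul_add, h, map_add,
        add_mul, ← mul_assoc (S.expAd X) (LieAlgebra.ad ℝ 𝔤 _), expAd_mul_ad]
      noncomm_ring
    rw [hw, mul_sub, h1, degree_mul_expAd]
    noncomm_ring
  have hmem : ∀ n, ∀ i, ∀ y ∈ S.layer i, w y ∈ S.filt (i + n + 1) := by
    intro n
    induction n with
    | zero =>
      intro i y hy
      have hy' : y ∈ S.filt i := S.mem_filt_of_mem_layer le_rfl hy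
      have h1 := S.expAd_sub_mem_filt Z hy'
      have h2 := S.expAd_sub_mem_filt X (S.expAd_mem_filt Y hy')
      have h3 := S.expAd_sub_mem_filt Y hy'
      have h4 : w y = (S.expAd Z y - y) - (S.expAd X (S.expAd Y y) - S.expAd Y y)
          - (S.expAd Y y - y) := by
        simp only [hw, LinearMap.sub_apply, Module.End.mul_apply]; abel
      rw [h4]
      exact sub_mem (sub_mem h1 h2) h3
    | succ n ih =>
      intro i y hy
      have h1 := ih i y hy
      have h2 : S.degree (w y) - (i : ℝ) • w y ∈ S.filt (i + n + 1 + 1) := by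
        have h3 := LinearMap.congr_fun hD y
        simp only [Module.End.mul_apply, LinearMap.add_apply, LieAlgebra.ad_apply] at h3
        rw [h3, degree, S.weightMap_of_mem _ hy, map_smul, add_sub_cancel_left]
        have := S.lie_mem_filt (S.mem_filt_one (S.logDer Z)) h1
        rwa [show i + n + 1 + 1 = 1 + (i + n + 1) by ring]
      rw [mem_filt] at h1 h2 ⊢
      intro j hj
      by_cases hj' : j < i + n + 1
      · exact h1 j hj'
      · have h4 := h2 j (by omega)
        rw [map_sub, map_smul, proj_degree, ← sub_smul, smul_eq_zero] at h4
        refine h4.resolve_left fun h5 => ?_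
        rw [sub_eq_zero, Nat.cast_inj] at h5
        omega
  have hw0 : w = 0 := by
    ext y
    refine S.layer_induction (p := fun y => w y = 0) (by simp) (fun x y hx hy => ?_)
      (fun i y hy => ?_) y
    · rw [map_add, hx, hy, add_zero]
    · exact S.eq_zero_of_mem_filt (n := i + S.step + 1) (by omega) (hmem S.step i y hy)
  exact sub_eq_zero.1 hw0

theorem logDer_sub_mem {X Y : 𝔤} {n : ℕ} (hXY : X - Y ∈ S.filt n) :
    S.logDer X - S.logDer Y - S.degree (X - Y) ∈ S.filt (n + 1) := by
  have h0 : ∀ k, ((LieAlgebra.ad ℝ 𝔤 X) ^ k) (S.degree X)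
      - ((LieAlgebra.ad ℝ 𝔤 Y) ^ k) (S.degree Y) ∈ S.filt (n + k) := by
    intro k
    induction k with
    | zero => simpa [← map_sub, degree_mem_filt] using hXY
    | succ k ih =>
      have h1 := S.lie_mem_filt hXY (S.ad_pow_mem_filt X k (S.mem_filt_one (S.degree X)))
      have h2 := S.lie_mem_filt (S.mem_filt_one Y) ih
      have h3 : ((LieAlgebra.ad ℝ 𝔤 X) ^ (k + 1)) (S.degree X)
          - ((LieAlgebra.ad ℝ 𝔤 Y) ^ (k + 1)) (S.degree Y)
          = ⁅X - Y, ((LieAlgebra.ad ℝ 𝔤 X) ^ k) (S.degree X)⁆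
            + ⁅Y, ((LieAlgebra.ad ℝ 𝔤 X) ^ k) (S.degree X)
              - ((LieAlgebra.ad ℝ 𝔤 Y) ^ k) (S.degree Y)⁆ := by
        simp only [pow_succ', Module.End.mul_apply, LieAlgebra.ad_apply, sub_lie, lie_sub]
        abel
      rw [h3]
      exact add_mem (S.filt_anti (by omega) h1) (S.filt_anti (by omega) h2)
  rcases Nat.eq_zero_or_pos S.step with hs | hs
  · have hz : ∀ x : 𝔤, x = 0 := fun x => S.eq_zero_of_mem_filt (n := 1) (by omega) (S.mem_filt_one x)
    rw [hz (_ - _ - _)]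
    exact zero_mem _
  · obtain ⟨s, hs'⟩ : ∃ s, S.step = s + 1 := ⟨S.step - 1, by omega⟩
    rw [logDer, logDer, hs', Finset.sum_range_succ', Finset.sum_range_succ']
    have h4 : ∀ (a b : 𝔤), a + (((0 + 1)! : ℝ))⁻¹ • ((LieAlgebra.ad ℝ 𝔤 X) ^ 0) (S.degree X)
        - (b + (((0 + 1)! : ℝ))⁻¹ • ((LieAlgebra.ad ℝ 𝔤 Y) ^ 0) (S.degree Y))
        - S.degree (X - Y) = a - b := by
      intro a b
      simp only [zero_add, Nat.factorial_one, Nat.cast_one, inv_one, one_smul, pow_zero,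
        Module.End.one_apply, map_sub]
      abel
    rw [h4, ← Finset.sum_sub_distrib]
    refine sum_mem fun k _ => ?_
    rw [← smul_sub]
    exact Submodule.smul_mem _ _ (S.filt_anti (by omega) (h0 (k + 1)))

theorem logDer_bijective : Function.Bijective S.logDer := by
  constructor
  · intro X Y h
    have hn : ∀ n, X - Y ∈ S.filt (n + 1) := by
      intro n
      induction n with
      | zero => exact S.mem_filt_one _
      | succ n ih =>
        have h1 := S.logDer_sub_mem ih
        rwa [h, sub_self, zero_sub, neg_mem_iff, degree_mem_filt] at h1
    exact sub_eq_zero.1 (S.eq_zero_of_mem_filt (Nat.lt_succ_self _) (hn S.step))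
  · intro q
    have hn : ∀ n, ∃ Z, S.logDer Z - q ∈ S.filt (n + 1) := by
      intro n
      induction n with
      | zero => exact ⟨0, S.mem_filt_one _⟩
      | succ n ih =>
        obtain ⟨Z, hZ⟩ := ih
        set v := S.degreeInv (S.logDer Z - q) with hv
        have hDv : S.degree v = S.logDer Z - q := S.degree_degreeInv _
        have hvm : v ∈ S.filt (n + 1) := by rwa [← degree_mem_filt, hDv]
        have h1 := S.logDer_sub_mem (X := Z - v) (Y := Z) (n := n + 1)
          (by rwa [sub_sub_cancel_left, neg_mem_iff])
        refine ⟨Z - v, ?_⟩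
        rw [sub_sub_cancel_left, map_neg, hDv] at h1
        convert h1 using 1
        abel
    obtain ⟨Z, hZ⟩ := hn S.step
    exact ⟨Z, sub_eq_zero.1 (S.eq_zero_of_mem_filt (Nat.lt_succ_self _) hZ)⟩

/-- The linear map `(Y, t) ↦ ([X, Y] + t D X, 0)` of `𝔤 × ℝ`, where `D` is the grading
derivation. -/
def repMap (X : 𝔤) : Module.End ℝ (𝔤 × ℝ) :=
  LinearMap.inl ℝ 𝔤 ℝ ∘ₗ
    ((LieAlgebra.ad ℝ 𝔤 X).coprod (LinearMap.toSpanSingleton ℝ 𝔤 (S.degree X)))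

theorem repMap_apply (X : 𝔤) (p : 𝔤 × ℝ) :
    S.repMap X p = (⁅X, p.1⁆ + p.2 • S.degree X, 0) := by
  simp [repMap]

/-- The faithful nilpotent representation of `𝔤` on `𝔤 × ℝ` which comes from the adjoint
representation of the semidirect product of `𝔤` with its grading derivation `D`: the element `X`
acts by `(Y, t) ↦ ([X, Y] + t D X, 0)`. -/
def rep : 𝔤 →ₗ⁅ℝ⁆ Module.End ℝ (𝔤 × ℝ) where
  toFun := S.repMap
  map_add' X Y := by
    refine LinearMap.ext fun p => ?_
    simp only [LinearMap.add_apply, repMap_apply, add_lie, map_add, smul_add, Prod.mk_add_mk,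
      add_zero]
    congr 1
    abel
  map_smul' c X := by
    refine LinearMap.ext fun p => ?_
    simp only [LinearMap.smul_apply, repMap_apply, smul_lie, map_smul, RingHom.id_apply,
      Prod.smul_mk, smul_add, smul_zero, smul_comm c]
  map_lie' {X Y} := by
    refine LinearMap.ext fun p => ?_
    simp only [Ring.lie_def, LinearMap.sub_apply, Module.End.mul_apply, repMap_apply, degree_lie,
      zero_smul, add_zero, lie_add, lie_smul, Prod.mk_sub_mk, sub_zero, smul_add]
    congr 1
    rw [lie_lie, ← lie_skew (S.degree X) Y]
    simp only [smul_neg]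
    abel

theorem rep_apply (X : 𝔤) (p : 𝔤 × ℝ) : S.rep X p = (⁅X, p.1⁆ + p.2 • S.degree X, 0) :=
  S.repMap_apply X p

theorem rep_injective : Function.Injective S.rep := by
  intro X Y h
  have h1 := LinearMap.congr_fun h (0, 1)
  simp only [rep_apply, lie_zero, one_smul, zero_add, Prod.mk.injEq, and_true] at h1
  have h2 : ∀ n, X - Y ∈ S.filt n := fun n => by
    rw [← degree_mem_filt, map_sub, h1, sub_self]; exact zero_mem _
  exact sub_eq_zero.1 (S.eq_zero_of_mem_filt (Nat.lt_succ_self _) (h2 (S.step + 1)))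

theorem rep_pow_succ (X : 𝔤) (k : ℕ) (p : 𝔤 × ℝ) : ((S.rep X) ^ (k + 1)) p
    = (((LieAlgebra.ad ℝ 𝔤 X) ^ (k + 1)) p.1
        + p.2 • ((LieAlgebra.ad ℝ 𝔤 X) ^ k) (S.degree X), 0) := by
  induction k with
  | zero => simp [rep_apply]
  | succ k ih =>
    rw [pow_succ', Module.End.mul_apply, ih, rep_apply]
    simp [pow_succ' _ (k + 1), pow_succ' _ k]

theorem rep_pow_eq_zero (X : 𝔤) : (S.rep X) ^ (S.step + 1) = 0 := by
  have h : ((LieAlgebra.ad ℝ 𝔤 X) ^ S.step) (S.degree X) = 0 :=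
    S.eq_zero_of_mem_filt (n := S.step + 1) (by omega)
      (S.ad_pow_mem_filt X S.step (S.mem_filt_one (S.degree X)))
  refine LinearMap.ext fun p => ?_
  refine (S.rep_pow_succ X S.step p).trans ?_
  have h' := S.ad_pow_eq_zero X (Nat.lt_succ_self S.step)
  simp [h, h']

/-- The exponential `e ^ (rep X)`. -/
def expRep (X : 𝔤) : Module.End ℝ (𝔤 × ℝ) := nilExp (S.step + 1) (S.rep X)

theorem expRep_apply (X : 𝔤) (p : 𝔤 × ℝ) :
    S.expRep X p = (S.expAd X p.1 + p.2 • S.logDer X, p.2) := by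
  simp only [expRep, expAd, nilExp, logDer, Finset.sum_range_succ', LinearMap.add_apply,
    LinearMap.sum_apply, LinearMap.smul_apply, rep_pow_succ, Prod.smul_mk, smul_zero, smul_add]
  ext
  · simp only [Prod.fst_add, Prod.fst_sum, Finset.sum_add_distrib, Finset.smul_sum, pow_zero,
      Module.End.one_apply, Prod.smul_fst, smul_comm p.2]
    abel
  · simp [Prod.snd_sum]

theorem expRep_eq_mul_iff {X Y Z : 𝔤} : S.expRep Z = S.expRep X * S.expRep Y
    ↔ S.logDer Z = S.logDer X + S.expAd X (S.logDer Y) := by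
  constructor
  · intro h
    have h1 := congrArg Prod.fst (LinearMap.congr_fun h (0, 1))
    simpa [Module.End.mul_apply, expRep_apply, add_comm] using h1
  · intro h
    refine LinearMap.ext fun p => ?_
    simp only [Module.End.mul_apply, expRep_apply, S.expAd_eq_mul h, h, map_add, map_smul,
      smul_add]
    congr 1
    abel

theorem expRep_injective : Function.Injective S.expRep := by
  intro X Y h
  have h1 := congrArg Prod.fst (LinearMap.congr_fun h (0, 1))
  simp only [expRep_apply, map_zero, zero_add, one_smul] at h1
  exact S.logDer_bijective.1 h1

theorem exists_expRep_eq_mul (X Y : 𝔤) : ∃ Z, S.expRep Z = S.expRep X * S.expRep Y := by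
  obtain ⟨Z, hZ⟩ := S.logDer_bijective.2 (S.logDer X + S.expAd X (S.logDer Y))
  exact ⟨Z, S.expRep_eq_mul_iff.2 hZ⟩

/-- The Baker-Campbell-Hausdorff product `Z = log (exp X exp Y)`: the unique `Z ∈ 𝔤` such that
`e ^ (rep Z) = e ^ (rep X) e ^ (rep Y)`. -/
def bch (X Y : 𝔤) : 𝔤 := (S.exists_expRep_eq_mul X Y).choose

theorem expRep_bch (X Y : 𝔤) : S.expRep (S.bch X Y) = S.expRep X * S.expRep Y :=
  (S.exists_expRep_eq_mul X Y).choose_spec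

theorem expRep_zero : S.expRep 0 = 1 := by
  simp [expRep, nilExp, Finset.sum_range_succ']

theorem expRep_neg_mul (X : 𝔤) : S.expRep (-X) * S.expRep X = 1 := by
  have h := nilExp_mul_nilExp_neg S.step (S.rep (-X)) (S.rep_pow_eq_zero (-X))
  rwa [map_neg, neg_neg, ← map_neg] at h

end Stratification

/-- The Carnot group of a stratified Lie algebra `𝔤`, that is, the simply connected Lie group with
Lie algebra `𝔤`. Its elements are `exp X` with a unique `X ∈ 𝔤` (the exponential map of a simply
connected nilpotent Lie group is a diffeomorphism), and `X ↦ e ^ (rep X)` is a faithful linear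
representation of it. -/
@[ext]
structure CarnotGroup {𝔤 : Type*} [LieRing 𝔤] [LieAlgebra ℝ 𝔤] (S : Stratification 𝔤) where
  /-- The exponential map `𝔤 → G`. -/
  exp ::
  /-- The inverse of the exponential map. -/
  log : 𝔤

namespace CarnotGroup

variable {𝔤 : Type*} [LieRing 𝔤] [LieAlgebra ℝ 𝔤] {S : Stratification 𝔤}

instance : Mul (CarnotGroup S) := ⟨fun g h => exp (S.bch g.log h.log)⟩

instance : One (CarnotGroup S) := ⟨exp 0⟩

instance : Inv (CarnotGroup S) := ⟨fun g => exp (-g.log)⟩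

theorem expRep_log_mul (g h : CarnotGroup S) :
    S.expRep (g * h).log = S.expRep g.log * S.expRep h.log := S.expRep_bch _ _

theorem expRep_log_injective : Function.Injective fun g : CarnotGroup S => S.expRep g.log :=
  fun _ _ h => CarnotGroup.ext (S.expRep_injective h)

instance : Group (CarnotGroup S) :=
  Group.ofLeftAxioms
    (fun a b c => expRep_log_injective (by simp only [expRep_log_mul, mul_assoc]))
    (fun a => expRep_log_injective
      (by simp only [expRep_log_mul]; exact (congrArg (· * _) S.expRep_zero).trans (one_mul _)))
    (fun a => expRep_log_injective
      (by simp only [expRep_log_mul]; exact (S.expRep_neg_mul a.log).trans S.expRep_zero.symm))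

/-- The manifold topology of `G`, for which `exp` is a homeomorphism. -/
instance [TopologicalSpace 𝔤] : TopologicalSpace (CarnotGroup S) :=
  TopologicalSpace.induced log inferInstance

/-- The Carnot dilation `δ_t` of `G`, induced by multiplication by `t ^ i` on `V_i`. -/
def dilation (t : ℝ) (g : CarnotGroup S) : CarnotGroup S :=
  exp (S.weightMap (fun i => t ^ i) g.log)

/-- The connected subgroup `exp 𝔥` of `G`, the one generated by a Lie subalgebra `𝔥`. -/
def subgroupOf (𝔥 : LieSubalgebra ℝ 𝔤) : Subgroup (CarnotGroup S) :=
  Subgroup.closure (exp '' (𝔥 : Set 𝔤))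

section Metric

/-- The derivative `(X F)(g)` of `F : G → ℝ` along the left invariant vector field given by
`X ∈ 𝔤`. -/
def leftInvariantDeriv (X : 𝔤) (F : CarnotGroup S → ℝ) (g : CarnotGroup S) : ℝ :=
  deriv (fun s : ℝ => F (g * exp (s • X))) 0

variable [TopologicalSpace 𝔤]

/-- `γ : [0, 1] → G` is a `C¹` path from `x` to `y` whose velocity at the time `t` is the value at
`γ t` of the left invariant vector field of `u t ∈ V₁`, with `u` continuous. The velocity is tested
on the linear coordinate functions `ξ ∘ log` of `G`, where `ξ` is a linear functional on `𝔤`. -/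
structure IsHorizontalPath (γ : ℝ → CarnotGroup S) (u : ℝ → S.layer 1) (x y : CarnotGroup S) :
    Prop where
  source : γ 0 = x
  target : γ 1 = y
  continuousOn : ContinuousOn u (Icc 0 1)
  hasDerivWithinAt : ∀ ξ : Module.Dual ℝ 𝔤, ∀ t ∈ Icc (0 : ℝ) 1,
    HasDerivWithinAt (fun τ => ξ (γ τ).log)
      (leftInvariantDeriv (u t : 𝔤) (fun g => ξ g.log) (γ t)) (Icc 0 1) t

/-- The Carnot-Carathéodory distance for the inner product `ip` on `V₁`: the infimal length of a
horizontal path (any two points are joined by one, since `V₁` generates `𝔤`). -/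
def ccDist (ip : InnerProductSpace.Core ℝ (S.layer 1)) (x y : CarnotGroup S) : ℝ :=
  sInf {ℓ : ℝ | ∃ γ : ℝ → CarnotGroup S, ∃ u : ℝ → S.layer 1, IsHorizontalPath γ u x y ∧
    ℓ = ∫ t in (0 : ℝ)..1, √(ip.inner (u t) (u t))}

/-- The open ball of the Carnot-Carathéodory distance. -/
def ccBall (ip : InnerProductSpace.Core ℝ (S.layer 1)) (x : CarnotGroup S) (r : ℝ) :
    Set (CarnotGroup S) := {y | ccDist ip x y < r}

/-- `f` is `η`-quasisymmetric on `U`, for a homeomorphism `η : [0, ∞) → [0, ∞)`. -/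
def IsQuasisymmetricOn (ip : InnerProductSpace.Core ℝ (S.layer 1)) (η : ℝ≥0 ≃ₜ ℝ≥0)
    (f : CarnotGroup S → CarnotGroup S) (U : Set (CarnotGroup S)) : Prop :=
  ∀ p ∈ U, ∀ x ∈ U, ∀ y ∈ U, p ≠ x → p ≠ y → x ≠ y →
    ccDist ip (f p) (f x) / ccDist ip (f p) (f y)
      ≤ η (Real.toNNReal (ccDist ip p x / ccDist ip p y))

/-- `f` is `L`-bilipschitz on `U`. -/
def IsBilipschitzOn (ip : InnerProductSpace.Core ℝ (S.layer 1)) (L : ℝ)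
    (f : CarnotGroup S → CarnotGroup S) (U : Set (CarnotGroup S)) : Prop :=
  ∀ y ∈ U, ∀ z ∈ U, L⁻¹ * ccDist ip y z ≤ ccDist ip (f y) (f z) ∧
    ccDist ip (f y) (f z) ≤ L * ccDist ip y z

end Metric

/-- The homeomorphism `f : U → U'` between open subsets of `G` preserves the coset foliation
of `H`. -/
def PreservesCosetFoliation [TopologicalSpace 𝔤]
    (f : OpenPartialHomeomorph (CarnotGroup S) (CarnotGroup S)) (H : Subgroup (CarnotGroup S)) :
    Prop :=
  ∀ g : CarnotGroup S, ∃ g' : CarnotGroup S,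
    f '' (f.source ∩ g • (H : Set (CarnotGroup S)))
      = f.target ∩ g' • (H : Set (CarnotGroup S))

end CarnotGroup

end

/-! ### The logarithmic coordinate, smoothness of the group law, dilations -/

noncomputable section

/-! Write `X₁` for the component of `X` in `V₁`, and call the left cosets of `H` fibres. The
condition on `W` makes `[W, W]` central (`lie_derived`), so that `𝔥 = W ⊕ [W, W]`, and conjugation
by `h ∈ H` changes `X` only by a bracket of first-layer components, which lies in `V₂`
(`expAd_apply`). The Carnot-Carathéodory distance is comparable to a homogeneous quasi-norm whose
square contains the `V₂` component to the first power. Hence the squared distance from `h ∈ H` to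
another fibre is comparable to `E + ‖Y + T h₁‖`, a constant plus the norm of an affine function
(`exists_fibre_dist`). Moreover, at every scale there are fibres parallel to a given one: `k⁻¹ H k ⊆
H` for suitable `k`, so right translation by `k` moves a whole fibre onto another by a constant
distance (`exists_parallel`).

Let the stretch of `f` at `q` and scale `a` be the distance of the images of `q` and of `q exp (a
w₀)`, where `w₀ ∈ W` has unit speed. By quasisymmetry it is comparable to the distance from `f q` to
the image of a parallel fibre at distance about `a`. So along a fibre its square is comparable to `E
+ ‖affine function‖` in the first-layer coordinate of the image (`exists_stretch_comparison`).

The central claim is that on a piece of a fibre of radius `D ≥ a` around `p` the stretch at scale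
`a` is at most a constant times the stretch at `p` (`exists_stretch_le_on_fibre`). Let `q` be an
almost maximal point, let `v` be the first-layer component of `p⁻¹ q`, and let `q'` be the point
over `v - c v` with a small `c`. Almost maximality bounds the linear part of the affine function, so
the stretch at `q'` is still comparable to that at `q` (`exists_almost_maximal`). If the stretch at
`p` were far smaller, take in the image a parallel fibre at distance about the stretch at `p`. Its
preimage would be a fibre within a small multiple of `a` of both `q` and `q'`. In the source the
squared distance to this preimage is again of affine type. Being small over `v` and over `(1 - c)
v`, it is small over `0` by extrapolation, so the preimage passes much closer to `p` than `a`.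
Quasisymmetry at `p` forbids this.

Adding up about `D / a` steps along the line `p exp (s w₀)`, the ratio of stretch to scale at scale
`D` is at most a constant times the same ratio at scale `a` (`exists_stretch_ratio_le`). Applied to
`f` this bounds `d (f y, f z)` below, applied to `f⁻¹` it bounds it above, both in terms of the
stretch at one fixed scale, which the dilation normalises (`exists_bilipschitz_of_isControlled`).

The groundwork is Chow's theorem and the comparison of the distance with the quasi-norm. It rests on
the coordinate `logDer`, a cocycle for the adjoint action: in it left translations are affine and
horizontal paths satisfy a simple equation. -/

/-- A Euclidean norm on a finite-dimensional Lie algebra. -/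
@[reducible] def lieNorm (𝔤 : Type*) [LieRing 𝔤] [LieAlgebra ℝ 𝔤] [FiniteDimensional ℝ 𝔤] :
    NormedAddCommGroup 𝔤 :=
  NormedAddCommGroup.induced 𝔤 (EuclideanSpace ℝ (Fin (Module.finrank ℝ 𝔤)))
    ((Module.finBasis ℝ 𝔤).equivFun.trans (WithLp.linearEquiv 2 ℝ _).symm)
    (LinearEquiv.injective _)

attribute [local instance] lieNorm

/-- The normed space structure which belongs to `lieNorm`. -/
@[reducible] def lieNormedSpace (𝔤 : Type*) [LieRing 𝔤] [LieAlgebra ℝ 𝔤]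
    [FiniteDimensional ℝ 𝔤] : NormedSpace ℝ 𝔤 :=
  NormedSpace.induced ℝ 𝔤 (EuclideanSpace ℝ (Fin (Module.finrank ℝ 𝔤)))
    ((Module.finBasis ℝ 𝔤).equivFun.trans (WithLp.linearEquiv 2 ℝ _).symm)

attribute [local instance] lieNormedSpace

section Calculus

variable {𝔤 : Type*} [LieRing 𝔤] [LieAlgebra ℝ 𝔤] [FiniteDimensional ℝ 𝔤]
variable {E : Type*} [NormedAddCommGroup E] [NormedSpace ℝ E] {n : WithTop ℕ∞}

theorem contDiff_lie : ContDiff ℝ n (fun p : 𝔤 × 𝔤 => ⁅p.1, p.2⁆) := by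
  let B : 𝔤 →L[ℝ] 𝔤 →L[ℝ] 𝔤 := LinearMap.toContinuousLinearMap
    ((LinearMap.toContinuousLinearMap : (𝔤 →ₗ[ℝ] 𝔤) ≃ₗ[ℝ] _).toLinearMap ∘ₗ
      (LieAlgebra.ad ℝ 𝔤 : 𝔤 →ₗ[ℝ] (𝔤 →ₗ[ℝ] 𝔤)))
  have := B.isBoundedBilinearMap.contDiff (n := n)
  simpa [B] using this

theorem ContDiff.lie {f g : E → 𝔤} (hf : ContDiff ℝ n f) (hg : ContDiff ℝ n g) :
    ContDiff ℝ n (fun x => ⁅f x, g x⁆) := contDiff_lie.comp (hf.prodMk hg)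

theorem LinearMap.contDiff_lie {F : Type*} [NormedAddCommGroup F] [NormedSpace ℝ F]
    (L : 𝔤 →ₗ[ℝ] F) : ContDiff ℝ n L := (LinearMap.toContinuousLinearMap L).contDiff

theorem ContDiff.ad_pow {f g : E → 𝔤} (hf : ContDiff ℝ n f) (hg : ContDiff ℝ n g) (k : ℕ) :
    ContDiff ℝ n (fun x => ((LieAlgebra.ad ℝ 𝔤 (f x)) ^ k) (g x)) := by
  induction k with
  | zero => simpa using hg
  | succ k ih =>
    simp only [pow_succ', Module.End.mul_apply, LieAlgebra.ad_apply]
    exact hf.lie ih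

end Calculus

namespace Stratification

variable {𝔤 : Type*} [LieRing 𝔤] [LieAlgebra ℝ 𝔤] (S : Stratification 𝔤)

/-- The iteration `Z ↦ Z - D⁻¹ (logDer Z - q)` for solving `logDer Z = q`. -/
def logDerInvIter (q : 𝔤) : ℕ → 𝔤
  | 0 => 0
  | n + 1 => logDerInvIter q n - S.degreeInv (S.logDer (logDerInvIter q n) - q)

/-- The inverse of `logDer`. -/
def logDerInv (q : 𝔤) : 𝔤 := S.logDerInvIter q S.step

/-- Up to terms one layer deeper, `logDer` changes by the grading derivation, so each correction
gains one layer and `step` corrections leave no error. An explicit iteration is used, instead of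
bijectivity, because the smoothness of the inverse can be read off from it. -/
theorem logDer_logDerInvIter_sub_mem (q : 𝔤) (n : ℕ) :
    S.logDer (S.logDerInvIter q n) - q ∈ S.filt (n + 1) := by
  induction n with
  | zero => exact S.mem_filt_one _
  | succ n ih =>
    rw [logDerInvIter]
    set Z := S.logDerInvIter q n
    set v := S.degreeInv (S.logDer Z - q) with hv
    have hDv : S.degree v = S.logDer Z - q := S.degree_degreeInv _
    have hvm : v ∈ S.filt (n + 1) := by rwa [← degree_mem_filt, hDv]
    have h1 := S.logDer_sub_mem (X := Z - v) (Y := Z) (n := n + 1)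
      (by rwa [sub_sub_cancel_left, neg_mem_iff])
    rw [sub_sub_cancel_left, map_neg, hDv] at h1
    convert h1 using 1
    abel

theorem logDer_logDerInv (q : 𝔤) : S.logDer (S.logDerInv q) = q :=
  sub_eq_zero.1 (S.eq_zero_of_mem_filt (Nat.lt_succ_self _)
    (S.logDer_logDerInvIter_sub_mem q S.step))

theorem logDerInv_logDer (X : 𝔤) : S.logDerInv (S.logDer X) = X :=
  S.logDer_bijective.1 (S.logDer_logDerInv _)

/-- The cocycle identity: in the coordinate `logDer`, left translation by `exp X` is affine with
linear part `Ad`. -/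
theorem logDer_bch (X Y : 𝔤) : S.logDer (S.bch X Y) = S.logDer X + S.expAd X (S.logDer Y) :=
  S.expRep_eq_mul_iff.1 (S.expRep_bch X Y)

theorem expAd_bch (X Y : 𝔤) : S.expAd (S.bch X Y) = S.expAd X * S.expAd Y :=
  S.expAd_eq_mul (S.logDer_bch X Y)

theorem bch_eq (X Y : 𝔤) : S.bch X Y = S.logDerInv (S.logDer X + S.expAd X (S.logDer Y)) := by
  rw [← logDer_bch, logDerInv_logDer]

theorem logDer_zero : S.logDer 0 = 0 := by
  simp [logDer]

theorem logDerInv_zero : S.logDerInv 0 = 0 := by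
  simpa [logDer_zero] using S.logDerInv_logDer 0

section Smooth

variable [FiniteDimensional ℝ 𝔤]
variable {E : Type*} [NormedAddCommGroup E] [NormedSpace ℝ E] {n : WithTop ℕ∞}

theorem contDiff_logDer : ContDiff ℝ n S.logDer := by
  unfold logDer
  exact ContDiff.sum fun k _ => (contDiff_id.ad_pow (S.degree.contDiff_lie) k).const_smul _

theorem contDiff_expAd {f g : E → 𝔤} (hf : ContDiff ℝ n f) (hg : ContDiff ℝ n g) :
    ContDiff ℝ n (fun x => S.expAd (f x) (g x)) := by
  simp only [expAd, nilExp, LinearMap.sum_apply, LinearMap.smul_apply]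
  exact ContDiff.sum fun k _ => (hf.ad_pow hg k).const_smul _

theorem contDiff_logDerInv : ContDiff ℝ n S.logDerInv := by
  have : ∀ k, ContDiff ℝ n (fun q => S.logDerInvIter q k) := by
    intro k
    induction k with
    | zero => exact contDiff_const
    | succ k ih =>
      exact ih.sub (S.degreeInv.contDiff_lie.comp ((S.contDiff_logDer.comp ih).sub contDiff_id))
  exact this S.step

/-- Through the cocycle identity the product is a composition of `logDer`, the polynomial `expAd`
and the iterated inverse of `logDer`, so no closed Baker-Campbell-Hausdorff formula is needed. -/
theorem contDiff_bch {f g : E → 𝔤} (hf : ContDiff ℝ n f) (hg : ContDiff ℝ n g) :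
    ContDiff ℝ n (fun x => S.bch (f x) (g x)) := by
  simp only [bch_eq]
  exact S.contDiff_logDerInv.comp
    ((S.contDiff_logDer.comp hf).add (S.contDiff_expAd hf (S.contDiff_logDer.comp hg)))

end Smooth

/-- On the first layer, `logDer` is the identity. -/
theorem logDer_of_mem {X : 𝔤} (hX : X ∈ S.layer 1) : S.logDer X = X := by
  have hD : S.degree X = X := by rw [degree, S.weightMap_of_mem _ hX]; simp
  rcases Nat.eq_zero_or_pos S.step with hs | hs
  · have hz : ∀ x : 𝔤, x = 0 := fun x => S.eq_zero_of_mem_filt (n := 1) (by omega) (S.mem_filt_one x)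
    rw [hz (S.logDer X), hz X]
  · obtain ⟨s, hs'⟩ : ∃ s, S.step = s + 1 := ⟨S.step - 1, by omega⟩
    rw [logDer, hs', Finset.sum_range_succ', hD]
    simp [pow_succ]

/-- The automorphism of `𝔤` which multiplies `V_i` by `t ^ i`. -/
def dil (t : ℝ) : 𝔤 →ₗ[ℝ] 𝔤 := S.weightMap fun i => t ^ i

theorem dil_of_mem (t : ℝ) {i : ℕ} {x : 𝔤} (hx : x ∈ S.layer i) : S.dil t x = t ^ i • x :=
  S.weightMap_of_mem _ hx

theorem proj_dil (t : ℝ) (i : ℕ) (x : 𝔤) : S.proj i (S.dil t x) = t ^ i • S.proj i x :=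
  S.proj_weightMap _ i x

theorem dil_dil (s t : ℝ) (x : 𝔤) : S.dil s (S.dil t x) = S.dil (s * t) x :=
  S.eq_of_proj_eq fun i => by simp only [proj_dil, smul_smul, mul_pow]

theorem dil_one (x : 𝔤) : S.dil 1 x = x :=
  S.eq_of_proj_eq fun i => by simp [proj_dil]

theorem dil_lie (t : ℝ) (x y : 𝔤) : S.dil t ⁅x, y⁆ = ⁅S.dil t x, S.dil t y⁆ := by
  refine S.layer_induction (p := fun x => S.dil t ⁅x, y⁆ = ⁅S.dil t x, S.dil t y⁆)
    (by simp) (fun x x' hx hx' => ?_) (fun i x hx => ?_) x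
  · simp only [map_add, add_lie, hx, hx']
  · refine S.layer_induction (p := fun y => S.dil t ⁅x, y⁆ = ⁅S.dil t x, S.dil t y⁆)
      (by simp) (fun y y' hy hy' => ?_) (fun j y hy => ?_) y
    · simp only [map_add, lie_add, hy, hy']
    · rw [S.dil_of_mem t hx, S.dil_of_mem t hy,
        S.dil_of_mem t (S.lie_mem i j x y hx hy), smul_lie, lie_smul, smul_smul, pow_add]

theorem dil_degree (t : ℝ) (x : 𝔤) : S.dil t (S.degree x) = S.degree (S.dil t x) :=
  S.eq_of_proj_eq fun i => by simp only [proj_dil, proj_degree, smul_smul, mul_comm]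

theorem dil_ad_pow (t : ℝ) (X Y : 𝔤) (k : ℕ) : S.dil t (((LieAlgebra.ad ℝ 𝔤 X) ^ k) Y)
    = ((LieAlgebra.ad ℝ 𝔤 (S.dil t X)) ^ k) (S.dil t Y) := by
  induction k with
  | zero => simp
  | succ k ih => simp only [pow_succ', Module.End.mul_apply, LieAlgebra.ad_apply, dil_lie, ih]

theorem dil_expAd (t : ℝ) (X Y : 𝔤) :
    S.dil t (S.expAd X Y) = S.expAd (S.dil t X) (S.dil t Y) := by
  simp only [expAd, nilExp, LinearMap.sum_apply, LinearMap.smul_apply, map_sum, map_smul,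
    dil_ad_pow]

theorem dil_logDer (t : ℝ) (X : 𝔤) : S.dil t (S.logDer X) = S.logDer (S.dil t X) := by
  simp only [logDer, map_sum, map_smul, dil_ad_pow, dil_degree]

theorem dil_bch (t : ℝ) (X Y : 𝔤) :
    S.dil t (S.bch X Y) = S.bch (S.dil t X) (S.dil t Y) := by
  apply S.logDer_bijective.1
  rw [← dil_logDer, logDer_bch, logDer_bch, map_add, dil_expAd, dil_logDer, dil_logDer]

end Stratification

namespace CarnotGroup

variable {𝔤 : Type*} [LieRing 𝔤] [LieAlgebra ℝ 𝔤] {S : Stratification 𝔤}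

theorem log_mul (g h : CarnotGroup S) : (g * h).log = S.bch g.log h.log := rfl

theorem log_one : (1 : CarnotGroup S).log = 0 := rfl

theorem log_inv (g : CarnotGroup S) : (g⁻¹).log = -g.log := rfl

theorem log_dilation (t : ℝ) (g : CarnotGroup S) : (dilation t g).log = S.dil t g.log := rfl

theorem dilation_mul (t : ℝ) (g h : CarnotGroup S) :
    dilation t (g * h) = dilation t g * dilation t h :=
  CarnotGroup.ext (S.dil_bch t _ _)

theorem dilation_dilation (s t : ℝ) (g : CarnotGroup S) :
    dilation s (dilation t g) = dilation (s * t) g :=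
  CarnotGroup.ext (S.dil_dil s t _)

theorem dilation_one (g : CarnotGroup S) : dilation 1 g = g :=
  CarnotGroup.ext (S.dil_one _)

theorem exp_zero : (exp 0 : CarnotGroup S) = 1 := rfl

end CarnotGroup

end

/-! ### Horizontal paths in the coordinate `logDer` -/

noncomputable section
attribute [local instance] lieNorm
attribute [local instance] lieNormedSpace

theorem hasDerivWithinAt_iff_forall_dual {F : Type*} [NormedAddCommGroup F] [NormedSpace ℝ F]
    [FiniteDimensional ℝ F] {f : ℝ → F} {f' : F} {s : Set ℝ} {t : ℝ} :
    HasDerivWithinAt f f' s t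
      ↔ ∀ ξ : Module.Dual ℝ F, HasDerivWithinAt (fun τ => ξ (f τ)) (ξ f') s t := by
  constructor
  · intro h ξ
    exact (LinearMap.toContinuousLinearMap ξ).hasFDerivAt.comp_hasDerivWithinAt t h
  · intro h
    let b := Module.finBasis ℝ F
    have hb : ∀ x : F, x = ∑ i, b.coord i x • b i := fun x => (b.sum_repr x).symm
    have h1 : HasDerivWithinAt (fun τ => ∑ i, b.coord i (f τ) • b i)
        (∑ i, b.coord i f' • b i) s t :=
      HasDerivWithinAt.fun_sum fun i _ => (h (b.coord i)).smul_const (b i)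
    rw [← hb f'] at h1
    exact h1.congr (fun τ _ => hb _) (hb _)

namespace CarnotGroup

variable {𝔤 : Type*} [LieRing 𝔤] [LieAlgebra ℝ 𝔤] [FiniteDimensional ℝ 𝔤]
variable {S : Stratification 𝔤}

/-- Since `logDer` is a cocycle and the identity on `V₁`, the curve `s ↦ g exp (s X)` is a straight
line with direction `Ad_g X` in this coordinate. -/
theorem hasDerivAt_log_mul_exp (g : CarnotGroup S) {X : 𝔤} (hX : X ∈ S.layer 1) :
    HasDerivAt (fun s : ℝ => (g * exp (s • X)).log)
      (fderiv ℝ S.logDerInv (S.logDer g.log) (S.expAd g.log X)) 0 := by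
  have h0 : ∀ s : ℝ, (g * exp (s • X)).log
      = S.logDerInv (S.logDer g.log + s • S.expAd g.log X) := by
    intro s
    rw [log_mul, Stratification.bch_eq, S.logDer_of_mem (Submodule.smul_mem _ s hX), map_smul]
  simp only [h0]
  have h1 : HasFDerivAt S.logDerInv (fderiv ℝ S.logDerInv (S.logDer g.log)) (S.logDer g.log) :=
    ((S.contDiff_logDerInv (n := 1)).differentiable one_ne_zero _).hasFDerivAt
  have h2 : HasDerivAt (fun s : ℝ => S.logDer g.log + s • S.expAd g.log X)
      (S.expAd g.log X) 0 := by
    simpa using ((hasDerivAt_id (0 : ℝ)).smul_const (S.expAd g.log X)).const_add (S.logDer g.log)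
  exact HasFDerivAt.comp_hasDerivAt (f := fun s : ℝ => S.logDer g.log + s • S.expAd g.log X)
    (0 : ℝ) (by simpa using h1) h2

theorem leftInvariantDeriv_dual (g : CarnotGroup S) {X : 𝔤} (hX : X ∈ S.layer 1)
    (ξ : Module.Dual ℝ 𝔤) : leftInvariantDeriv X (fun g : CarnotGroup S => ξ g.log) g
      = ξ (fderiv ℝ S.logDerInv (S.logDer g.log) (S.expAd g.log X)) :=
  ((LinearMap.toContinuousLinearMap ξ).hasFDerivAt.comp_hasDerivAt 0
    (hasDerivAt_log_mul_exp g hX)).deriv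

/-- Because `logDer` is a diffeomorphism, testing on linear functionals of `log` amounts to one
differential equation for `logDer ∘ γ`. All manipulations of paths below use this form. -/
theorem isHorizontalPath_iff {γ : ℝ → CarnotGroup S} {u : ℝ → S.layer 1} {x y : CarnotGroup S} :
    IsHorizontalPath γ u x y ↔ γ 0 = x ∧ γ 1 = y ∧ ContinuousOn u (Icc 0 1) ∧
      ∀ t ∈ Icc (0 : ℝ) 1, HasDerivWithinAt (fun τ => S.logDer (γ τ).log)
        (S.expAd (γ t).log (u t)) (Icc 0 1) t := by
  have key : ∀ t, (∀ ξ : Module.Dual ℝ 𝔤, HasDerivWithinAt (fun τ => ξ (γ τ).log)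
      (leftInvariantDeriv (u t : 𝔤) (fun g => ξ g.log) (γ t)) (Icc 0 1) t)
      ↔ HasDerivWithinAt (fun τ => S.logDer (γ τ).log)
        (S.expAd (γ t).log (u t)) (Icc 0 1) t := by
    intro t
    simp only [leftInvariantDeriv_dual _ (u t).2]
    rw [← hasDerivWithinAt_iff_forall_dual (f := fun τ => (γ τ).log)]
    have hI : HasFDerivAt S.logDerInv (fderiv ℝ S.logDerInv (S.logDer (γ t).log))
        (S.logDer (γ t).log) :=
      ((S.contDiff_logDerInv (n := 1)).differentiable one_ne_zero _).hasFDerivAt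
    have hL : HasFDerivAt S.logDer (fderiv ℝ S.logDer (γ t).log) (γ t).log :=
      ((S.contDiff_logDer (n := 1)).differentiable one_ne_zero _).hasFDerivAt
    constructor
    · intro h
      have h1 := hL.comp_hasDerivWithinAt t h
      have h2 : (fderiv ℝ S.logDer (γ t).log).comp
          (fderiv ℝ S.logDerInv (S.logDer (γ t).log)) = ContinuousLinearMap.id ℝ 𝔤 := by
        have h3 : HasFDerivAt (S.logDer ∘ S.logDerInv) ((fderiv ℝ S.logDer (γ t).log).comp
          (fderiv ℝ S.logDerInv (S.logDer (γ t).log))) (S.logDer (γ t).log) := by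
          refine HasFDerivAt.comp _ ?_ hI
          rwa [S.logDerInv_logDer]
        have h4 : S.logDer ∘ S.logDerInv = id := funext S.logDer_logDerInv
        rw [h4] at h3
        exact h3.unique (hasFDerivAt_id _)
      have h5 := DFunLike.congr_fun h2 (S.expAd (γ t).log (u t))
      simp only [ContinuousLinearMap.comp_apply, ContinuousLinearMap.id_apply] at h5
      rw [h5] at h1
      exact h1
    · intro h
      have h1 := hI.comp_hasDerivWithinAt t h
      refine h1.congr (fun τ _ => ?_) ?_ <;> simp [S.logDerInv_logDer]
  constructor
  · rintro ⟨h1, h2, h3, h4⟩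
    exact ⟨h1, h2, h3, fun t ht => (key t).1 fun ξ => h4 ξ t ht⟩
  · rintro ⟨h1, h2, h3, h4⟩
    exact ⟨h1, h2, h3, fun ξ t ht => (key t).2 (h4 t ht) ξ⟩

theorem continuous_log : Continuous (log : CarnotGroup S → 𝔤) := continuous_induced_dom

theorem continuous_exp : Continuous (exp : 𝔤 → CarnotGroup S) :=
  continuous_induced_rng.2 continuous_id

theorem IsHorizontalPath.continuousOn_path {γ : ℝ → CarnotGroup S} {u : ℝ → S.layer 1}
    {x y : CarnotGroup S} (h : IsHorizontalPath γ u x y) : ContinuousOn γ (Icc 0 1) := by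
  have h1 : ContinuousOn (fun τ => S.logDer (γ τ).log) (Icc 0 1) :=
    fun t ht => ((isHorizontalPath_iff.1 h).2.2.2 t ht).continuousWithinAt
  have h2 := (continuous_exp (S := S)).comp_continuousOn
    ((S.contDiff_logDerInv (n := 0)).continuous.comp_continuousOn h1)
  refine h2.congr fun τ _ => ?_
  simp [S.logDerInv_logDer]

theorem IsHorizontalPath.comp {γ : ℝ → CarnotGroup S} {u : ℝ → S.layer 1}
    {x y : CarnotGroup S} (h : IsHorizontalPath γ u x y) {θ θ' : ℝ → ℝ}
    (hθ : ∀ t, HasDerivAt θ (θ' t) t) (hm : MapsTo θ (Icc 0 1) (Icc 0 1))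
    (hθ' : Continuous θ') :
    IsHorizontalPath (fun t => γ (θ t)) (fun t => θ' t • u (θ t)) (γ (θ 0)) (γ (θ 1)) := by
  rw [isHorizontalPath_iff] at h ⊢
  obtain ⟨h1, h2, h3, h4⟩ := h
  refine ⟨rfl, rfl, ?_, fun t ht => ?_⟩
  · refine hθ'.continuousOn.smul (h3.comp (fun t _ => ?_) hm)
    exact (hθ t).continuousAt.continuousWithinAt
  · refine ((h4 (θ t) (hm ht)).scomp t (hθ t).hasDerivWithinAt hm).congr_deriv ?_
    simp

theorem IsHorizontalPath.mul_left {γ : ℝ → CarnotGroup S} {u : ℝ → S.layer 1}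
    {x y : CarnotGroup S} (h : IsHorizontalPath γ u x y) (g : CarnotGroup S) :
    IsHorizontalPath (fun t => g * γ t) u (g * x) (g * y) := by
  rw [isHorizontalPath_iff] at h ⊢
  obtain ⟨h1, h2, h3, h4⟩ := h
  refine ⟨by rw [h1], by rw [h2], h3, fun t ht => ?_⟩
  simp only [log_mul, S.logDer_bch, S.expAd_bch, Module.End.mul_apply]
  exact ((LinearMap.toContinuousLinearMap (S.expAd g.log)).hasFDerivAt.comp_hasDerivWithinAt t
    (h4 t ht)).const_add _

theorem IsHorizontalPath.dilation {γ : ℝ → CarnotGroup S} {u : ℝ → S.layer 1}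
    {x y : CarnotGroup S} (h : IsHorizontalPath γ u x y) (c : ℝ) :
    IsHorizontalPath (fun t => dilation c (γ t)) (fun t => c • u t) (dilation c x)
      (dilation c y) := by
  rw [isHorizontalPath_iff] at h ⊢
  obtain ⟨h1, h2, h3, h4⟩ := h
  refine ⟨by rw [h1], by rw [h2], h3.const_smul c, fun t ht => ?_⟩
  simp only [log_dilation, ← S.dil_logDer]
  have h5 : S.expAd (S.dil c (γ t).log) ((c • u t : S.layer 1) : 𝔤)
      = S.dil c (S.expAd (γ t).log (u t)) := by
    rw [S.dil_expAd, S.dil_of_mem c (u t).2, pow_one]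
    rfl
  rw [h5]
  exact (LinearMap.toContinuousLinearMap (S.dil c)).hasFDerivAt.comp_hasDerivWithinAt t
    (h4 t ht)

theorem isHorizontalPath_exp (w : S.layer 1) :
    IsHorizontalPath (S := S) (fun t => exp (t • (w : 𝔤))) (fun _ => w) 1 (exp w) := by
  rw [isHorizontalPath_iff]
  refine ⟨by simp [exp_zero], by simp, continuousOn_const, fun t _ => ?_⟩
  have h1 : ∀ τ : ℝ, S.logDer (τ • (w : 𝔤)) = τ • (w : 𝔤) :=
    fun τ => S.logDer_of_mem (Submodule.smul_mem _ τ w.2)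
  have h2 : S.expAd (t • (w : 𝔤)) w = w := by
    simp [Stratification.expAd, nilExp, Finset.sum_range_succ', pow_succ]
  simp only [h1, h2]
  simpa using ((hasDerivAt_id t).smul_const (w : 𝔤)).hasDerivWithinAt

/-- The controls have to vanish at the junction, since otherwise the concatenated control need not
be continuous. -/
theorem isHorizontalPath_trans {γ₁ γ₂ : ℝ → CarnotGroup S} {u₁ u₂ : ℝ → S.layer 1}
    {x y z : CarnotGroup S} (h₁ : IsHorizontalPath γ₁ u₁ x y) (h₂ : IsHorizontalPath γ₂ u₂ y z)
    (e₁ : u₁ 1 = 0) (e₂ : u₂ 0 = 0) :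
    IsHorizontalPath (fun t => if t ≤ 1 / 2 then γ₁ (2 * t) else γ₂ (2 * t - 1))
      (fun t => if t ≤ 1 / 2 then (2 : ℝ) • u₁ (2 * t) else (2 : ℝ) • u₂ (2 * t - 1)) x z := by
  rw [isHorizontalPath_iff] at h₁ h₂
  obtain ⟨a1, a2, a3, a4⟩ := h₁
  obtain ⟨b1, b2, b3, b4⟩ := h₂
  set γ : ℝ → CarnotGroup S := fun t => if t ≤ 1 / 2 then γ₁ (2 * t) else γ₂ (2 * t - 1)
  set u : ℝ → S.layer 1 :=
    fun t => if t ≤ 1 / 2 then (2 : ℝ) • u₁ (2 * t) else (2 : ℝ) • u₂ (2 * t - 1)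
  have m₁ : MapsTo (fun t : ℝ => 2 * t) (Icc 0 (1 / 2)) (Icc 0 1) :=
    fun t ht => ⟨by linarith [ht.1], by linarith [ht.2]⟩
  have m₂ : MapsTo (fun t : ℝ => 2 * t - 1) (Icc (1 / 2) 1) (Icc 0 1) :=
    fun t ht => ⟨by linarith [ht.1], by linarith [ht.2]⟩
  have g1 : ∀ t ≤ (1 / 2 : ℝ), γ t = γ₁ (2 * t) := fun t ht => if_pos ht
  have g2 : ∀ t, (1 / 2 : ℝ) ≤ t → γ t = γ₂ (2 * t - 1) := by
    intro t ht
    rcases ht.eq_or_lt with rfl | ht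
    · rw [g1 _ le_rfl]; norm_num [a2, b1]
    · exact if_neg (not_le.2 ht)
  have v1 : ∀ t ≤ (1 / 2 : ℝ), u t = (2 : ℝ) • u₁ (2 * t) := fun t ht => if_pos ht
  have v2 : ∀ t, (1 / 2 : ℝ) ≤ t → u t = (2 : ℝ) • u₂ (2 * t - 1) := by
    intro t ht
    rcases ht.eq_or_lt with rfl | ht
    · rw [v1 _ le_rfl]; norm_num [e₁, e₂]
    · exact if_neg (not_le.2 ht)
  have hun : Icc (0 : ℝ) (1 / 2) ∪ Icc (1 / 2) 1 = Icc 0 1 :=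
    Icc_union_Icc_eq_Icc (by norm_num) (by norm_num)
  rw [isHorizontalPath_iff]
  refine ⟨by rw [g1 _ (by norm_num)]; simpa using a1, by rw [g2 _ (by norm_num)]; norm_num [b2],
    ?_, fun t ht => ?_⟩
  · rw [← hun]
    refine ContinuousOn.union_of_isClosed ?_ ?_ isClosed_Icc isClosed_Icc
    · exact ((a3.comp (by fun_prop) m₁).const_smul (2 : ℝ)).congr fun t ht => v1 t ht.2
    · exact ((b3.comp (by fun_prop) m₂).const_smul (2 : ℝ)).congr fun t ht => v2 t ht.1
  · rw [← hun]
    -- Derivatives are taken within each half separately; at a time outside the closed half the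
    -- condition is vacuous.
    refine HasDerivWithinAt.union ?_ ?_
    · by_cases h : t ≤ 1 / 2
      · have d1 : HasDerivWithinAt (fun t : ℝ => 2 * t) 2 (Icc 0 (1 / 2)) t := by
          simpa using ((hasDerivAt_id t).const_mul (2 : ℝ)).hasDerivWithinAt
        have := (a4 (2 * t) (m₁ ⟨ht.1, h⟩)).scomp t d1 m₁
        rw [g1 t h, v1 t h]
        refine (this.congr (fun τ hτ => by simp [g1 τ hτ.2]) (by simp [g1 t h])).congr_deriv ?_
        simp
      · refine HasFDerivWithinAt.of_notMem_closure ?_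
        rw [isClosed_Icc.closure_eq]
        exact fun h' => h h'.2
    · by_cases h : 1 / 2 ≤ t
      · have d1 : HasDerivWithinAt (fun t : ℝ => 2 * t - 1) 2 (Icc (1 / 2) 1) t := by
          simpa using (((hasDerivAt_id t).const_mul (2 : ℝ)).sub_const 1).hasDerivWithinAt
        have := (b4 (2 * t - 1) (m₂ ⟨h, ht.2⟩)).scomp t d1 m₂
        rw [g2 t h, v2 t h]
        refine (this.congr (fun τ hτ => by simp [g2 τ hτ.1]) (by simp [g2 t h])).congr_deriv ?_
        simp
      · refine HasFDerivWithinAt.of_notMem_closure ?_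
        rw [isClosed_Icc.closure_eq]
        exact fun h' => h h'.1

end CarnotGroup

end

/-! ### Lengths of horizontal paths -/

noncomputable section
set_option linter.unusedSectionVars false
attribute [local instance] lieNorm
attribute [local instance] lieNormedSpace

namespace CarnotGroup

variable {𝔤 : Type*} [LieRing 𝔤] [LieAlgebra ℝ 𝔤] [FiniteDimensional ℝ 𝔤]
variable {S : Stratification 𝔤} (ip : InnerProductSpace.Core ℝ (S.layer 1))

/-- The norm of the inner product `ip`. -/
def ipNorm (u : S.layer 1) : ℝ := √(ip.inner u u)

theorem ipNorm_nonneg (u : S.layer 1) : 0 ≤ ipNorm ip u := Real.sqrt_nonneg _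

theorem ipNorm_smul (c : ℝ) (u : S.layer 1) : ipNorm ip (c • u) = |c| * ipNorm ip u := by
  have h1 : ip.inner (c • u) (c • u) = c ^ 2 * ip.inner u u := by
    have e1 := ip.smul_left u (c • u) c
    have e2 := ip.conj_inner_symm u (c • u)
    have e3 := ip.smul_left u u c
    simp only [conj_trivial] at e1 e2 e3
    rw [e1, ← e2, e3]; ring
  rw [ipNorm, h1, Real.sqrt_mul (sq_nonneg c), Real.sqrt_sq_eq_abs, ipNorm]

theorem ipNorm_pos {u : S.layer 1} (hu : u ≠ 0) : 0 < ipNorm ip u := by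
  refine Real.sqrt_pos.2 (lt_of_le_of_ne (ip.re_inner_nonneg u) fun h => hu ?_)
  exact ip.definite u h.symm

theorem continuous_ipNorm : Continuous (ipNorm ip) := by
  let B : S.layer 1 →ₗ[ℝ] S.layer 1 →ₗ[ℝ] ℝ := LinearMap.mk₂ ℝ (fun u v => ip.inner u v)
    (fun u v w => ip.add_left u v w) (fun c u v => by simpa using ip.smul_left u v c)
    (fun u v w => by
      have e1 := ip.conj_inner_symm u (v + w)
      have e2 := ip.conj_inner_symm u v
      have e3 := ip.conj_inner_symm u w
      simp only [conj_trivial] at e1 e2 e3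
      rw [← e1, ip.add_left, e2, e3])
    (fun c u v => by
      have e1 := ip.conj_inner_symm u (c • v)
      have e2 := ip.conj_inner_symm u v
      have e3 := ip.smul_left v u c
      simp only [conj_trivial] at e1 e2 e3
      rw [← e1, e3, e2, smul_eq_mul])
  let B' : S.layer 1 →L[ℝ] S.layer 1 →L[ℝ] ℝ := LinearMap.toContinuousLinearMap
    ((LinearMap.toContinuousLinearMap : (S.layer 1 →ₗ[ℝ] ℝ) ≃ₗ[ℝ] _).toLinearMap ∘ₗ B)
  have h : Continuous fun u => B' u u := by fun_prop
  exact Real.continuous_sqrt.comp h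

/-- Equivalence of norms, by minimising over the unit sphere; the sphere is empty exactly when `V₁ =
0`. -/
theorem exists_norm_le_ipNorm : ∃ C : ℝ, 0 < C ∧ ∀ u : S.layer 1, ‖(u : 𝔤)‖ ≤ C * ipNorm ip u := by
  have hc : IsCompact (Metric.sphere (0 : S.layer 1) 1) := isCompact_sphere _ _
  rcases (Metric.sphere (0 : S.layer 1) 1).eq_empty_or_nonempty with he | hne
  · refine ⟨1, one_pos, fun u => ?_⟩
    have : u = 0 := by
      by_contra hu
      have h1 : (‖u‖⁻¹ • u) ∈ Metric.sphere (0 : S.layer 1) 1 := by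
        rw [mem_sphere_zero_iff_norm, norm_smul, norm_inv, norm_norm,
          inv_mul_cancel₀ (norm_ne_zero_iff.2 hu)]
      rw [he] at h1
      exact h1
    subst this
    simpa using ipNorm_nonneg ip 0
  · obtain ⟨u₀, hu₀, hmin⟩ := hc.exists_isMinOn hne (continuous_ipNorm ip).continuousOn
    have hu₀' : u₀ ≠ 0 := by
      rintro rfl
      simp at hu₀
    have hp := ipNorm_pos ip hu₀'
    refine ⟨(ipNorm ip u₀)⁻¹, inv_pos.2 hp, fun u => ?_⟩
    rcases eq_or_ne u 0 with rfl | hu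
    · simpa using mul_nonneg (inv_nonneg.2 hp.le) (ipNorm_nonneg ip 0)
    have hn : 0 < ‖u‖ := norm_pos_iff.2 hu
    have h1 : (‖u‖⁻¹ • u) ∈ Metric.sphere (0 : S.layer 1) 1 := by
      rw [mem_sphere_zero_iff_norm, norm_smul, norm_inv, norm_norm, inv_mul_cancel₀ hn.ne']
    have h2 : ipNorm ip u₀ ≤ ipNorm ip (‖u‖⁻¹ • u) := hmin h1
    rw [ipNorm_smul, abs_of_pos (inv_pos.2 hn)] at h2
    change ‖u‖ ≤ _
    rw [inv_mul_eq_div, le_div_iff₀ hp]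
    rw [inv_mul_eq_div, le_div_iff₀ hn] at h2
    linarith

/-- There is a horizontal path of length `ℓ` from `x` to `y`. -/
def IsJoined (x y : CarnotGroup S) (ℓ : ℝ) : Prop :=
  ∃ γ : ℝ → CarnotGroup S, ∃ u : ℝ → S.layer 1, IsHorizontalPath γ u x y ∧
    ℓ = ∫ t in (0 : ℝ)..1, ipNorm ip (u t)

variable {ip}

theorem IsJoined.nonneg {x y : CarnotGroup S} {ℓ : ℝ} (h : IsJoined ip x y ℓ) : 0 ≤ ℓ := by
  obtain ⟨γ, u, -, rfl⟩ := h
  exact intervalIntegral.integral_nonneg zero_le_one fun t _ => ipNorm_nonneg ip _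

theorem isJoined_refl (x : CarnotGroup S) : IsJoined ip x x 0 := by
  refine ⟨fun _ => x, fun _ => 0, ?_, by simp [show ipNorm ip 0 = 0 by
    simpa using ipNorm_smul ip 0 0]⟩
  rw [isHorizontalPath_iff]
  refine ⟨rfl, rfl, continuousOn_const, fun t _ => ?_⟩
  simpa using hasDerivWithinAt_const t (Icc 0 1) (S.logDer x.log)

theorem IsJoined.mul_left {x y : CarnotGroup S} {ℓ : ℝ} (h : IsJoined ip x y ℓ)
    (g : CarnotGroup S) : IsJoined ip (g * x) (g * y) ℓ := by
  obtain ⟨γ, u, h, rfl⟩ := h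
  exact ⟨_, u, h.mul_left g, rfl⟩

theorem IsJoined.dilation {x y : CarnotGroup S} {ℓ : ℝ} (h : IsJoined ip x y ℓ) {c : ℝ}
    (hc : 0 ≤ c) : IsJoined ip (dilation c x) (dilation c y) (c * ℓ) := by
  obtain ⟨γ, u, h, rfl⟩ := h
  refine ⟨_, _, h.dilation c, ?_⟩
  simp only [ipNorm_smul, abs_of_nonneg hc, intervalIntegral.integral_const_mul]

theorem isJoined_exp (w : S.layer 1) : IsJoined ip 1 (exp (w : 𝔤)) (ipNorm ip w) :=
  ⟨_, _, isHorizontalPath_exp w, by simp⟩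

theorem IsJoined.symm {x y : CarnotGroup S} {ℓ : ℝ} (h : IsJoined ip x y ℓ) :
    IsJoined ip y x ℓ := by
  obtain ⟨γ, u, h, rfl⟩ := h
  have h1 := h.comp (θ := fun t => 1 - t) (θ' := fun _ => -1)
    (fun t => by simpa using (hasDerivAt_id t).const_sub 1)
    (fun t ht => ⟨by linarith [ht.2], by linarith [ht.1]⟩) continuous_const
  simp only [sub_zero, sub_self, h.source, h.target] at h1
  refine ⟨_, _, h1, ?_⟩
  simp only [ipNorm_smul, abs_neg, abs_one, one_mul]
  have := intervalIntegral.integral_comp_sub_left (a := 0) (b := 1)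
    (fun t => ipNorm ip (u t)) (1 : ℝ)
  simpa using this.symm

theorem integral_ipNorm_comp {u : ℝ → S.layer 1} (hu : ContinuousOn u (Icc 0 1))
    {θ θ' : ℝ → ℝ} (hθ : ∀ t, HasDerivAt θ (θ' t) t) (hθ' : Continuous θ') {a b : ℝ}
    (hab : a ≤ b) (hm : MapsTo θ (Icc a b) (Icc 0 1)) (h0 : ∀ t ∈ Icc a b, 0 ≤ θ' t) :
    ∫ t in a..b, ipNorm ip (θ' t • u (θ t)) = ∫ t in θ a..θ b, ipNorm ip (u t) := by
  rw [← uIcc_of_le hab] at hm h0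
  rw [← intervalIntegral.integral_comp_mul_deriv''' (f := θ) (f' := θ')
    (g := fun t => ipNorm ip (u t))]
  · refine intervalIntegral.integral_congr fun t ht => ?_
    simp only [ipNorm_smul, Function.comp_apply, abs_of_nonneg (h0 t ht), mul_comm]
  · exact fun t _ => (hθ t).continuousAt.continuousWithinAt
  · exact fun t _ => (hθ t).hasDerivWithinAt
  · refine ((continuous_ipNorm ip).comp_continuousOn hu).mono ?_
    exact (image_mono Ioo_subset_Icc_self).trans hm.image_subset
  · refine ContinuousOn.integrableOn_compact (isCompact_uIcc.image_of_continuousOn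
      fun t _ => (hθ t).continuousAt.continuousWithinAt) ?_
    exact ((continuous_ipNorm ip).comp_continuousOn hu).mono hm.image_subset
  · refine ContinuousOn.integrableOn_compact isCompact_uIcc ?_
    refine ContinuousOn.mul ?_ hθ'.continuousOn
    refine ((continuous_ipNorm ip).comp_continuousOn hu).comp
      (fun t _ => (hθ t).continuousAt.continuousWithinAt) hm

/-- Reparametrization on an initial interval. -/
theorem IsHorizontalPath.isJoined_initial {γ : ℝ → CarnotGroup S} {u : ℝ → S.layer 1}
    {x y : CarnotGroup S} (h : IsHorizontalPath γ u x y) {s : ℝ} (hs : s ∈ Icc (0 : ℝ) 1) :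
    ∃ ℓ ≤ ∫ t in (0 : ℝ)..1, ipNorm ip (u t), IsJoined ip x (γ s) ℓ := by
  have hd : ∀ t, HasDerivAt (fun t : ℝ => s * t) s t := fun t => by
    simpa using (hasDerivAt_id t).const_mul s
  have hm : MapsTo (fun t : ℝ => s * t) (Icc 0 1) (Icc 0 1) := fun t ht =>
    ⟨mul_nonneg hs.1 ht.1, mul_le_one₀ hs.2 ht.1 ht.2⟩
  have h1 := h.comp hd hm continuous_const
  simp only [mul_zero, mul_one, h.source] at h1
  refine ⟨_, ?_, _, _, h1, rfl⟩
  rw [integral_ipNorm_comp h.continuousOn hd continuous_const zero_le_one hm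
    (fun _ _ => hs.1), mul_zero, mul_one]
  have hi : IntervalIntegrable (fun t => ipNorm ip (u t)) MeasureTheory.volume 0 1 := by
    refine ContinuousOn.intervalIntegrable ?_
    rw [uIcc_of_le zero_le_one]
    exact (continuous_ipNorm ip).comp_continuousOn h.continuousOn
  exact intervalIntegral.integral_mono_interval le_rfl hs.1 hs.2
    (Filter.Eventually.of_forall fun t => ipNorm_nonneg ip _) hi

/-- The time change `3 t ^ 2 - 2 t ^ 3` has derivative `6 t (1 - t)`, which vanishes at both ends.
Length is unchanged, and paths of this kind can be concatenated. -/
theorem IsJoined.exists_stationary {x y : CarnotGroup S} {ℓ : ℝ} (h : IsJoined ip x y ℓ) :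
    ∃ γ : ℝ → CarnotGroup S, ∃ u : ℝ → S.layer 1, IsHorizontalPath γ u x y ∧
      (ℓ = ∫ t in (0 : ℝ)..1, ipNorm ip (u t)) ∧ u 0 = 0 ∧ u 1 = 0 := by
  obtain ⟨γ, u, h, rfl⟩ := h
  have hd : ∀ t, HasDerivAt (fun t : ℝ => 3 * t ^ 2 - 2 * t ^ 3) (6 * t * (1 - t)) t := fun t => by
    have := ((hasDerivAt_pow 2 t).const_mul 3).sub ((hasDerivAt_pow 3 t).const_mul 2)
    refine this.congr_deriv ?_
    simp; ring
  have hm : MapsTo (fun t : ℝ => 3 * t ^ 2 - 2 * t ^ 3) (Icc 0 1) (Icc 0 1) := fun t ht => by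
    have h0 := ht.1
    have h1 := ht.2
    have h2 : 0 ≤ t ^ 2 * (3 - 2 * t) := mul_nonneg (sq_nonneg t) (by linarith)
    have h3 : 0 ≤ (1 - t) ^ 2 * (1 + 2 * t) := mul_nonneg (sq_nonneg _) (by linarith)
    constructor
    · change 0 ≤ 3 * t ^ 2 - 2 * t ^ 3
      linarith
    · change 3 * t ^ 2 - 2 * t ^ 3 ≤ 1
      linarith
  have hc : Continuous fun t : ℝ => 6 * t * (1 - t) := by fun_prop
  have h1 := h.comp hd hm hc
  have h2 := integral_ipNorm_comp (ip := ip) h.continuousOn hd hc zero_le_one hm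
    (fun t ht => mul_nonneg (mul_nonneg (by norm_num) ht.1) (by linarith [ht.2]))
  norm_num [h.source, h.target] at h1 h2
  exact ⟨_, _, h1, h2.symm, by simp, by simp⟩

theorem IsJoined.trans {x y z : CarnotGroup S} {a b : ℝ} (h₁ : IsJoined ip x y a)
    (h₂ : IsJoined ip y z b) : IsJoined ip x z (a + b) := by
  obtain ⟨γ₁, u₁, k₁, rfl, -, e₁⟩ := h₁.exists_stationary
  obtain ⟨γ₂, u₂, k₂, rfl, e₂, -⟩ := h₂.exists_stationary
  have h := isHorizontalPath_trans k₁ k₂ e₁ e₂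
  refine ⟨_, _, h, ?_⟩
  have hi : ContinuousOn (fun t => ipNorm ip (if t ≤ 1 / 2 then (2 : ℝ) • u₁ (2 * t)
      else (2 : ℝ) • u₂ (2 * t - 1))) (Icc 0 1) :=
    (continuous_ipNorm ip).comp_continuousOn h.continuousOn
  symm
  rw [← intervalIntegral.integral_add_adjacent_intervals (b := 1 / 2)]
  · congr 1
    · have := integral_ipNorm_comp (ip := ip) k₁.continuousOn (θ := fun t => 2 * t)
        (θ' := fun _ => 2) (a := 0) (b := 1 / 2)
        (fun t => by simpa using (hasDerivAt_id t).const_mul (2 : ℝ)) continuous_const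
        (by norm_num) (fun t ht => ⟨by linarith [ht.1], by linarith [ht.2]⟩) (by simp)
      norm_num at this
      rw [← this]
      refine intervalIntegral.integral_congr fun t ht => ?_
      rw [uIcc_of_le (by norm_num)] at ht
      rw [if_pos (by linarith [ht.2])]
    · have := integral_ipNorm_comp (ip := ip) k₂.continuousOn (θ := fun t => 2 * t - 1)
        (θ' := fun _ => 2) (a := 1 / 2) (b := 1)
        (fun t => by simpa using ((hasDerivAt_id t).const_mul (2 : ℝ)).sub_const 1)
        continuous_const
        (by norm_num) (fun t ht => ⟨by linarith [ht.1], by linarith [ht.2]⟩) (by simp)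
      norm_num at this
      rw [← this]
      refine intervalIntegral.integral_congr fun t ht => ?_
      rw [uIcc_of_le (by norm_num)] at ht
      split_ifs with h'
      · obtain rfl : t = 1 / 2 := le_antisymm h' (by linarith [ht.1])
        norm_num [e₁, e₂]
      · rfl
  · refine ContinuousOn.intervalIntegrable (hi.mono ?_)
    rw [uIcc_of_le (by norm_num)]
    exact Icc_subset_Icc_right (by norm_num)
  · refine ContinuousOn.intervalIntegrable (hi.mono ?_)
    rw [uIcc_of_le (by norm_num)]
    exact Icc_subset_Icc_left (by norm_num)

/-- Points which are joined to `1` by short horizontal paths are close to `1`. -/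
theorem exists_norm_logDer_lt (ip : InnerProductSpace.Core ℝ (S.layer 1)) {ε : ℝ} (hε : 0 < ε) :
    ∃ δ : ℝ, 0 < δ ∧ ∀ (g : CarnotGroup S) (ℓ : ℝ), IsJoined ip 1 g ℓ → ℓ < δ →
      ‖S.logDer g.log‖ < ε := by
  obtain ⟨C₁, hC₁, hC₁'⟩ := exists_norm_le_ipNorm ip
  have hcont : Continuous fun p : 𝔤 × 𝔤 => S.expAd (S.logDerInv p.1) p.2 :=
    (S.contDiff_expAd (n := 0) (S.contDiff_logDerInv.comp contDiff_fst) contDiff_snd).continuous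
  obtain ⟨C₂, hC₂⟩ : ∃ C₂, ∀ v ∈ Metric.closedBall (0 : 𝔤) ε, ∀ u ∈ Metric.closedBall (0 : 𝔤) 1,
      ‖S.expAd (S.logDerInv v) u‖ ≤ C₂ := by
    obtain ⟨C₂, h⟩ := ((isCompact_closedBall (0 : 𝔤) ε).prod
      (isCompact_closedBall (0 : 𝔤) 1)).exists_bound_of_continuousOn hcont.continuousOn
    exact ⟨C₂, fun v hv u hu => h (v, u) ⟨hv, hu⟩⟩
  have hC₂0 : 0 ≤ C₂ := (norm_nonneg _).trans (hC₂ 0 (by simp [hε.le]) 0 (by simp))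
  -- Compactness gives the bound for unit vectors, and linearity in `u` gives it for all.
  have hE : ∀ v : 𝔤, ‖v‖ ≤ ε → ∀ u : 𝔤, ‖S.expAd (S.logDerInv v) u‖ ≤ C₂ * ‖u‖ := by
    intro v hv u
    rcases eq_or_ne u 0 with rfl | hu
    · simp
    have hn : 0 < ‖u‖ := norm_pos_iff.2 hu
    have := hC₂ v (by simpa using hv) (‖u‖⁻¹ • u) (by simp [norm_smul, hn.ne'])
    rw [map_smul, norm_smul, norm_inv, norm_norm, inv_mul_le_iff₀ hn] at this
    linarith
  set C := C₁ * C₂ + 1 with hC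
  have hCp : 0 < C := by positivity
  refine ⟨ε / (2 * C), by positivity, ?_⟩
  rintro g ℓ ⟨γ, u, h, rfl⟩ hℓ
  have hu := h.continuousOn
  have h' := isHorizontalPath_iff.1 h
  obtain ⟨h0, h1, -, hder⟩ := h'
  set q : ℝ → ℝ := fun t => ipNorm ip (u t) with hq
  have hqc : ContinuousOn q (Icc 0 1) := (continuous_ipNorm ip).comp_continuousOn hu
  have hqi : ∀ a b, a ∈ Icc (0 : ℝ) 1 → b ∈ Icc (0 : ℝ) 1 →
      IntervalIntegrable q MeasureTheory.volume a b := fun a b ha hb =>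
    ContinuousOn.intervalIntegrable (hqc.mono (uIcc_subset_Icc ha hb))
  set v : ℝ → 𝔤 := fun t => S.logDer (γ t).log with hv
  -- A barrier for `‖v‖`: the term `(ε / 4) t` makes the differential inequality strict where `‖v‖ =
  -- B`, and a length below `ε / (2 C)` keeps `B` below `ε`. Hence the estimate `hE`, valid only for
  -- `‖v‖ ≤ ε`, is available there.
  set B : ℝ → ℝ := fun t => C * (∫ τ in (0 : ℝ)..t, q τ) + (ε / 4) * t + ε / 8 with hB
  have hIle : ∀ t ∈ Icc (0 : ℝ) 1, ∫ τ in (0 : ℝ)..t, q τ ≤ ∫ τ in (0 : ℝ)..1, q τ := fun t ht =>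
    intervalIntegral.integral_mono_interval le_rfl ht.1 ht.2
      (Filter.Eventually.of_forall fun t => ipNorm_nonneg ip _)
      (hqi 0 1 (by simp) (by simp))
  have hBlt : ∀ t ∈ Icc (0 : ℝ) 1, B t < ε := by
    intro t ht
    have e1 := hIle t ht
    have e2 : C * (∫ τ in (0 : ℝ)..t, q τ) < ε / 2 := by
      calc C * (∫ τ in (0 : ℝ)..t, q τ) ≤ C * (∫ τ in (0 : ℝ)..1, q τ) := by gcongr
        _ < C * (ε / (2 * C)) := by gcongr
        _ = ε / 2 := by field_simp
    have e3 : (ε / 4) * t ≤ ε / 4 := by nlinarith [ht.2]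
    simp only [hB]
    linarith
  have hvle : ∀ t ∈ Icc (0 : ℝ) 1, ‖v t‖ ≤ B t := by
    intro t ht
    refine image_norm_le_of_norm_deriv_right_lt_deriv_boundary' (f := v)
      (f' := fun t => S.expAd (γ t).log (u t)) (B := B) (B' := fun t => C * q t + ε / 4)
      (a := 0) (b := 1) (fun t ht => (hder t ht).continuousWithinAt) (fun t ht => ?_) ?_ ?_
      (fun t ht => ?_) (fun t ht htB => ?_) ht
    · exact ((hder t (Ico_subset_Icc_self ht)).mono_of_mem_nhdsWithin
        (Icc_mem_nhdsGE_of_mem ht))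
    · simp only [hv, hB, h0, log_one, S.logDer_zero, norm_zero]
      simp
      positivity
    · have : ContinuousOn (fun t => ∫ τ in (0 : ℝ)..t, q τ) (Icc 0 1) := by
        have := intervalIntegral.continuousOn_primitive_interval (a := 0) (b := 1) (f := q)
          (μ := MeasureTheory.volume)
          (by rw [uIcc_of_le zero_le_one]; exact hqc.integrableOn_compact isCompact_Icc)
        rwa [uIcc_of_le zero_le_one] at this
      simp only [hB]
      fun_prop
    · have ht' := Ico_subset_Icc_self ht
      have e1 : HasDerivWithinAt (fun t => ∫ τ in (0 : ℝ)..t, q τ) (q t) (Ici t) t := by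
        refine intervalIntegral.integral_hasDerivWithinAt_right (hqi 0 t (by simp) ht') (t := Ioi t)
          ?_ ?_
        · refine ⟨Icc 0 1, ?_, hqc.aestronglyMeasurable measurableSet_Icc⟩
          exact Icc_mem_nhdsGT_of_mem ht
        · exact (hqc t ht').mono_of_mem_nhdsWithin (Icc_mem_nhdsGT_of_mem ht)
      have e2 := ((e1.const_mul C).add
        ((hasDerivAt_id t).const_mul (ε / 4)).hasDerivWithinAt).add_const (ε / 8)
      refine e2.congr_deriv ?_
      simp
    · have ht' := Ico_subset_Icc_self ht
      have e1 : ‖v t‖ ≤ ε := htB.le.trans (hBlt t ht').le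
      have e2 := hE (v t) e1 (u t)
      simp only [hv, S.logDerInv_logDer] at e2
      have e3 := hC₁' (u t)
      have e4 : C₂ * ‖(u t : 𝔤)‖ ≤ C₂ * (C₁ * q t) := by gcongr
      have e5 := ipNorm_nonneg ip (u t)
      simp only [hC]
      have e6 : 0 ≤ q t := e5
      nlinarith
  have := (hvle 1 (by simp)).trans_lt (hBlt 1 (by simp))
  simpa [hv, h1] using this

end CarnotGroup

end

/-! ### Chow's theorem -/

noncomputable section
set_option linter.unusedSectionVars false
attribute [local instance] lieNorm
attribute [local instance] lieNormedSpace

namespace Stratification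

variable {𝔤 : Type*} [LieRing 𝔤] [LieAlgebra ℝ 𝔤] (S : Stratification 𝔤)

theorem logDer_sub_degree_mem {X : 𝔤} {n : ℕ} (hX : X ∈ S.filt n) :
    S.logDer X - S.degree X ∈ S.filt (n + 1) := by
  simpa [logDer_zero] using S.logDer_sub_mem (X := X) (Y := 0) (n := n) (by simpa using hX)

/-- Leading terms of `logDer X` and `D X` agree, and `D` is invertible on every layer; depth is
therefore compared one layer at a time. -/
theorem logDer_mem_filt {X : 𝔤} {n : ℕ} : S.logDer X ∈ S.filt n ↔ X ∈ S.filt n := by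
  constructor
  · intro h
    have : ∀ k, k ≤ n → X ∈ S.filt k := by
      intro k
      induction k with
      | zero => intro _; simp [mem_filt]
      | succ k ih =>
        intro hk
        have h1 := S.logDer_sub_degree_mem (ih (by omega))
        have h2 := sub_mem (S.filt_anti hk h) h1
        rwa [sub_sub_cancel, degree_mem_filt] at h2
    exact this n le_rfl
  · intro h
    have h1 := add_mem (S.filt_anti (Nat.le_succ n) (S.logDer_sub_degree_mem h))
      (S.degree_mem_filt.2 h)
    rwa [sub_add_cancel] at h1

theorem ad_pow_mem_filt_mul {m n : ℕ} {X y : 𝔤} (hX : X ∈ S.filt m) (hy : y ∈ S.filt n)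
    (k : ℕ) : ((LieAlgebra.ad ℝ 𝔤 X) ^ k) y ∈ S.filt (k * m + n) := by
  induction k with
  | zero => simpa using hy
  | succ k ih =>
    rw [pow_succ', Module.End.mul_apply, LieAlgebra.ad_apply]
    have := S.lie_mem_filt hX ih
    rwa [show (k + 1) * m + n = m + (k * m + n) by ring]

theorem expAd_sub_mem_filt_add {m n : ℕ} {X y : 𝔤} (hX : X ∈ S.filt m) (hy : y ∈ S.filt n) :
    S.expAd X y - y ∈ S.filt (m + n) := by
  simp only [expAd, nilExp, Finset.sum_range_succ', LinearMap.add_apply, LinearMap.sum_apply,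
    LinearMap.smul_apply, pow_zero, Nat.factorial_zero, Nat.cast_one, inv_one, one_smul,
    Module.End.one_apply, add_sub_cancel_right]
  refine sum_mem fun k _ => Submodule.smul_mem _ _
    (S.filt_anti ?_ (S.ad_pow_mem_filt_mul hX hy (k + 1)))
  nlinarith [Nat.zero_le (k * m)]

theorem expAd_sub_sub_mem_filt {m n : ℕ} (hm : 1 ≤ m) {X y : 𝔤} (hX : X ∈ S.filt m)
    (hy : y ∈ S.filt n) : S.expAd X y - y - ⁅X, y⁆ ∈ S.filt (m + n + 1) := by
  rcases Nat.eq_zero_or_pos S.step with hs | hs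
  · have hz : ∀ x : 𝔤, x = 0 := fun x => S.eq_zero_of_mem_filt (n := 1) (by omega) (S.mem_filt_one x)
    rw [hz (_ - _ - _)]
    exact zero_mem _
  obtain ⟨s, hs'⟩ : ∃ s, S.step = s + 1 := ⟨S.step - 1, by omega⟩
  simp only [expAd, nilExp, hs', Finset.sum_range_succ', LinearMap.add_apply,
    LinearMap.sum_apply,
    LinearMap.smul_apply, pow_zero, Nat.factorial_zero, Nat.cast_one, inv_one, one_smul,
    Module.End.one_apply, add_sub_cancel_right, zero_add, pow_one, LieAlgebra.ad_apply,
    Nat.factorial_one]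
  refine sum_mem fun k _ => Submodule.smul_mem _ _
    (S.filt_anti ?_ (S.ad_pow_mem_filt_mul hX hy (k + 1 + 1)))
  nlinarith [Nat.zero_le (k * m)]

theorem bch_sub_mem_filt {n : ℕ} {X Y : 𝔤} (hX : X ∈ S.filt n) (hY : Y ∈ S.filt n) :
    S.bch X Y - (X + Y) ∈ S.filt (n + 1) := by
  have hlY := S.logDer_mem_filt.2 hY
  have h1 := S.expAd_sub_mem_filt X hlY
  have h2 : S.bch X Y ∈ S.filt n := by
    rw [← logDer_mem_filt, logDer_bch]
    exact add_mem (S.logDer_mem_filt.2 hX) (S.expAd_mem_filt X hlY)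
  have h3 := S.logDer_sub_degree_mem h2
  rw [logDer_bch] at h3
  rw [← degree_mem_filt]
  have h4 : S.degree (S.bch X Y - (X + Y)) = (S.logDer X - S.degree X) +
      (S.logDer Y - S.degree Y) + (S.expAd X (S.logDer Y) - S.logDer Y)
      - (S.logDer X + S.expAd X (S.logDer Y) - S.degree (S.bch X Y)) := by
    rw [map_sub, map_add]; abel
  rw [h4]
  exact sub_mem (add_mem (add_mem (S.logDer_sub_degree_mem hX) (S.logDer_sub_degree_mem hY)) h1) h3

/-- The leading term of a group commutator is the Lie bracket of the leading terms. -/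
theorem commutator_sub_mem_filt {m n : ℕ} (hm : 1 ≤ m) (hn : 1 ≤ n) {A B C a b : 𝔤}
    (ha : a ∈ S.layer m) (hb : b ∈ S.layer n) (hA : A - a ∈ S.filt (m + 1))
    (hB : B - b ∈ S.filt (n + 1)) (hC : S.bch A B = S.bch C (S.bch B A)) :
    C - ⁅a, b⁆ ∈ S.filt (m + n + 1) := by
  have haf := S.mem_filt_of_mem_layer le_rfl ha
  have hbf := S.mem_filt_of_mem_layer le_rfl hb
  have hAf : A ∈ S.filt m := by
    have := add_mem (S.filt_anti (Nat.le_succ m) hA) haf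
    rwa [sub_add_cancel] at this
  have hBf : B ∈ S.filt n := by
    have := add_mem (S.filt_anti (Nat.le_succ n) hB) hbf
    rwa [sub_add_cancel] at this
  have hdeg : ∀ {k : ℕ} {x : 𝔤}, x ∈ S.layer k → S.degree x = (k : ℝ) • x := fun hx =>
    S.weightMap_of_mem _ hx
  have hlead : ∀ {k : ℕ} {X x : 𝔤}, x ∈ S.layer k → X ∈ S.filt k → X - x ∈ S.filt (k + 1) →
      S.logDer X - (k : ℝ) • x ∈ S.filt (k + 1) := by
    intro k X x hx hX hXx
    have h1 := add_mem (S.logDer_sub_degree_mem hX) (S.degree_mem_filt.2 hXx)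
    rwa [map_sub, hdeg hx, sub_add_sub_cancel] at h1
  have hvA := hlead ha hAf hA
  have hvB := hlead hb hBf hB
  set vA := S.logDer A
  set vB := S.logDer B
  have hvAf : vA ∈ S.filt m := S.logDer_mem_filt.2 hAf
  have hvBf : vB ∈ S.filt n := S.logDer_mem_filt.2 hBf
  set r := S.logDer (S.bch B A) with hr
  -- The cocycle identity applied to `A B = C (B A)`, solved for `logDer C`.
  have hv : S.logDer C = (S.expAd A vB - vB) - (S.expAd B vA - vA) - (S.expAd C r - r) := by
    have h1 := congrArg S.logDer hC
    rw [logDer_bch, logDer_bch, ← hr, ← sub_eq_iff_eq_add] at h1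
    have h2 : r = vB + S.expAd B vA := S.logDer_bch B A
    rw [← h1]
    nth_rewrite 3 [h2]
    abel
  -- As `logDer` multiplies a leading term in `V_n` by `n`, the first difference is `n [a, b]` to
  -- leading order. The second is `-m [a, b]`, so together they give `(m + n) [a, b] = D [a, b]`.
  have e1 : (S.expAd A vB - vB) - (n : ℝ) • ⁅a, b⁆ ∈ S.filt (m + n + 1) := by
    have f1 := S.expAd_sub_sub_mem_filt hm hAf hvBf
    have f2 := S.lie_mem_filt hAf hvB
    have f3 := S.lie_mem_filt hA (Submodule.smul_mem _ (n : ℝ) hbf)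
    have f4 : (S.expAd A vB - vB) - (n : ℝ) • ⁅a, b⁆ = (S.expAd A vB - vB - ⁅A, vB⁆)
        + ⁅A, vB - (n : ℝ) • b⁆ + ⁅A - a, (n : ℝ) • b⁆ := by
      simp only [lie_sub, sub_lie, lie_smul, smul_sub]; abel
    rw [f4]
    exact add_mem (add_mem f1 f2) (S.filt_anti (by omega) f3)
  have e2 : (S.expAd B vA - vA) + (m : ℝ) • ⁅a, b⁆ ∈ S.filt (m + n + 1) := by
    have f1 := S.expAd_sub_sub_mem_filt hn hBf hvAf
    have f2 := S.lie_mem_filt hBf hvA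
    have f3 := S.lie_mem_filt hB (Submodule.smul_mem _ (m : ℝ) haf)
    have f4 : (S.expAd B vA - vA) + (m : ℝ) • ⁅a, b⁆ = (S.expAd B vA - vA - ⁅B, vA⁆)
        + ⁅B, vA - (m : ℝ) • a⁆ + ⁅B - b, (m : ℝ) • a⁆ := by
      rw [← lie_skew]
      simp only [lie_sub, sub_lie, lie_smul, smul_neg, smul_sub]; abel
    rw [f4]
    exact add_mem (add_mem (S.filt_anti (by omega) f1) (S.filt_anti (by omega) f2))
      (S.filt_anti (by omega) f3)
  have e3 : (S.expAd A vB - vB) - (S.expAd B vA - vA) - S.degree ⁅a, b⁆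
      ∈ S.filt (m + n + 1) := by
    have := sub_mem e1 e2
    rw [hdeg (S.lie_mem m n a b ha hb)]
    convert this using 1
    push_cast
    rw [add_smul]
    abel
  have hab : ⁅a, b⁆ ∈ S.filt (m + n) := S.lie_mem_filt haf hbf
  have e4 : (S.expAd A vB - vB) - (S.expAd B vA - vA) ∈ S.filt (m + n) := by
    have := add_mem (S.filt_anti (Nat.le_succ _) e3) (S.degree_mem_filt.2 hab)
    rwa [sub_add_cancel] at this
  -- Bootstrap: `Ad_C r - r` is one layer deeper than `C`, so `C` sinks layer by layer until depth
  -- `m + n`, where the bracket term appears.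
  have hCf : ∀ k, k ≤ m + n → C ∈ S.filt k := by
    intro k
    induction k with
    | zero => intro _; simp [mem_filt]
    | succ k ih =>
      intro hk
      rw [← logDer_mem_filt, hv]
      exact sub_mem (S.filt_anti hk e4) (S.expAd_sub_mem_filt_add (ih (by omega)) (S.mem_filt_one r))
  have hCf := hCf _ le_rfl
  have e5 := S.expAd_sub_mem_filt_add hCf (S.mem_filt_one r)
  have e6 := S.logDer_sub_degree_mem hCf
  rw [← degree_mem_filt, map_sub]
  have e7 : S.degree C - S.degree ⁅a, b⁆ = ((S.expAd A vB - vB) - (S.expAd B vA - vA)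
      - S.degree ⁅a, b⁆) - (S.expAd C r - r) - (S.logDer C - S.degree C) := by
    rw [hv]; abel
  rw [e7]
  exact sub_mem (sub_mem e3 e5) e6

theorem proj_lie_mem {P : ℕ → Submodule ℝ 𝔤} (x y : 𝔤)
    (h : ∀ i j, ⁅S.proj i x, S.proj j y⁆ ∈ P (i + j)) (n : ℕ) : S.proj n ⁅x, y⁆ ∈ P n := by
  rw [← S.sum_proj x, ← S.sum_proj y]
  simp only [sum_lie, lie_sum, map_sum]
  refine sum_mem fun j _ => sum_mem fun i _ => ?_
  rw [S.proj_of_mem (S.lie_mem i j _ _ (S.proj_mem i x) (S.proj_mem j y))]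
  split_ifs with hij
  · exact hij ▸ h i j
  · exact zero_mem _

end Stratification

namespace CarnotGroup

variable {𝔤 : Type*} [LieRing 𝔤] [LieAlgebra ℝ 𝔤] {S : Stratification 𝔤}

variable (S) in
/-- The subgroup generated by the exponentials of the first layer. -/
def horizontalSubgroup : Subgroup (CarnotGroup S) :=
  Subgroup.closure (exp '' (S.layer 1 : Set 𝔤))

theorem dilation_mem_horizontalSubgroup (t : ℝ) {g : CarnotGroup S}
    (hg : g ∈ horizontalSubgroup S) : dilation t g ∈ horizontalSubgroup S := by
  induction hg using Subgroup.closure_induction with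
  | mem x hx =>
    obtain ⟨X, hX, rfl⟩ := hx
    refine Subgroup.subset_closure ⟨S.dil t X, ?_, rfl⟩
    rw [S.dil_of_mem t hX]
    exact Submodule.smul_mem _ _ hX
  | one =>
    have : dilation t (1 : CarnotGroup S) = 1 := CarnotGroup.ext (map_zero (S.dil t))
    rw [this]; exact one_mem _
  | mul x y _ _ hx hy => rw [dilation_mul]; exact mul_mem hx hy
  | inv x _ hx =>
    have : dilation t x⁻¹ = (dilation t x)⁻¹ := CarnotGroup.ext (map_neg (S.dil t) x.log)
    rw [this]; exact inv_mem hx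

variable (S) in
/-- The vectors of `V_n` which are leading terms of logarithms of elements of the subgroup
generated by `exp V₁`. -/
def leadingTerms (n : ℕ) : Submodule ℝ 𝔤 where
  carrier := {X | X ∈ S.layer n ∧ ∃ g ∈ horizontalSubgroup S, g.log - X ∈ S.filt (n + 1)}
  zero_mem' := ⟨zero_mem _, 1, one_mem _, by simp [log_one]⟩
  add_mem' := by
    rintro X Y ⟨hX, g, hg, hgX⟩ ⟨hY, h, hh, hhY⟩
    refine ⟨add_mem hX hY, g * h, mul_mem hg hh, ?_⟩
    have e : ∀ {x z : 𝔤}, x ∈ S.layer n → z - x ∈ S.filt (n + 1) → z ∈ S.filt n := by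
      intro x z hx hz
      have := add_mem (S.filt_anti (Nat.le_succ n) hz) (S.mem_filt_of_mem_layer le_rfl hx)
      rwa [sub_add_cancel] at this
    have h1 := S.bch_sub_mem_filt (e hX hgX) (e hY hhY)
    have h2 := add_mem (add_mem h1 hgX) hhY
    rw [log_mul]
    convert h2 using 1
    abel
  smul_mem' := by
    have hpos : ∀ (c : ℝ) (X : 𝔤), 0 ≤ c → (X ∈ S.layer n ∧ ∃ g ∈ horizontalSubgroup S,
        g.log - X ∈ S.filt (n + 1)) → (c • X ∈ S.layer n ∧ ∃ g ∈ horizontalSubgroup S,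
        g.log - c • X ∈ S.filt (n + 1)) := by
      rintro c X hc ⟨hX, g, hg, hgX⟩
      refine ⟨Submodule.smul_mem _ _ hX, ?_⟩
      rcases Nat.eq_zero_or_pos n with rfl | hn
      · rw [S.layer_zero, Submodule.mem_bot] at hX
        exact ⟨1, one_mem _, by simp [log_one, hX]⟩
      -- Dilation by the `n`-th root of `c` multiplies `V_n` by `c` and preserves the horizontal
      -- subgroup. Negative scalars are reached with the inverse.
      refine ⟨dilation (c ^ ((n : ℝ)⁻¹)) g, dilation_mem_horizontalSubgroup _ hg, ?_⟩
      have h1 : c • X = S.dil (c ^ ((n : ℝ)⁻¹)) X := by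
        rw [S.dil_of_mem _ hX, Real.rpow_inv_natCast_pow hc (by omega)]
      rw [h1, log_dilation, ← map_sub, Stratification.mem_filt]
      intro i hi
      rw [S.proj_dil, S.mem_filt.1 hgX i hi, smul_zero]
    rintro c X hX
    rcases le_total 0 c with hc | hc
    · exact hpos c X hc hX
    · obtain ⟨h1, g, hg, h2⟩ := hpos (-c) X (by linarith) hX
      rw [neg_smul] at h1 h2
      refine ⟨by simpa using h1, g⁻¹, inv_mem hg, ?_⟩
      rw [log_inv]
      have := neg_mem h2
      convert this using 1
      abel

/-- The bracket is the leading term of the group commutator of the two representing elements. -/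
theorem lie_mem_leadingTerms {m n : ℕ} {a b : 𝔤} (ha : a ∈ leadingTerms S m)
    (hb : b ∈ leadingTerms S n) : ⁅a, b⁆ ∈ leadingTerms S (m + n) := by
  obtain ⟨ha, g, hg, hga⟩ := ha
  obtain ⟨hb, h, hh, hhb⟩ := hb
  rcases Nat.eq_zero_or_pos m with rfl | hm
  · rw [S.layer_zero, Submodule.mem_bot] at ha
    simp [ha]
  rcases Nat.eq_zero_or_pos n with rfl | hn
  · rw [S.layer_zero, Submodule.mem_bot] at hb
    simp [hb]
  refine ⟨S.lie_mem m n a b ha hb, g * h * (h * g)⁻¹,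
    mul_mem (mul_mem hg hh) (inv_mem (mul_mem hh hg)), ?_⟩
  refine S.commutator_sub_mem_filt hm hn ha hb hga hhb ?_
  simp only [← log_mul, inv_mul_cancel_right]

/-- The vectors all of whose components are leading terms form a Lie subalgebra. It contains `V₁`,
which generates. -/
theorem leadingTerms_eq (n : ℕ) : leadingTerms S n = S.layer n := by
  refine le_antisymm (fun X hX => hX.1) fun X hX => ?_
  let K : LieSubalgebra ℝ 𝔤 :=
    { carrier := {X | ∀ n, S.proj n X ∈ leadingTerms S n}
      zero_mem' := fun n => by simp
      add_mem' := fun hx hy n => by rw [map_add]; exact add_mem (hx n) (hy n)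
      smul_mem' := fun c x hx n => by rw [map_smul]; exact Submodule.smul_mem _ _ (hx n)
      lie_mem' := fun {x y} hx hy => S.proj_lie_mem x y
        fun i j => lie_mem_leadingTerms (hx i) (hy j) }
  have h1 : LieSubalgebra.lieSpan ℝ 𝔤 (S.layer 1 : Set 𝔤) ≤ K := by
    rw [LieSubalgebra.lieSpan_le]
    intro x hx n
    rw [S.proj_of_mem hx]
    split_ifs with h
    · subst h
      exact ⟨hx, exp x, Subgroup.subset_closure ⟨x, hx, rfl⟩, by simp⟩
    · exact zero_mem _
  rw [S.lieSpan_eq_top] at h1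
  have h2 : S.proj n X ∈ leadingTerms S n := h1 (LieSubalgebra.mem_top X) n
  rwa [S.proj_of_mem hX, if_pos rfl] at h2

/-- The lowest component of `log g` is the leading term of some `y` in the subgroup, and `y⁻¹ g` is
one layer deeper. After finitely many steps nothing is left. -/
theorem horizontalSubgroup_eq_top : horizontalSubgroup S = ⊤ := by
  have h : ∀ k n, S.step + 1 ≤ n + k → ∀ g : CarnotGroup S, g.log ∈ S.filt n →
      g ∈ horizontalSubgroup S := by
    intro k
    induction k with
    | zero =>
      intro n hn g hg
      have : g = 1 := CarnotGroup.ext (S.eq_zero_of_mem_filt (by omega) hg)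
      rw [this]
      exact one_mem _
    | succ k ih =>
      intro n hn g hg
      have h1 : S.proj n g.log ∈ leadingTerms S n := by
        rw [leadingTerms_eq]; exact S.proj_mem _ _
      obtain ⟨-, y, hy, hyg⟩ := h1
      have h2 : g.log - S.proj n g.log ∈ S.filt (n + 1) := by
        rw [Stratification.mem_filt] at hg ⊢
        intro i hi
        rw [map_sub, S.proj_of_mem (S.proj_mem n g.log)]
        split_ifs with hin
        · rw [hin, sub_self]
        · rw [hg i (by omega), sub_zero]
      have h3 : g.log - y.log ∈ S.filt (n + 1) := by
        have := sub_mem h2 hyg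
        rwa [sub_sub_sub_cancel_right] at this
      have hyf : y.log ∈ S.filt n := by
        have := sub_mem hg (S.filt_anti (Nat.le_succ n) h3)
        rwa [sub_sub_cancel] at this
      have h4 : (y⁻¹ * g).log ∈ S.filt (n + 1) := by
        have h5 := S.bch_sub_mem_filt (neg_mem hyf) hg
        rw [log_mul, log_inv]
        have := add_mem h5 h3
        convert this using 1
        abel
      have h6 := mul_mem hy (ih (n + 1) (by omega) _ h4)
      rwa [mul_inv_cancel_left] at h6
  rw [eq_top_iff]
  intro g _
  exact h (S.step + 1) 0 (by omega) g (by simp [Stratification.mem_filt])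

section Topology

variable [FiniteDimensional ℝ 𝔤]

theorem isTopologicalGroup : IsTopologicalGroup (CarnotGroup S) where
  continuous_mul := by
    refine continuous_induced_rng.2 ?_
    have h : Continuous fun p : 𝔤 × 𝔤 => S.bch p.1 p.2 :=
      (S.contDiff_bch (n := 0) contDiff_fst contDiff_snd).continuous
    have h' : Continuous fun p : CarnotGroup S × CarnotGroup S => S.bch p.1.log p.2.log :=
      h.comp₂ (continuous_log.comp continuous_fst) (continuous_log.comp continuous_snd)
    exact h'.congr fun p => (log_mul p.1 p.2).symm
  continuous_inv := continuous_induced_rng.2 continuous_log.neg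

variable (S) in
/-- The products of `n` exponentials of horizontal vectors of norm at most `n`. -/
def horizontalProducts (n : ℕ) : Set (CarnotGroup S) :=
  (exp '' ((↑) '' Metric.closedBall (0 : S.layer 1) n : Set 𝔤)) ^ n

theorem isCompact_horizontalProducts (n : ℕ) : IsCompact (horizontalProducts S n) := by
  have := isTopologicalGroup (S := S)
  have h : IsCompact (exp '' ((↑) '' Metric.closedBall (0 : S.layer 1) n : Set 𝔤)
      : Set (CarnotGroup S)) :=
    ((isCompact_closedBall _ _).image continuous_subtype_val).image continuous_exp
  have : ∀ k : ℕ, IsCompact ((exp '' ((↑) '' Metric.closedBall (0 : S.layer 1) n : Set 𝔤)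
      : Set (CarnotGroup S)) ^ k) := by
    intro k
    induction k with
    | zero => rw [pow_zero]; exact isCompact_singleton
    | succ k ih => rw [pow_succ]; exact ih.mul h
  exact this n

/-- This exhausts the group by countably many compact sets, as Baire's theorem requires. -/
theorem exists_mem_horizontalProducts (g : CarnotGroup S) : ∃ n, g ∈ horizontalProducts S n := by
  have hg : g ∈ horizontalSubgroup S := by rw [horizontalSubgroup_eq_top]; trivial
  have hmono : ∀ {m n : ℕ}, m ≤ n → (exp '' ((↑) '' Metric.closedBall (0 : S.layer 1) m : Set 𝔤)
      : Set (CarnotGroup S)) ⊆ exp '' ((↑) '' Metric.closedBall (0 : S.layer 1) n : Set 𝔤) :=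
    fun h => image_mono (image_mono (Metric.closedBall_subset_closedBall (by exact_mod_cast h)))
  have hone : ∀ n : ℕ, (1 : CarnotGroup S) ∈
      (exp '' ((↑) '' Metric.closedBall (0 : S.layer 1) n : Set 𝔤) : Set (CarnotGroup S)) :=
    fun n => ⟨0, ⟨0, by simp, rfl⟩, rfl⟩
  induction hg using Subgroup.closure_induction with
  | mem x hx =>
    obtain ⟨X, hX, rfl⟩ := hx
    obtain ⟨n, hn⟩ := exists_nat_ge ‖X‖
    refine ⟨n + 1, Set.pow_subset_pow_right (m := 1) (hone _) (by omega) ?_⟩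
    rw [pow_one]
    refine ⟨X, ⟨⟨X, hX⟩, ?_, rfl⟩, rfl⟩
    rw [mem_closedBall_zero_iff]
    push_cast
    exact hn.trans (by linarith)
  | one => exact ⟨0, by simp [horizontalProducts]⟩
  | mul x y _ _ hx hy =>
    obtain ⟨m, hm⟩ := hx
    obtain ⟨n, hn⟩ := hy
    refine ⟨m + n, ?_⟩
    rw [horizontalProducts, pow_add]
    exact Set.mul_mem_mul (Set.pow_subset_pow_left (hmono (by omega)) hm)
      (Set.pow_subset_pow_left (hmono (by omega)) hn)
  | inv x _ hx =>
    obtain ⟨n, hn⟩ := hx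
    refine ⟨n, ?_⟩
    have h1 : (exp '' ((↑) '' Metric.closedBall (0 : S.layer 1) n : Set 𝔤)
        : Set (CarnotGroup S))⁻¹ = exp '' ((↑) '' Metric.closedBall (0 : S.layer 1) n) := by
      ext z
      constructor
      · rintro ⟨_, ⟨w, hw, rfl⟩, hz⟩
        refine ⟨_, ⟨-w, by simpa using hw, rfl⟩, ?_⟩
        rw [← inv_inv z, ← hz]
        rfl
      · rintro ⟨_, ⟨w, hw, rfl⟩, rfl⟩
        exact ⟨_, ⟨-w, by simpa using hw, rfl⟩, rfl⟩
    rw [horizontalProducts, ← h1, inv_pow, Set.inv_mem_inv]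
    exact hn

variable (ip : InnerProductSpace.Core ℝ (S.layer 1))

theorem exists_isJoined_of_mem_horizontalProducts (n : ℕ) :
    ∃ C : ℝ, ∀ g ∈ horizontalProducts S n, ∃ ℓ ≤ C, IsJoined ip 1 g ℓ := by
  obtain ⟨C, hC⟩ := (isCompact_closedBall (0 : S.layer 1) n).exists_bound_of_continuousOn
    (continuous_ipNorm ip).continuousOn
  have : ∀ k : ℕ, ∀ g ∈ (exp '' ((↑) '' Metric.closedBall (0 : S.layer 1) n : Set 𝔤)
      : Set (CarnotGroup S)) ^ k, ∃ ℓ ≤ k * C, IsJoined ip 1 g ℓ := by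
    intro k
    induction k with
    | zero =>
      intro g hg
      rw [pow_zero, Set.mem_one] at hg
      exact ⟨0, by simp, by rw [hg]; exact isJoined_refl 1⟩
    | succ k ih =>
      intro g hg
      rw [pow_succ] at hg
      obtain ⟨a, ha, _, ⟨_, ⟨w, hw, rfl⟩, rfl⟩, rfl⟩ := hg
      obtain ⟨ℓ, hℓ, h⟩ := ih a ha
      refine ⟨ℓ + ipNorm ip w, ?_, ?_⟩
      · have := hC w hw
        rw [Real.norm_of_nonneg (ipNorm_nonneg ip w)] at this
        push_cast
        linarith
      · have := (isJoined_exp (ip := ip) w).mul_left a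
        rw [mul_one] at this
        exact h.trans this
  exact ⟨n * C, this n⟩

/-- A quantitative form of Chow's theorem. -/
theorem exists_isJoined_of_norm_lt : ∃ δ : ℝ, 0 < δ ∧ ∃ C : ℝ, ∀ X : 𝔤, ‖X‖ < δ →
    ∃ ℓ ≤ C, IsJoined ip (S := S) 1 (exp X) ℓ := by
  have hcomp : ∀ n, IsCompact (log '' horizontalProducts S n) := fun n =>
    (isCompact_horizontalProducts n).image continuous_log
  have hun : ⋃ n, log '' horizontalProducts S n = (univ : Set 𝔤) := by
    refine eq_univ_of_forall fun X => ?_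
    obtain ⟨n, hn⟩ := exists_mem_horizontalProducts (exp X : CarnotGroup S)
    exact mem_iUnion.2 ⟨n, _, hn, rfl⟩
  -- Baire: one of the countably many closed sets has an interior point.
  obtain ⟨n, X₀, hX₀⟩ := nonempty_interior_of_iUnion_of_closed (fun n => (hcomp n).isClosed) hun
  obtain ⟨C, hC⟩ := exists_isJoined_of_mem_horizontalProducts ip n
  have hcont : Continuous fun X : 𝔤 => S.bch X₀ X :=
    (S.contDiff_bch (n := 0) contDiff_const contDiff_id).continuous
  have h0 : S.bch X₀ 0 = X₀ := by
    have : (exp X₀ * 1 : CarnotGroup S) = exp X₀ := mul_one _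
    exact congrArg log this
  -- Translating the interior point to `1` writes every `exp X` with small `X` as `g₀⁻¹ g`, where
  -- both factors are joined to `1` by paths of bounded length.
  have hnhds : (fun X : 𝔤 => S.bch X₀ X) ⁻¹' (log '' horizontalProducts S n) ∈ 𝓝 (0 : 𝔤) := by
    refine hcont.continuousAt.preimage_mem_nhds ?_
    rw [h0]
    exact mem_interior_iff_mem_nhds.1 hX₀
  obtain ⟨δ, hδ, hball⟩ := Metric.mem_nhds_iff.1 hnhds
  obtain ⟨g₀, hg₀, hg₀X⟩ := interior_subset hX₀
  obtain ⟨ℓ₀, hℓ₀, hJ₀⟩ := hC g₀ hg₀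
  refine ⟨δ, hδ, C + C, fun X hX => ?_⟩
  obtain ⟨g, hg, hgX⟩ := hball (show X ∈ Metric.ball 0 δ by simpa using hX)
  obtain ⟨ℓ, hℓ, hJ⟩ := hC g hg
  refine ⟨ℓ₀ + ℓ, by linarith, ?_⟩
  have h1 := (hJ₀.symm.trans hJ).mul_left g₀⁻¹
  have h2 : g = g₀ * exp X := by
    apply CarnotGroup.ext
    rw [hgX, log_mul, hg₀X]
  rwa [inv_mul_cancel, h2, inv_mul_cancel_left] at h1

end Topology

end CarnotGroup

end

/-! ### The homogeneous quasi-norm and the Carnot-Carathéodory distance -/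

noncomputable section
set_option linter.unusedSectionVars false
attribute [local instance] lieNorm
attribute [local instance] lieNormedSpace

namespace Stratification

variable {𝔤 : Type*} [LieRing 𝔤] [LieAlgebra ℝ 𝔤] [FiniteDimensional ℝ 𝔤] (S : Stratification 𝔤)

/-- The square of a homogeneous quasi-norm on `𝔤`. -/
def sqNorm (X : 𝔤) : ℝ :=
  ∑ i ∈ Finset.range S.step, ‖S.proj (i + 1) X‖ ^ (2 / ((i : ℝ) + 1))

theorem sqNorm_nonneg (X : 𝔤) : 0 ≤ S.sqNorm X :=
  Finset.sum_nonneg fun _ _ => Real.rpow_nonneg (norm_nonneg _) _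

theorem continuous_sqNorm : Continuous S.sqNorm := by
  refine continuous_finsetSum _ fun i _ => ?_
  refine Continuous.rpow_const ?_ fun X => Or.inr (by positivity)
  exact ((S.proj (i + 1)).contDiff_lie (n := 0)).continuous.norm

theorem sqNorm_zero : S.sqNorm 0 = 0 := by
  refine Finset.sum_eq_zero fun i _ => ?_
  rw [map_zero, norm_zero, Real.zero_rpow (by positivity)]

theorem sqNorm_dil {t : ℝ} (ht : 0 ≤ t) (X : 𝔤) : S.sqNorm (S.dil t X) = t ^ 2 * S.sqNorm X := by
  rw [sqNorm, sqNorm, Finset.mul_sum]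
  refine Finset.sum_congr rfl fun i _ => ?_
  rw [proj_dil, norm_smul, norm_pow, Real.norm_of_nonneg ht,
    Real.mul_rpow (by positivity) (norm_nonneg _), ← Real.rpow_natCast, ← Real.rpow_mul ht]
  congr 1
  have : ((i + 1 : ℕ) : ℝ) * (2 / ((i : ℝ) + 1)) = (2 : ℕ) := by
    push_cast
    field_simp
  rw [this, Real.rpow_natCast]

theorem norm_proj_le_of_sqNorm_le {τ : ℝ} (hτ : 0 ≤ τ) {X : 𝔤} (h : S.sqNorm X ≤ τ ^ 2) (i : ℕ) :
    ‖S.proj i X‖ ≤ τ ^ i := by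
  rcases Nat.eq_zero_or_pos i with rfl | hi
  · rw [S.proj_zero]; simp
  rcases le_or_gt i S.step with hs | hs
  · obtain ⟨k, rfl⟩ : ∃ k, i = k + 1 := ⟨i - 1, by omega⟩
    have h1 : ‖S.proj (k + 1) X‖ ^ (2 / ((k : ℝ) + 1)) ≤ τ ^ 2 := by
      refine le_trans ?_ h
      exact Finset.single_le_sum (f := fun i => ‖S.proj (i + 1) X‖ ^ (2 / ((i : ℝ) + 1)))
        (fun _ _ => Real.rpow_nonneg (norm_nonneg _) _) (Finset.mem_range.2 (by omega))
    have h2 : τ ^ 2 = (τ ^ (k + 1)) ^ (2 / ((k : ℝ) + 1)) := by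
      rw [← Real.rpow_natCast τ (k + 1), ← Real.rpow_mul hτ]
      have : ((k + 1 : ℕ) : ℝ) * (2 / ((k : ℝ) + 1)) = (2 : ℕ) := by
        push_cast
        field_simp
      rw [this, Real.rpow_natCast]
    rw [h2] at h1
    exact (Real.rpow_le_rpow_iff (norm_nonneg _) (by positivity) (by positivity)).1 h1
  · rw [S.proj_of_lt hs]; simpa using pow_nonneg hτ i

theorem norm_le_of_sqNorm_le {τ : ℝ} (hτ : 0 ≤ τ) (hτ1 : τ ≤ 1) {X : 𝔤}
    (h : S.sqNorm X ≤ τ ^ 2) : ‖X‖ ≤ S.step * τ := by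
  rw [← S.sum_proj X, Finset.sum_range_succ', S.proj_zero, add_zero]
  refine (norm_sum_le _ _).trans ?_
  have : ∀ i ∈ Finset.range S.step, ‖S.proj (i + 1) X‖ ≤ τ := fun i _ =>
    (S.norm_proj_le_of_sqNorm_le hτ h (i + 1)).trans
      (pow_le_of_le_one hτ hτ1 (Nat.succ_ne_zero i))
  simpa using Finset.sum_le_sum this

theorem eq_zero_of_sqNorm_le {X : 𝔤} (h : S.sqNorm X ≤ 0) : X = 0 := by
  have := S.norm_le_of_sqNorm_le le_rfl zero_le_one (X := X) (by simpa using h)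
  simpa using this

theorem sqNorm_pos {X : 𝔤} (h : X ≠ 0) : 0 < S.sqNorm X := by
  by_contra h'
  exact h (S.eq_zero_of_sqNorm_le (not_lt.1 h'))

/-- The exponent `2 / i` equals `1` for `i = 2`, so a shift in `V₂` enters through a plain norm.
This is why the square of the quasi-norm is used: the shift between fibres will be affine in a
`V₂`-valued variable. -/
theorem sqNorm_add_of_mem_layer_two (Z : 𝔤) {z : 𝔤} (hz : z ∈ S.layer 2) :
    S.sqNorm (Z + z) = (S.sqNorm Z - ‖S.proj 2 Z‖) + ‖S.proj 2 Z + z‖ := by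
  rcases lt_or_ge S.step 2 with hs | hs
  · rw [S.layer_of_lt 2 hs, Submodule.mem_bot] at hz
    simp [hz]
  · have h1 : 1 ∈ Finset.range S.step := Finset.mem_range.2 (by omega)
    rw [sqNorm, sqNorm, ← Finset.add_sum_erase _ _ h1, ← Finset.add_sum_erase _ _ h1]
    have h2 : ∀ i ∈ (Finset.range S.step).erase 1, ‖S.proj (i + 1) (Z + z)‖ ^ (2 / ((i : ℝ) + 1))
        = ‖S.proj (i + 1) Z‖ ^ (2 / ((i : ℝ) + 1)) := by
      intro i hi
      have := Finset.ne_of_mem_erase hi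
      rw [map_add, S.proj_of_mem hz, if_neg (by omega), add_zero]
    rw [Finset.sum_congr rfl h2, map_add, S.proj_of_mem hz]
    norm_num
    ring

theorem sqNorm_sub_norm_nonneg (Z : 𝔤) : 0 ≤ S.sqNorm Z - ‖S.proj 2 Z‖ := by
  have h := S.sqNorm_add_of_mem_layer_two Z (neg_mem (S.proj_mem 2 Z))
  rw [add_neg_cancel, norm_zero, add_zero] at h
  rw [← h]
  exact S.sqNorm_nonneg _

theorem tendsto_dil_zero (X : 𝔤) : Filter.Tendsto (fun t : ℝ => S.dil t X) (𝓝 0) (𝓝 0) := by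
  have h : Continuous fun t : ℝ => S.dil t X := by
    simp only [dil, weightMap, LinearMap.sum_apply, LinearMap.smul_apply]
    fun_prop
  have h0 : S.dil 0 X = 0 := by
    refine S.eq_of_proj_eq fun i => ?_
    rw [proj_dil, map_zero]
    rcases Nat.eq_zero_or_pos i with rfl | hi
    · simp [S.proj_zero]
    · simp [hi.ne']
  simpa [h0] using h.tendsto 0

end Stratification

namespace CarnotGroup

variable {𝔤 : Type*} [LieRing 𝔤] [LieAlgebra ℝ 𝔤] [FiniteDimensional ℝ 𝔤]
variable {S : Stratification 𝔤} (ip : InnerProductSpace.Core ℝ (S.layer 1))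

/-- A dilation moves `x⁻¹ y` into the neighbourhood of `1` covered by the local result; the path
found there is dilated back. -/
theorem exists_isJoined (x y : CarnotGroup S) : ∃ ℓ, IsJoined ip x y ℓ := by
  obtain ⟨δ, hδ, C, hC⟩ := exists_isJoined_of_norm_lt ip
  have h1 := (S.tendsto_dil_zero (x⁻¹ * y).log).eventually (Metric.ball_mem_nhds 0 hδ)
  obtain ⟨ε, hε, hball⟩ := Metric.eventually_nhds_iff.1 h1
  have h2 := hball (y := ε / 2) (by rw [Real.dist_eq, sub_zero, abs_of_pos (by positivity)]; linarith)
  obtain ⟨ℓ, -, hJ⟩ := hC _ (by simpa using h2)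
  have h3 := (hJ.dilation (c := (ε / 2)⁻¹) (by positivity)).mul_left x
  have h4 : dilation (ε / 2)⁻¹ (exp (S.dil (ε / 2) (x⁻¹ * y).log)) = x⁻¹ * y := by
    have := dilation_dilation (ε / 2)⁻¹ (ε / 2) (x⁻¹ * y)
    rwa [inv_mul_cancel₀ (by positivity), dilation_one] at this
  have h5 : dilation (ε / 2)⁻¹ (1 : CarnotGroup S) = 1 := CarnotGroup.ext (map_zero (S.dil _))
  rw [h4, h5, mul_one, mul_inv_cancel_left] at h3
  exact ⟨_, h3⟩

theorem ccDist_eq (x y : CarnotGroup S) : ccDist ip x y = sInf {ℓ | IsJoined ip x y ℓ} := rfl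

variable {ip}

theorem ccDist_nonneg (x y : CarnotGroup S) : 0 ≤ ccDist ip x y :=
  Real.sInf_nonneg fun _ h => IsJoined.nonneg h

theorem IsJoined.ccDist_le {x y : CarnotGroup S} {ℓ : ℝ} (h : IsJoined ip x y ℓ) :
    ccDist ip x y ≤ ℓ := csInf_le ⟨0, fun _ h => IsJoined.nonneg h⟩ h

theorem exists_isJoined_lt {x y : CarnotGroup S} {r : ℝ} (h : ccDist ip x y < r) :
    ∃ ℓ < r, IsJoined ip x y ℓ := by
  obtain ⟨ℓ, h1, h2⟩ := exists_lt_of_csInf_lt (exists_isJoined ip x y) h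
  exact ⟨ℓ, h2, h1⟩

theorem ccDist_self (x : CarnotGroup S) : ccDist ip x x = 0 :=
  le_antisymm (isJoined_refl x).ccDist_le (ccDist_nonneg _ _)

theorem ccDist_comm (x y : CarnotGroup S) : ccDist ip x y = ccDist ip y x := by
  rw [ccDist_eq, ccDist_eq]
  congr 1
  ext ℓ
  exact ⟨IsJoined.symm, IsJoined.symm⟩

theorem ccDist_triangle (x y z : CarnotGroup S) :
    ccDist ip x z ≤ ccDist ip x y + ccDist ip y z := by
  refine le_of_forall_pos_le_add fun ε hε => ?_
  obtain ⟨a, ha, h1⟩ := exists_isJoined_lt (ip := ip) (x := x) (y := y)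
    (lt_add_of_pos_right _ (half_pos hε))
  obtain ⟨b, hb, h2⟩ := exists_isJoined_lt (ip := ip) (x := y) (y := z)
    (lt_add_of_pos_right _ (half_pos hε))
  have := (h1.trans h2).ccDist_le
  linarith

theorem ccDist_mul_left (g x y : CarnotGroup S) : ccDist ip (g * x) (g * y) = ccDist ip x y := by
  rw [ccDist_eq, ccDist_eq]
  congr 1
  ext ℓ
  refine ⟨fun h => ?_, fun h => h.mul_left g⟩
  simpa using IsJoined.mul_left h g⁻¹

theorem ccDist_dilation_le {t : ℝ} (ht : 0 < t) (x y : CarnotGroup S) :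
    ccDist ip (dilation t x) (dilation t y) ≤ t * ccDist ip x y := by
  rw [← div_le_iff₀' ht]
  refine le_csInf (exists_isJoined ip x y) fun ℓ h => ?_
  rw [div_le_iff₀' ht]
  exact (IsJoined.dilation h ht.le).ccDist_le

theorem ccDist_dilation {t : ℝ} (ht : 0 < t) (x y : CarnotGroup S) :
    ccDist ip (dilation t x) (dilation t y) = t * ccDist ip x y := by
  refine le_antisymm (ccDist_dilation_le ht x y) ?_
  have := ccDist_dilation_le (ip := ip) (inv_pos.2 ht) (dilation t x) (dilation t y)
  simp only [dilation_dilation, inv_mul_cancel₀ ht.ne', dilation_one] at this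
  rwa [inv_mul_eq_div, le_div_iff₀' ht] at this

/-- Every initial piece of a path from `x` of length less than `r` stays in the ball. -/
theorem isPreconnected_ccBall (x : CarnotGroup S) (r : ℝ) : IsPreconnected (ccBall ip x r) := by
  refine isPreconnected_of_forall x fun y hy => ?_
  obtain ⟨ℓ, hℓ, γ, u, h, rfl⟩ := exists_isJoined_lt hy
  refine ⟨γ '' Icc 0 1, ?_, ⟨0, by simp, h.source⟩, ⟨1, by simp, h.target⟩,
    isPreconnected_Icc.image γ h.continuousOn_path⟩
  rintro _ ⟨s, hs, rfl⟩
  obtain ⟨ℓ', h1, h2⟩ := h.isJoined_initial (ip := ip) hs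
  exact h2.ccDist_le.trans_lt (h1.trans_lt hℓ)

theorem ccDist_eq_one_left (x y : CarnotGroup S) : ccDist ip x y = ccDist ip 1 (x⁻¹ * y) := by
  rw [← ccDist_mul_left x⁻¹, inv_mul_cancel]

-- By homogeneity it suffices to treat one value `τ ^ 2` of the quasi-norm, small enough for the
-- bound of the local Chow theorem to apply.
variable (ip) in
theorem exists_sq_ccDist_le : ∃ C : ℝ, 0 < C ∧ ∀ g : CarnotGroup S,
    ccDist ip 1 g ^ 2 ≤ C * S.sqNorm g.log := by
  obtain ⟨δ, hδ, C, hC⟩ := exists_isJoined_of_norm_lt ip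
  have hC0 : 0 ≤ C := by
    obtain ⟨ℓ, h1, h2⟩ := hC 0 (by simpa using hδ)
    exact h2.nonneg.trans h1
  obtain ⟨τ, hτ, hτ1, hτδ⟩ : ∃ τ : ℝ, 0 < τ ∧ τ ≤ 1 ∧ S.step * τ < δ := by
    refine ⟨min 1 (δ / (S.step + 1)), by positivity, min_le_left _ _, ?_⟩
    have h1 : min 1 (δ / (S.step + 1)) ≤ δ / (S.step + 1) := min_le_right _ _
    have h2 : (0 : ℝ) < S.step + 1 := by positivity
    calc (S.step : ℝ) * min 1 (δ / (S.step + 1)) ≤ S.step * (δ / (S.step + 1)) := by gcongr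
      _ < (S.step + 1) * (δ / (S.step + 1)) := by gcongr; linarith
      _ = δ := by field_simp
  -- The summand `1` only makes the constant positive.
  refine ⟨C ^ 2 / τ ^ 2 + 1, by positivity, fun g => ?_⟩
  rcases eq_or_ne g.log 0 with h0 | h0
  · have : g = 1 := CarnotGroup.ext h0
    rw [this, ccDist_self, log_one, S.sqNorm_zero]
    simp
  have hq := S.sqNorm_pos h0
  set q := S.sqNorm g.log with hqdef
  have hsq := Real.sqrt_pos.2 hq
  have hss := Real.sq_sqrt hq.le
  set t := τ / √q with ht
  have htp : 0 < t := by positivity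
  have hn : S.sqNorm (S.dil t g.log) ≤ τ ^ 2 := by
    rw [S.sqNorm_dil htp.le, ← hqdef, ht, div_pow, hss]
    exact le_of_eq (by field_simp)
  obtain ⟨ℓ, hℓ, hJ⟩ := hC _ ((S.norm_le_of_sqNorm_le hτ.le hτ1 hn).trans_lt hτδ)
  have h1 : ccDist ip (dilation t 1) (dilation t g) ≤ C := by
    have h5 : dilation t (1 : CarnotGroup S) = 1 := CarnotGroup.ext (map_zero (S.dil _))
    rw [h5]
    exact hJ.ccDist_le.trans hℓ
  rw [ccDist_dilation htp] at h1
  have h2 : (t * ccDist ip 1 g) ^ 2 ≤ C ^ 2 :=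
    pow_le_pow_left₀ (mul_nonneg htp.le (ccDist_nonneg _ _)) h1 2
  rw [mul_pow, ht, div_pow, hss] at h2
  have h3 : ccDist ip 1 g ^ 2 ≤ C ^ 2 / τ ^ 2 * q := by
    rw [div_mul_eq_mul_div, div_le_iff₀ hq] at h2
    rw [div_mul_eq_mul_div, le_div_iff₀ (by positivity)]
    linarith
  nlinarith

-- Short paths from `1` stay where the quasi-norm is less than `1`. An element dilated to quasi-norm
-- `1` is therefore at distance at least `δ` from `1`, and homogeneity does the rest.
variable (ip) in
theorem exists_sqNorm_le : ∃ C : ℝ, 0 < C ∧ ∀ g : CarnotGroup S,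
    S.sqNorm g.log ≤ C * ccDist ip 1 g ^ 2 := by
  have hcont : Continuous fun v : 𝔤 => S.sqNorm (S.logDerInv v) :=
    S.continuous_sqNorm.comp (S.contDiff_logDerInv (n := 0)).continuous
  have h0 : S.sqNorm (S.logDerInv 0) = 0 := by rw [S.logDerInv_zero, S.sqNorm_zero]
  obtain ⟨ε, hε, hball⟩ := Metric.continuousAt_iff.1 (hcont.continuousAt (x := 0)) 1 one_pos
  obtain ⟨δ, hδ, hJ⟩ := exists_norm_logDer_lt ip hε
  have key : ∀ g : CarnotGroup S, ccDist ip 1 g < δ → S.sqNorm g.log < 1 := by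
    intro g hg
    obtain ⟨ℓ, hℓ, h⟩ := exists_isJoined_lt hg
    have h1 := hball (x := S.logDer g.log) (by simpa using hJ g ℓ h hℓ)
    rw [h0, S.logDerInv_logDer, Real.dist_eq, sub_zero] at h1
    exact (abs_lt.1 h1).2
  refine ⟨1 / δ ^ 2, by positivity, fun g => ?_⟩
  rcases eq_or_ne g.log 0 with hg0 | hg0
  · rw [hg0, S.sqNorm_zero]
    positivity
  have hq := S.sqNorm_pos hg0
  set q := S.sqNorm g.log with hqdef
  have hsq := Real.sqrt_pos.2 hq
  have hss := Real.sq_sqrt hq.le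
  set t := 1 / √q with ht
  have htp : 0 < t := by positivity
  have h1 : ¬ ccDist ip 1 (dilation t g) < δ := by
    intro h
    have h2 := key _ h
    rw [log_dilation, S.sqNorm_dil htp.le, ← hqdef, ht, div_pow, hss] at h2
    field_simp at h2
    norm_num at h2
  have h5 : dilation t (1 : CarnotGroup S) = 1 := CarnotGroup.ext (map_zero (S.dil _))
  rw [← h5, ccDist_dilation htp, not_lt] at h1
  have h2 : δ ^ 2 ≤ (t * ccDist ip 1 g) ^ 2 := pow_le_pow_left₀ hδ.le h1 2
  rw [mul_pow, ht, div_pow, hss] at h2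
  rw [div_mul_eq_mul_div, le_div_iff₀ (by positivity)]
  rw [div_mul_eq_mul_div, le_div_iff₀ hq] at h2
  linarith

theorem eq_of_ccDist_le_zero {x y : CarnotGroup S} (h : ccDist ip x y ≤ 0) : x = y := by
  obtain ⟨C, hC, h1⟩ := exists_sqNorm_le ip
  have h2 := h1 (x⁻¹ * y)
  rw [← ccDist_eq_one_left, le_antisymm h (ccDist_nonneg _ _)] at h2
  have h3 := S.eq_zero_of_sqNorm_le (by simpa using h2)
  have h4 : x⁻¹ * y = 1 := CarnotGroup.ext h3
  exact (inv_mul_eq_one.1 h4)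

theorem ccDist_pos {x y : CarnotGroup S} (h : x ≠ y) : 0 < ccDist ip x y := by
  by_contra h'
  exact h (eq_of_ccDist_le_zero (not_lt.1 h'))

/-- The triangle inequality and the upper bound by the quasi-norm, which is continuous for the
manifold topology. -/
theorem continuous_ccDist (x : CarnotGroup S) : Continuous fun y => ccDist ip x y := by
  have := isTopologicalGroup (S := S)
  obtain ⟨C, hC, h1⟩ := exists_sq_ccDist_le ip
  rw [continuous_iff_continuousAt]
  intro y₀
  have hc : Continuous fun y : CarnotGroup S => √(C * S.sqNorm (y₀⁻¹ * y).log) :=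
    Real.continuous_sqrt.comp (continuous_const.mul
      (S.continuous_sqNorm.comp (continuous_log.comp (continuous_const.mul continuous_id))))
  rw [ContinuousAt, tendsto_iff_dist_tendsto_zero]
  refine squeeze_zero (fun _ => dist_nonneg) (fun y => ?_)
    (show Filter.Tendsto (fun y : CarnotGroup S => √(C * S.sqNorm (y₀⁻¹ * y).log)) (𝓝 y₀) (𝓝 0)
      by simpa [log_one, S.sqNorm_zero] using hc.tendsto y₀)
  have h2 : ccDist ip y₀ y ≤ √(C * S.sqNorm (y₀⁻¹ * y).log) := by
    rw [ccDist_eq_one_left]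
    exact Real.le_sqrt_of_sq_le (h1 _)
  refine le_trans ?_ h2
  rw [Real.dist_eq, abs_sub_le_iff]
  constructor
  · have := ccDist_triangle (ip := ip) x y₀ y
    linarith
  · have := ccDist_triangle (ip := ip) x y y₀
    rw [ccDist_comm y y₀] at this
    linarith

theorem isOpen_ccBall (x : CarnotGroup S) (r : ℝ) : IsOpen (ccBall ip x r) :=
  isOpen_lt (continuous_ccDist x) continuous_const

theorem isCompact_ccDist_le (x : CarnotGroup S) (r : ℝ) : IsCompact {y | ccDist ip x y ≤ r} := by
  have := isTopologicalGroup (S := S)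
  have hcl : IsClosed {y | ccDist ip x y ≤ r} := isClosed_le (continuous_ccDist x) continuous_const
  obtain ⟨C, hC, h1⟩ := exists_sqNorm_le ip
  have hb : IsCompact {X : 𝔤 | S.sqNorm X ≤ C * r ^ 2} := by
    refine Metric.isCompact_of_isClosed_isBounded
      (isClosed_le S.continuous_sqNorm continuous_const) ?_
    rw [Metric.isBounded_iff_subset_closedBall 0]
    refine ⟨∑ i ∈ Finset.range (S.step + 1), √(C * r ^ 2) ^ i, fun X hX => ?_⟩
    rw [mem_closedBall_zero_iff, ← S.sum_proj X]
    refine (norm_sum_le _ _).trans (Finset.sum_le_sum fun i _ => ?_)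
    refine S.norm_proj_le_of_sqNorm_le (Real.sqrt_nonneg _) ?_ i
    rw [Real.sq_sqrt (by positivity)]
    exact hX
  refine ((hb.image continuous_exp).image (continuous_const_mul x)).of_isClosed_subset hcl
    fun y hy => ⟨x⁻¹ * y, ⟨(x⁻¹ * y).log, ?_, rfl⟩, by simp⟩
  change S.sqNorm _ ≤ _
  refine (h1 _).trans ?_
  rw [← ccDist_eq_one_left]
  gcongr
  · exact ccDist_nonneg _ _
  · exact hy

end CarnotGroup

end

/-! ### Conjugation and central elements -/

noncomputable section
set_option linter.unusedSectionVars false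

namespace Stratification

attribute [local instance] LieRing.ofAssociativeRing

variable {𝔤 : Type*} [LieRing 𝔤] [LieAlgebra ℝ 𝔤] (S : Stratification 𝔤)

theorem eq_zero_of_step_eq_zero (h : S.step = 0) (x : 𝔤) : x = 0 :=
  S.eq_zero_of_mem_filt (n := 1) (by omega) (S.mem_filt_one x)

theorem expAd_eq_add {A X : 𝔤} (h : ⁅A, ⁅A, X⁆⁆ = 0) : S.expAd A X = X + ⁅A, X⁆ := by
  rcases Nat.eq_zero_or_pos S.step with hs | hs
  · rw [S.eq_zero_of_step_eq_zero hs (S.expAd A X), S.eq_zero_of_step_eq_zero hs (X + _)]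
  obtain ⟨s, hs'⟩ : ∃ s, S.step = s + 1 := ⟨S.step - 1, by omega⟩
  have h2 : ∀ k, ((LieAlgebra.ad ℝ 𝔤 A) ^ (k + 2)) X = 0 := by
    intro k
    rw [pow_add, Module.End.mul_apply, pow_two, Module.End.mul_apply, LieAlgebra.ad_apply,
      LieAlgebra.ad_apply, h, map_zero]
  rw [expAd, nilExp, hs', Finset.sum_range_succ', Finset.sum_range_succ', LinearMap.add_apply,
    LinearMap.add_apply, LinearMap.sum_apply, Finset.sum_eq_zero fun k _ => by
      rw [LinearMap.smul_apply, h2, smul_zero]]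
  simp [add_comm]

/-- Conjugation has to be computed in the faithful representation, since the adjoint one does not
see the centre. -/
theorem expRep_mul_rep (A X : 𝔤) :
    S.expRep A * S.rep X = S.rep (S.expAd A X) * S.expRep A := by
  have h := nilExp_mul_eq (S.step + 1) (S.rep A)
    (fun k => S.rep (((LieAlgebra.ad ℝ 𝔤 A) ^ k) X)) (fun k => ?_) (fun k m hkm => ?_)
  · simp only [pow_zero, Module.End.one_apply] at h
    rw [expRep, h]
    congr 1
    simp only [expAd, nilExp, LinearMap.sum_apply, LinearMap.smul_apply, map_sum, map_smul]
  · rw [pow_succ', Module.End.mul_apply, LieAlgebra.ad_apply, LieHom.map_lie, Ring.lie_def]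
  · have hk := S.ad_pow_mem_filt A k (S.mem_filt_one X)
    cases m with
    | zero =>
      rw [S.eq_zero_of_mem_filt (n := k + 1) (by omega) hk, map_zero, zero_mul]
    | succ m =>
      refine LinearMap.ext fun p => ?_
      rw [Module.End.mul_apply, rep_pow_succ, rep_apply, zero_smul, add_zero,
        LinearMap.zero_apply]
      have h1 : ((LieAlgebra.ad ℝ 𝔤 A) ^ (m + 1)) p.1
          + p.2 • ((LieAlgebra.ad ℝ 𝔤 A) ^ m) (S.degree A) ∈ S.filt (m + 1) :=
        add_mem (S.ad_pow_mem_filt A (m + 1) (n := 0) (by simp [mem_filt]))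
          (Submodule.smul_mem _ _ (S.ad_pow_mem_filt A m (S.mem_filt_one _)))
      rw [S.eq_zero_of_mem_filt (by omega) (S.lie_mem_filt hk h1)]
      rfl

theorem expRep_mul_expRep (A X : 𝔤) :
    S.expRep A * S.expRep X = S.expRep (S.expAd A X) * S.expRep A := by
  have h : ∀ k, S.expRep A * S.rep X ^ k = S.rep (S.expAd A X) ^ k * S.expRep A := by
    intro k
    induction k with
    | zero => simp
    | succ k ih => rw [pow_succ, ← mul_assoc, ih, mul_assoc, expRep_mul_rep, ← mul_assoc, pow_succ]
  generalize S.expRep A = M at h ⊢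
  rw [expRep, expRep, nilExp, nilExp, Finset.mul_sum, Finset.sum_mul]
  exact Finset.sum_congr rfl fun k _ => by rw [mul_smul_comm, smul_mul_assoc, h k]

/-- A central summand does not change `ad X`, and it is killed by every positive power of it, so
only the term `D z` survives. -/
theorem logDer_add_of_central {z : 𝔤} (hz : ∀ x : 𝔤, ⁅x, z⁆ = 0) {i : ℕ} (hi : z ∈ S.layer i)
    (X : 𝔤) : S.logDer (X + z) = S.logDer X + (i : ℝ) • z := by
  rcases Nat.eq_zero_or_pos S.step with hs | hs
  · rw [S.eq_zero_of_step_eq_zero hs (S.logDer _), S.eq_zero_of_step_eq_zero hs (_ + _)]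
  obtain ⟨s, hs'⟩ : ∃ s, S.step = s + 1 := ⟨S.step - 1, by omega⟩
  have h1 : LieAlgebra.ad ℝ 𝔤 (X + z) = LieAlgebra.ad ℝ 𝔤 X := by
    ext y
    rw [LieAlgebra.ad_apply, LieAlgebra.ad_apply, add_lie, ← lie_skew z, hz, neg_zero, add_zero]
  have h2 : S.degree z = (i : ℝ) • z := S.weightMap_of_mem _ hi
  have h3 : ∀ k, ((LieAlgebra.ad ℝ 𝔤 X) ^ (k + 1)) z = 0 := by
    intro k
    rw [pow_succ, Module.End.mul_apply, LieAlgebra.ad_apply, hz, map_zero]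
  simp only [logDer, h1, map_add, smul_add, Finset.sum_add_distrib, h2]
  congr 1
  rw [hs', Finset.sum_range_succ']
  simp [h3]

theorem bch_of_central {z : 𝔤} (hz : ∀ x : 𝔤, ⁅x, z⁆ = 0) {i : ℕ} (hi : z ∈ S.layer i)
    (X : 𝔤) : S.bch X z = X + z := by
  apply S.logDer_bijective.1
  have h1 : S.logDer z = (i : ℝ) • z := by
    have := S.logDer_add_of_central hz hi 0
    rwa [zero_add, logDer_zero, zero_add] at this
  rw [logDer_bch, S.logDer_add_of_central hz hi, h1, map_smul,
    S.expAd_eq_add (by rw [hz, lie_zero]), hz, add_zero]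

theorem proj_one_bch (X Y : 𝔤) : S.proj 1 (S.bch X Y) = S.proj 1 X + S.proj 1 Y := by
  have h := S.bch_sub_mem_filt (S.mem_filt_one X) (S.mem_filt_one Y)
  rw [mem_filt] at h
  have := h 1 (by omega)
  rwa [map_sub, sub_eq_zero, map_add] at this

end Stratification

end

/-! ### The fibres: algebra of `𝔥` and distances between cosets of `H` -/

noncomputable section
set_option linter.unusedSectionVars false
attribute [local instance] lieNorm
attribute [local instance] lieNormedSpace

theorem Submodule.exists_projection {V : Type*} [AddCommGroup V] [Module ℝ V]
    (W : Submodule ℝ V) : ∃ π : V →ₗ[ℝ] V, (∀ x, π x ∈ W) ∧ ∀ w ∈ W, π w = w := by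
  obtain ⟨g, hg⟩ := W.subtype.exists_leftInverse_of_injective W.ker_subtype
  refine ⟨W.subtype ∘ₗ g, fun x => (g x).2, fun w hw => ?_⟩
  have := LinearMap.congr_fun hg ⟨w, hw⟩
  exact congrArg Subtype.val this

/-- The span of the brackets of elements of `W`. -/
def Submodule.derived {𝔤 : Type*} [LieRing 𝔤] [LieAlgebra ℝ 𝔤] (W : Submodule ℝ 𝔤) :
    Submodule ℝ 𝔤 := Submodule.span ℝ {z | ∃ a ∈ W, ∃ b ∈ W, z = ⁅a, b⁆}

/-- A subspace of the first layer which commutes with all higher layers. -/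
structure Stratification.IsCommuting {𝔤 : Type*} [LieRing 𝔤] [LieAlgebra ℝ 𝔤]
    (S : Stratification 𝔤) (W : Submodule ℝ 𝔤) : Prop where
  le_layer : W ≤ S.layer 1
  lie_eq_zero : ∀ i, 2 ≤ i → ∀ w ∈ W, ∀ v ∈ S.layer i, ⁅w, v⁆ = 0

namespace Stratification.IsCommuting

variable {𝔤 : Type*} [LieRing 𝔤] [LieAlgebra ℝ 𝔤] {S : Stratification 𝔤} {W : Submodule ℝ 𝔤}

theorem derived_le_layer (hW : S.IsCommuting W) : W.derived ≤ S.layer 2 := by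
  refine Submodule.span_le.2 ?_
  rintro _ ⟨a, ha, b, hb, rfl⟩
  exact S.lie_mem 1 1 a b (hW.le_layer ha) (hW.le_layer hb)

/-- By the Jacobi identity it is enough that `[[x, c], d] = 0` for `c, d ∈ W`. For `x ∈ V₁` the
inner bracket lies in `V₂`, which commutes with `W`; for deeper `x` it already vanishes. -/
theorem lie_derived (hW : S.IsCommuting W) {z : 𝔤} (hz : z ∈ W.derived) (x : 𝔤) : ⁅x, z⁆ = 0 := by
  induction hz using Submodule.span_induction with
  | mem z hz =>
    obtain ⟨a, ha, b, hb, rfl⟩ := hz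
    refine S.layer_induction (p := fun x => ⁅x, ⁅a, b⁆⁆ = 0) (by simp)
      (fun x y hx hy => by rw [add_lie, hx, hy, add_zero]) (fun i x hx => ?_) x
    have h0 : ∀ c ∈ W, ∀ d ∈ W, ⁅⁅x, c⁆, d⁆ = 0 := by
      intro c hc d hd
      rcases lt_trichotomy i 1 with hi | rfl | hi
      · obtain rfl : i = 0 := by omega
        rw [S.layer_zero, Submodule.mem_bot] at hx
        simp [hx]
      · rw [← lie_skew, hW.lie_eq_zero 2 le_rfl d hd _
          (S.lie_mem 1 1 x c hx (hW.le_layer hc)), neg_zero]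
      · rw [← lie_skew x c, hW.lie_eq_zero i (by omega) c hc x hx, neg_zero, zero_lie]
    rw [leibniz_lie, h0 a ha b hb, zero_add, ← lie_skew, h0 b hb a ha, neg_zero]
  | zero => simp
  | add y z _ _ hy hz => rw [lie_add, hy, hz, add_zero]
  | smul c z _ hz => rw [lie_smul, hz, smul_zero]

theorem lie_eq_lie_proj_one (hW : S.IsCommuting W) {w : 𝔤} (hw : w ∈ W) (X : 𝔤) :
    ⁅w, X⁆ = ⁅w, S.proj 1 X⁆ := by
  refine S.layer_induction (p := fun X => ⁅w, X⁆ = ⁅w, S.proj 1 X⁆) (by simp)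
    (fun x y hx hy => by rw [lie_add, hx, hy, map_add, lie_add]) (fun i x hx => ?_) X
  rw [S.proj_of_mem hx]
  split_ifs with h
  · rfl
  · rw [lie_zero]
    rcases Nat.eq_zero_or_pos i with rfl | hi
    · rw [S.layer_zero, Submodule.mem_bot] at hx
      rw [hx, lie_zero]
    · exact hW.lie_eq_zero i (by omega) w hw x hx

theorem lie_mem_layer_two (hW : S.IsCommuting W) {w : 𝔤} (hw : w ∈ W) (X : 𝔤) :
    ⁅w, X⁆ ∈ S.layer 2 := by
  rw [hW.lie_eq_lie_proj_one hw]
  exact S.lie_mem 1 1 _ _ (hW.le_layer hw) (S.proj_mem 1 X)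

/-- As `[W, W]` is central, `W + [W, W]` is closed under brackets. -/
theorem mem_lieSpan_iff (hW : S.IsCommuting W) {x : 𝔤} :
    x ∈ LieSubalgebra.lieSpan ℝ 𝔤 (W : Set 𝔤) ↔ ∃ w ∈ W, ∃ z ∈ W.derived, x = w + z := by
  constructor
  · let K : LieSubalgebra ℝ 𝔤 :=
      { W ⊔ W.derived with
        lie_mem' := by
          intro x y hx hy
          obtain ⟨w, hw, z, hz, rfl⟩ := Submodule.mem_sup.1 hx
          obtain ⟨w', hw', z', hz', rfl⟩ := Submodule.mem_sup.1 hy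
          rw [lie_add, hW.lie_derived hz', add_zero, add_lie, ← lie_skew z, hW.lie_derived hz,
            neg_zero, add_zero]
          exact Submodule.mem_sup_right (Submodule.subset_span ⟨w, hw, w', hw', rfl⟩) }
    intro hx
    have h1 : LieSubalgebra.lieSpan ℝ 𝔤 (W : Set 𝔤) ≤ K :=
      LieSubalgebra.lieSpan_le.2 fun w hw => Submodule.mem_sup_left hw
    obtain ⟨w, hw, z, hz, rfl⟩ := Submodule.mem_sup.1 (h1 hx : x ∈ W ⊔ W.derived)
    exact ⟨w, hw, z, hz, rfl⟩
  · rintro ⟨w, hw, z, hz, rfl⟩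
    have hle : ∀ v ∈ W, v ∈ LieSubalgebra.lieSpan ℝ 𝔤 (W : Set 𝔤) :=
      fun v hv => LieSubalgebra.subset_lieSpan hv
    refine add_mem (hle w hw) ?_
    have h2 : W.derived ≤ (LieSubalgebra.lieSpan ℝ 𝔤 (W : Set 𝔤)).toSubmodule := by
      refine Submodule.span_le.2 ?_
      rintro _ ⟨a, ha, b, hb, rfl⟩
      exact LieSubalgebra.lie_mem _ (hle a ha) (hle b hb)
    exact h2 hz

theorem proj_one_mem (hW : S.IsCommuting W) {x : 𝔤}
    (hx : x ∈ LieSubalgebra.lieSpan ℝ 𝔤 (W : Set 𝔤)) :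
    S.proj 1 x ∈ W ∧ x - S.proj 1 x ∈ W.derived := by
  obtain ⟨w, hw, z, hz, rfl⟩ := hW.mem_lieSpan_iff.1 hx
  have : S.proj 1 (w + z) = w := by
    rw [map_add, S.proj_of_mem (hW.le_layer hw), if_pos rfl,
      S.proj_of_mem (hW.derived_le_layer hz), if_neg (by omega), add_zero]
  rw [this, add_sub_cancel_left]
  exact ⟨hw, hz⟩

/-- Only `a₁` and `X₁` contribute to `[a, X]`, which lies in `V₂`; its bracket with `a` is therefore
zero and the exponential series stops. -/
theorem expAd_apply (hW : S.IsCommuting W) {a : 𝔤}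
    (ha : a ∈ LieSubalgebra.lieSpan ℝ 𝔤 (W : Set 𝔤)) (X : 𝔤) :
    S.expAd a X = X + ⁅S.proj 1 a, S.proj 1 X⁆ := by
  obtain ⟨hw, hz⟩ := hW.proj_one_mem ha
  have h1 : ∀ Y, ⁅a, Y⁆ = ⁅S.proj 1 a, S.proj 1 Y⁆ := by
    intro Y
    rw [← hW.lie_eq_lie_proj_one hw, ← sub_eq_zero, ← sub_lie, ← lie_skew, hW.lie_derived hz,
      neg_zero]
  rw [S.expAd_eq_add, h1]
  rw [h1 ⁅a, X⁆, h1 X, S.proj_of_mem (S.lie_mem 1 1 _ _ (S.proj_mem 1 a) (S.proj_mem 1 X)),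
    if_neg (by omega), lie_zero]

theorem logDer_apply (hW : S.IsCommuting W) {w z : 𝔤} (hw : w ∈ W) (hz : z ∈ W.derived) :
    S.logDer (w + z) = w + (2 : ℝ) • z := by
  rw [S.logDer_add_of_central (hW.lie_derived hz) (hW.derived_le_layer hz),
    S.logDer_of_mem (hW.le_layer hw)]
  simp

/-- Brackets of elements of `𝔥` are central, so the product stops at the first bracket. In
particular `𝔥` is closed under it. -/
theorem bch_apply (hW : S.IsCommuting W) {a b : 𝔤}
    (ha : a ∈ LieSubalgebra.lieSpan ℝ 𝔤 (W : Set 𝔤))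
    (hb : b ∈ LieSubalgebra.lieSpan ℝ 𝔤 (W : Set 𝔤)) :
    S.bch a b = a + b + (1 / 2 : ℝ) • ⁅S.proj 1 a, S.proj 1 b⁆ := by
  have ha' := ha
  have hpa := (hW.proj_one_mem ha).1
  have hpb := (hW.proj_one_mem hb).1
  have hsa := (hW.proj_one_mem ha).2
  have hsb := (hW.proj_one_mem hb).2
  set w := S.proj 1 a
  set w' := S.proj 1 b
  obtain ⟨z, hz, hza⟩ : ∃ z ∈ W.derived, a = w + z := ⟨_, hsa, by abel⟩
  obtain ⟨z', hz', hzb⟩ : ∃ z ∈ W.derived, b = w' + z := ⟨_, hsb, by abel⟩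
  have hc : ⁅w, w'⁆ ∈ W.derived := Submodule.subset_span ⟨w, hpa, w', hpb, rfl⟩
  apply S.logDer_bijective.1
  have e1 : a + b + (1 / 2 : ℝ) • ⁅w, w'⁆ = (w + w') + (z + z' + (1 / 2 : ℝ) • ⁅w, w'⁆) := by
    rw [hza, hzb]; abel
  have e2 : S.logDer b = w' + (2 : ℝ) • z' := by rw [hzb, hW.logDer_apply hpb hz']
  have e3 : S.logDer a = w + (2 : ℝ) • z := by
    conv_lhs => rw [hza]
    exact hW.logDer_apply hpa hz
  have e4 : S.proj 1 (w' + (2 : ℝ) • z') = w' := by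
    rw [map_add, map_smul, S.proj_of_mem (hW.le_layer hpb), if_pos rfl,
      S.proj_of_mem (hW.derived_le_layer hz'), if_neg (by omega), smul_zero, add_zero]
  rw [S.logDer_bch, e1, hW.logDer_apply (add_mem hpa hpb)
    (add_mem (add_mem hz hz') (Submodule.smul_mem _ _ hc)), hW.expAd_apply ha', e2, e3, e4]
  simp only [smul_add, smul_smul]
  norm_num
  abel

theorem dil_mem (hW : S.IsCommuting W) {a : 𝔤}
    (ha : a ∈ LieSubalgebra.lieSpan ℝ 𝔤 (W : Set 𝔤)) (t : ℝ) :
    S.dil t a ∈ LieSubalgebra.lieSpan ℝ 𝔤 (W : Set 𝔤) := by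
  obtain ⟨w, hw, z, hz, rfl⟩ := hW.mem_lieSpan_iff.1 ha
  rw [hW.mem_lieSpan_iff]
  refine ⟨t ^ 1 • w, Submodule.smul_mem _ _ hw, t ^ 2 • z, Submodule.smul_mem _ _ hz, ?_⟩
  rw [map_add, S.dil_of_mem t (hW.le_layer hw), S.dil_of_mem t (hW.derived_le_layer hz)]

end Stratification.IsCommuting

namespace CarnotGroup

variable {𝔤 : Type*} [LieRing 𝔤] [LieAlgebra ℝ 𝔤] {S : Stratification 𝔤} {W : Submodule ℝ 𝔤}

variable (S W) in
/-- The subgroup `H` of `G` generated by `W`. -/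
abbrev fibreSubgroup : Subgroup (CarnotGroup S) :=
  subgroupOf (LieSubalgebra.lieSpan ℝ 𝔤 (W : Set 𝔤))

theorem mem_fibreSubgroup (hW : S.IsCommuting W) {g : CarnotGroup S} :
    g ∈ fibreSubgroup S W ↔ g.log ∈ LieSubalgebra.lieSpan ℝ 𝔤 (W : Set 𝔤) := by
  constructor
  · intro hg
    induction hg using Subgroup.closure_induction with
    | mem x hx =>
      obtain ⟨X, hX, rfl⟩ := hx
      exact hX
    | one => rw [log_one]; exact zero_mem _
    | mul x y _ _ hx hy =>
      rw [log_mul, hW.bch_apply hx hy]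
      refine add_mem (add_mem hx hy) ?_
      have h := LieSubalgebra.lie_mem _
        (LieSubalgebra.subset_lieSpan (R := ℝ) (hW.proj_one_mem hx).1)
        (LieSubalgebra.subset_lieSpan (R := ℝ) (hW.proj_one_mem hy).1)
      exact Submodule.smul_mem (LieSubalgebra.lieSpan ℝ 𝔤 (W : Set 𝔤)).toSubmodule _ h
    | inv x _ hx => rw [log_inv]; exact neg_mem hx
  · intro h
    exact Subgroup.subset_closure ⟨g.log, h, rfl⟩

theorem dilation_mem_fibreSubgroup (hW : S.IsCommuting W) {g : CarnotGroup S}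
    (hg : g ∈ fibreSubgroup S W) (t : ℝ) : dilation t g ∈ fibreSubgroup S W := by
  rw [mem_fibreSubgroup hW] at hg ⊢
  exact hW.dil_mem hg t

theorem exp_mul_exp (A X : 𝔤) :
    (exp A * exp X : CarnotGroup S) = exp (S.expAd A X) * exp A := by
  apply expRep_log_injective
  simp only [expRep_log_mul]
  exact S.expRep_mul_expRep A X

/-- The source of the affine functions: moving along the fibre changes the transversal coordinate
`X` by a term in `V₂` that is linear in the first layer of `log h`. -/
theorem inv_mul_exp (hW : S.IsCommuting W) {h : CarnotGroup S} (hh : h ∈ fibreSubgroup S W)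
    (X : 𝔤) : h⁻¹ * exp X = exp (X - ⁅S.proj 1 h.log, S.proj 1 X⁆) * h⁻¹ := by
  have h1 : -h.log ∈ LieSubalgebra.lieSpan ℝ 𝔤 (W : Set 𝔤) :=
    neg_mem ((mem_fibreSubgroup hW).1 hh)
  have h2 := exp_mul_exp (S := S) (-h.log) X
  rw [hW.expAd_apply h1, map_neg, neg_lie, ← sub_eq_add_neg] at h2
  exact h2

theorem exp_add_derived (hW : S.IsCommuting W) (X : 𝔤) {z : 𝔤} (hz : z ∈ W.derived) :
    (exp (X + z) : CarnotGroup S) = exp X * exp z :=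
  CarnotGroup.ext (S.bch_of_central (hW.lie_derived hz) (hW.derived_le_layer hz) X).symm

theorem exp_mem_fibreSubgroup {w : 𝔤} (hw : w ∈ W) : (exp w : CarnotGroup S) ∈ fibreSubgroup S W :=
  Subgroup.subset_closure ⟨w, LieSubalgebra.subset_lieSpan (R := ℝ) (L := 𝔤) hw, rfl⟩

theorem exp_mem_fibreSubgroup_of_derived (hW : S.IsCommuting W) {z : 𝔤} (hz : z ∈ W.derived) :
    (exp z : CarnotGroup S) ∈ fibreSubgroup S W :=
  (mem_fibreSubgroup hW).2 (hW.mem_lieSpan_iff.2 ⟨0, zero_mem _, z, hz, (zero_add z).symm⟩)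

section

variable [FiniteDimensional ℝ 𝔤]

/-- A homogeneous complement of the fibre subalgebra which is transversal to the fibres. -/
theorem exists_transversal (hW : S.IsCommuting W) : ∃ π : 𝔤 →ₗ[ℝ] 𝔤, (∀ x, π x ∈ W.derived) ∧
    ∃ M : Submodule ℝ 𝔤, (∀ X ∈ M, ∀ y, X + (y - π y) ∈ M ∨ y ∉ S.layer 2) ∧
      (∀ g : CarnotGroup S, ∃ X ∈ M, ∃ h ∈ fibreSubgroup S W, g = exp X * h) ∧
      ∃ C : ℝ, 0 < C ∧ ∀ X ∈ M, ∀ h ∈ fibreSubgroup S W,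
        S.sqNorm X ≤ C * S.sqNorm (exp X * h : CarnotGroup S).log := by
  obtain ⟨π₁, hπ₁, hπ₁'⟩ := W.exists_projection
  obtain ⟨π₂, hπ₂, hπ₂'⟩ := W.derived.exists_projection
  -- `M` is defined layer by layer: no `W` component in `V₁` and no `[W, W]` component in `V₂`. It
  -- is therefore invariant under dilations.
  set M : Submodule ℝ 𝔤 := LinearMap.ker (π₁ ∘ₗ S.proj 1) ⊓ LinearMap.ker (π₂ ∘ₗ S.proj 2) with hM
  have hmem : ∀ X, X ∈ M ↔ π₁ (S.proj 1 X) = 0 ∧ π₂ (S.proj 2 X) = 0 := fun X => by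
    simp [hM]
  refine ⟨π₂, hπ₂, M, ?_, ?_, ?_⟩
  · intro X hX y
    by_cases hy : y ∈ S.layer 2
    · left
      have hy' : y - π₂ y ∈ S.layer 2 := sub_mem hy (hW.derived_le_layer (hπ₂ y))
      rw [hmem] at hX ⊢
      rw [map_add, map_add (S.proj 2), S.proj_of_mem hy' 1, S.proj_of_mem hy' 2,
        if_neg (by omega), if_pos rfl, add_zero, map_add, hX.2, map_sub, hπ₂' _ (hπ₂ y)]
      simp [hX.1]
    · exact Or.inr hy
  · intro g
    set w := π₁ (S.proj 1 g.log) with hw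
    have hwW : w ∈ W := hπ₁ _
    -- The `W` component is removed by a right translation. The `[W, W]` component then splits off
    -- because it is central.
    set g₁ := g * exp (-w) with hg₁
    have h1 : S.proj 1 g₁.log = S.proj 1 g.log - w := by
      rw [hg₁, log_mul, S.proj_one_bch, S.proj_of_mem (neg_mem (hW.le_layer hwW)), if_pos rfl,
        sub_eq_add_neg]
    set z := π₂ (S.proj 2 g₁.log) with hz
    have hzW : z ∈ W.derived := hπ₂ _
    have hz2 := hW.derived_le_layer hzW
    refine ⟨g₁.log - z, ?_, exp z * exp w, mul_mem (exp_mem_fibreSubgroup_of_derived hW hzW)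
      (exp_mem_fibreSubgroup hwW), ?_⟩
    · rw [hmem, map_sub, map_sub (S.proj 2), S.proj_of_mem hz2 1, S.proj_of_mem hz2 2,
        if_neg (by omega), if_pos rfl, h1, sub_zero, map_sub, map_sub, hπ₁' w hwW, hπ₂' z hzW]
      simp [← hw, ← hz]
    · rw [← mul_assoc, ← exp_add_derived hW _ hzW, sub_add_cancel]
      have : exp (-w) = (exp w : CarnotGroup S)⁻¹ := rfl
      change g = g₁ * exp w
      rw [hg₁, this, inv_mul_cancel_right]
  · set 𝔥 := (LieSubalgebra.lieSpan ℝ 𝔤 (W : Set 𝔤)).toSubmodule with h𝔥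
    -- A compact unit sphere in `M × 𝔥`. On it `exp X · exp a ≠ 1`, because `M ∩ 𝔥 = 0`, so the
    -- quasi-norm of the product has a positive minimum; dilations extend the estimate to all pairs.
    set K : Set (𝔤 × 𝔤) := {p | p.1 ∈ M ∧ p.2 ∈ 𝔥 ∧ S.sqNorm p.1 + S.sqNorm p.2 = 1} with hK
    have hKc : IsCompact K := by
      refine Metric.isCompact_of_isClosed_isBounded ?_ ?_
      · have c1 : IsClosed {p : 𝔤 × 𝔤 | p.1 ∈ M} :=
          M.closed_of_finiteDimensional.preimage continuous_fst
        have c2 : IsClosed {p : 𝔤 × 𝔤 | p.2 ∈ 𝔥} :=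
          𝔥.closed_of_finiteDimensional.preimage continuous_snd
        have c3 : IsClosed {p : 𝔤 × 𝔤 | S.sqNorm p.1 + S.sqNorm p.2 = 1} :=
          isClosed_eq ((S.continuous_sqNorm.comp continuous_fst).add
            (S.continuous_sqNorm.comp continuous_snd)) continuous_const
        exact c1.inter (c2.inter c3)
      · rw [Metric.isBounded_iff_subset_closedBall 0]
        refine ⟨S.step, fun p hp => ?_⟩
        rw [mem_closedBall_zero_iff, Prod.norm_def]
        have n1 := S.sqNorm_nonneg p.1
        have n2 := S.sqNorm_nonneg p.2
        have n3 := hp.2.2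
        have := S.norm_le_of_sqNorm_le zero_le_one le_rfl (X := p.1) (by linarith)
        have := S.norm_le_of_sqNorm_le zero_le_one le_rfl (X := p.2) (by linarith)
        simp_all
    have hcont : Continuous fun p : 𝔤 × 𝔤 => S.sqNorm (S.bch p.1 p.2) :=
      S.continuous_sqNorm.comp (S.contDiff_bch (n := 0) contDiff_fst contDiff_snd).continuous
    have hpos : ∀ p ∈ K, 0 < S.sqNorm (S.bch p.1 p.2) := by
      rintro ⟨X, a⟩ ⟨hX, ha, hXa⟩
      refine S.sqNorm_pos fun h0 => ?_
      have h1 : (exp X * exp a : CarnotGroup S) = 1 := CarnotGroup.ext h0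
      have h2 : X = -a := congrArg log (eq_inv_of_mul_eq_one_left h1)
      have h3 : X ∈ LieSubalgebra.lieSpan ℝ 𝔤 (W : Set 𝔤) := by rw [h2]; exact neg_mem ha
      obtain ⟨w, hw, z, hz, hwz⟩ := hW.mem_lieSpan_iff.1 h3
      obtain ⟨e1, e2⟩ := (hmem X).1 hX
      rw [hwz, map_add, S.proj_of_mem (hW.le_layer hw), S.proj_of_mem (hW.derived_le_layer hz)]
        at e1 e2
      simp only [if_true, OfNat.one_ne_ofNat, OfNat.ofNat_ne_one, if_false, add_zero, zero_add,
        hπ₁' w hw, hπ₂' z hz] at e1 e2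
      have h4 : X = 0 := by rw [hwz, e1, e2, add_zero]
      have h5 : a = 0 := by rw [← neg_eq_zero, ← h2, h4]
      simp [h4, h5, S.sqNorm_zero] at hXa
    obtain ⟨m, hm, hmin⟩ : ∃ m : ℝ, 0 < m ∧ ∀ p ∈ K, m ≤ S.sqNorm (S.bch p.1 p.2) := by
      rcases K.eq_empty_or_nonempty with he | hne
      · exact ⟨1, one_pos, fun p hp => by rw [he] at hp; exact hp.elim⟩
      · obtain ⟨p, hp, hmin⟩ := hKc.exists_isMinOn hne hcont.continuousOn
        exact ⟨_, hpos p hp, fun q hq => hmin hq⟩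
    refine ⟨1 / m, by positivity, fun X hX h hh => ?_⟩
    rw [mem_fibreSubgroup hW] at hh
    have n1 := S.sqNorm_nonneg X
    have n2 := S.sqNorm_nonneg h.log
    rcases n1.eq_or_lt with h0 | h0
    · rw [← h0]
      exact mul_nonneg (by positivity) (S.sqNorm_nonneg _)
    set q := S.sqNorm X + S.sqNorm h.log with hq
    have hqp : 0 < q := by linarith
    set t := 1 / √q with ht
    have htp : 0 < t := by have := Real.sqrt_pos.2 hqp; positivity
    have ht2 : t ^ 2 * q = 1 := by
      rw [ht, div_pow, Real.sq_sqrt hqp.le]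
      field_simp
    have h1 := hmin (S.dil t X, S.dil t h.log) ⟨?_, hW.dil_mem hh t, ?_⟩
    · simp only [← S.dil_bch, S.sqNorm_dil htp.le] at h1
      rw [log_mul]
      change S.sqNorm X ≤ 1 / m * S.sqNorm (S.bch X h.log)
      rw [div_mul_eq_mul_div, le_div_iff₀ hm, one_mul]
      have h2 : q * m ≤ q * (t ^ 2 * S.sqNorm (S.bch X h.log)) := by gcongr
      rw [← mul_assoc, mul_comm q (t ^ 2), ht2, one_mul] at h2
      nlinarith
    · rw [hmem] at hX ⊢
      simp only [S.proj_dil, map_smul, hX.1, hX.2, smul_zero, and_self]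
    · simp only [S.sqNorm_dil htp.le]
      rw [← mul_add, ← hq, ht2]

variable (ip : InnerProductSpace.Core ℝ (S.layer 1))

/-- The squared distance from the points `h` of the fibre `H` to a fibre `g H` is comparable to
the sum of a constant and the norm of an affine function of the first layer of `log h`. -/
theorem exists_fibre_dist (hW : S.IsCommuting W) : ∃ C : ℝ, 0 < C ∧ ∀ g : CarnotGroup S,
    ∃ E : ℝ, 0 ≤ E ∧ ∃ Y : 𝔤, ∃ T : 𝔤 →ₗ[ℝ] 𝔤, ∀ h ∈ fibreSubgroup S W,
      (∀ h' ∈ fibreSubgroup S W, E + ‖Y + T (S.proj 1 h.log)‖ ≤ C * ccDist ip h (g * h') ^ 2) ∧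
      ∃ h' ∈ fibreSubgroup S W, ccDist ip h (g * h') ^ 2 ≤ C * (E + ‖Y + T (S.proj 1 h.log)‖) := by
  obtain ⟨π, hπ, M, hM1, hM2, C₁, hC₁, hC₁'⟩ := exists_transversal hW
  obtain ⟨C₂, hC₂, hC₂'⟩ := exists_sq_ccDist_le ip
  obtain ⟨C₃, hC₃, hC₃'⟩ := exists_sqNorm_le ip
  refine ⟨C₂ + C₁ * C₃, by positivity, fun g => ?_⟩
  obtain ⟨X, hX, h₀, hh₀, rfl⟩ := hM2 g
  -- The shift `-[w, X₁]`, with its `[W, W]` part removed, since that part can be absorbed into the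
  -- coset.
  set T : 𝔤 →ₗ[ℝ] 𝔤 :=
    (π - LinearMap.id) ∘ₗ (LieModule.toEnd ℝ 𝔤 𝔤 : 𝔤 →ₗ[ℝ] Module.End ℝ 𝔤).flip (S.proj 1 X)
    with hT
  have hTa : ∀ w, T w = π ⁅w, S.proj 1 X⁆ - ⁅w, S.proj 1 X⁆ := fun w => by simp [hT]
  refine ⟨S.sqNorm X - ‖S.proj 2 X‖, S.sqNorm_sub_norm_nonneg X, S.proj 2 X, T, fun h hh => ?_⟩
  set w := S.proj 1 h.log with hw
  have hwW : w ∈ W := (hW.proj_one_mem ((mem_fibreSubgroup hW).1 hh)).1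
  have hl2 : ⁅w, S.proj 1 X⁆ ∈ S.layer 2 := hW.lie_mem_layer_two hwW _
  have hTl : T w ∈ S.layer 2 := by
    rw [hTa]; exact sub_mem (hW.derived_le_layer (hπ _)) hl2
  have hZM : X + T w ∈ M := by
    have := (hM1 X hX (-⁅w, S.proj 1 X⁆)).resolve_right (not_not.2 (neg_mem hl2))
    rw [hTa]
    convert this using 2
    rw [map_neg]; abel
  have hQ : S.sqNorm (X + T w) = S.sqNorm X - ‖S.proj 2 X‖ + ‖S.proj 2 X + T w‖ :=
    S.sqNorm_add_of_mem_layer_two X hTl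
  set z := π ⁅w, S.proj 1 X⁆ with hz
  -- Splits `h⁻¹ exp X` into its transversal factor, whose coordinate is `X + T w ∈ M`, and a factor
  -- in `H`.
  have hfac : h⁻¹ * exp X = exp (X + T w) * (exp (-z) * h⁻¹) := by
    rw [inv_mul_exp hW hh, ← mul_assoc, ← exp_add_derived hW _ (neg_mem (hπ _)), ← hw, hTa]
    congr 2
    abel
  have hzH : (exp (-z) : CarnotGroup S) ∈ fibreSubgroup S W :=
    exp_mem_fibreSubgroup_of_derived hW (neg_mem (hπ _))
  rw [← hQ]
  have hQ0 := S.sqNorm_nonneg (X + T w)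
  constructor
  · intro h' hh'
    have h1 : h⁻¹ * (exp X * h₀ * h') = exp (X + T w) * (exp (-z) * h⁻¹ * h₀ * h') := by
      rw [← mul_assoc, ← mul_assoc, hfac]; group
    rw [ccDist_eq_one_left, h1]
    have h2 := hC₁' _ hZM (exp (-z) * h⁻¹ * h₀ * h')
      (mul_mem (mul_mem (mul_mem hzH (inv_mem hh)) hh₀) hh')
    have h3 := hC₃' (exp (X + T w) * (exp (-z) * h⁻¹ * h₀ * h'))
    set d2 := ccDist ip 1 (exp (X + T w) * (exp (-z) * h⁻¹ * h₀ * h')) ^ 2 with hd2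
    have h4 : 0 ≤ d2 := sq_nonneg _
    calc S.sqNorm (X + T w) ≤ C₁ * (C₃ * d2) := h2.trans (by gcongr)
      _ ≤ (C₂ + C₁ * C₃) * d2 := by nlinarith
  -- This `h'` cancels the `H` factor, so only the transversal factor contributes to the distance.
  · refine ⟨h₀⁻¹ * (exp (-z) * h⁻¹)⁻¹, mul_mem (inv_mem hh₀)
      (inv_mem (mul_mem hzH (inv_mem hh))), ?_⟩
    have h1 : h⁻¹ * (exp X * h₀ * (h₀⁻¹ * (exp (-z) * h⁻¹)⁻¹)) = exp (X + T w) := by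
      have : h⁻¹ * (exp X * h₀ * (h₀⁻¹ * (exp (-z) * h⁻¹)⁻¹))
        = h⁻¹ * exp X * (exp (-z) * h⁻¹)⁻¹ := by group
      rw [this, hfac, mul_inv_cancel_right]
    rw [ccDist_eq_one_left, h1]
    refine (hC₂' _).trans ?_
    change C₂ * S.sqNorm (X + T w) ≤ _
    have : 0 ≤ C₁ * C₃ * S.sqNorm (X + T w) := by positivity
    linarith

/-- There are parallel fibres at all distances. -/
theorem exists_parallel (hW : S.IsCommuting W) (hlt : W < S.layer 1) :
    ∃ N₀ N₁ : ℝ, 0 < N₀ ∧ 0 < N₁ ∧ ∀ a : ℝ, 0 < a → ∃ k : CarnotGroup S,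
      ccDist ip 1 k = N₁ * a ∧ (∀ h ∈ fibreSubgroup S W, N₀ * a ≤ ccDist ip 1 (k * h)) ∧
      ∀ h ∈ fibreSubgroup S W, k⁻¹ * h * k ∈ fibreSubgroup S W := by
  -- If some `V_j` with `j ≥ 2` is not contained in `𝔥`, a vector there has no first-layer
  -- component. Otherwise any `X ∈ V₁` outside `W` serves, because `[W, X] ⊆ V₂ ∩ 𝔥 = [W, W]`.
  obtain ⟨j, X, hXj, hXH, hXW⟩ : ∃ j, ∃ X ∈ S.layer j,
      X ∉ LieSubalgebra.lieSpan ℝ 𝔤 (W : Set 𝔤) ∧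
      ∀ w ∈ W, ⁅w, S.proj 1 X⁆ ∈ W.derived := by
    by_cases hex : ∃ j, 2 ≤ j ∧ ∃ X ∈ S.layer j, X ∉ LieSubalgebra.lieSpan ℝ 𝔤 (W : Set 𝔤)
    · obtain ⟨j, hj, X, hX, hXH⟩ := hex
      refine ⟨j, X, hX, hXH, fun w _ => ?_⟩
      rw [S.proj_of_mem hX, if_neg (by omega), lie_zero]
      exact zero_mem _
    · push Not at hex
      obtain ⟨X, hX, hXW⟩ := SetLike.exists_of_lt hlt
      refine ⟨1, X, hX, fun h => hXW ?_, fun w hw => ?_⟩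
      · have := (hW.proj_one_mem h).1
        rwa [S.proj_of_mem hX, if_pos rfl] at this
      · have h2 := hW.lie_mem_layer_two hw (S.proj 1 X)
        have := (hW.proj_one_mem (hex 2 le_rfl _ h2)).2
        rwa [S.proj_of_mem h2, if_neg (by omega), sub_zero] at this
  obtain ⟨π, hπ, M, hM1, hM2, C₁, hC₁, hC₁'⟩ := exists_transversal hW
  obtain ⟨C₃, hC₃, hC₃'⟩ := exists_sqNorm_le ip
  obtain ⟨Z, hZ, h₀, hh₀, hXZ⟩ := hM2 (exp X)
  have hZ0 : Z ≠ 0 := by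
    rintro rfl
    refine hXH ((mem_fibreSubgroup hW (g := exp X)).1 ?_)
    rw [hXZ, exp_zero, one_mul]
    exact hh₀
  have hq := S.sqNorm_pos hZ0
  have hX1 : (1 : CarnotGroup S) ≠ exp X := by
    intro h
    refine hXH ((mem_fibreSubgroup hW (g := exp X)).1 ?_)
    rw [← h]
    exact one_mem _
  have hd1 : ∀ a : ℝ, dilation a (1 : CarnotGroup S) = 1 :=
    fun a => CarnotGroup.ext (map_zero (S.dil _))
  -- One element `exp X` is enough, since dilations preserve `H` and supply all scales. `N₀` is the
  -- transversality bound for its `M` coordinate `Z`.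
  refine ⟨√(S.sqNorm Z / (C₁ * C₃)), ccDist ip 1 (exp X), Real.sqrt_pos.2 (by positivity),
    ccDist_pos hX1, fun a ha => ⟨dilation a (exp X), ?_, fun h hh => ?_, fun h hh => ?_⟩⟩
  · rw [← hd1 a, ccDist_dilation ha, hd1, mul_comm]
  · have h1 : dilation a (exp X) * h = dilation a (exp X * dilation a⁻¹ h) := by
      rw [dilation_mul, dilation_dilation, mul_inv_cancel₀ ha.ne', dilation_one]
    rw [h1, ← hd1 a, ccDist_dilation ha, mul_comm]
    refine mul_le_mul_of_nonneg_left ?_ ha.le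
    refine Real.sqrt_le_left (ccDist_nonneg _ _) |>.2 ?_ |> fun h => h
    have h2 := hC₁' Z hZ (h₀ * dilation a⁻¹ h) (mul_mem hh₀ (dilation_mem_fibreSubgroup hW hh _))
    rw [← mul_assoc, ← hXZ] at h2
    have h3 := hC₃' (exp X * dilation a⁻¹ h)
    rw [div_le_iff₀ (by positivity)]
    calc S.sqNorm Z ≤ C₁ * (C₃ * ccDist ip 1 (exp X * dilation a⁻¹ h) ^ 2) :=
          h2.trans (by gcongr)
      _ = _ := by ring
  -- Conjugation by `exp (a ^ j X)` changes elements of `H` only by factors in the exponential of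
  -- `[W, W]`.
  · have h1 : dilation a (exp X) = (exp (a ^ j • X) : CarnotGroup S) := by
      rw [dilation]
      exact congrArg exp (S.dil_of_mem a hXj)
    have hw := (hW.proj_one_mem ((mem_fibreSubgroup hW).1 (inv_mem hh))).1
    have hzd : -⁅S.proj 1 (h⁻¹).log, S.proj 1 (a ^ j • X)⁆ ∈ W.derived := by
      rw [map_smul, lie_smul]
      exact neg_mem (Submodule.smul_mem _ _ (hXW _ hw))
    have h2 := inv_mul_exp hW (inv_mem hh) (a ^ j • X)
    rw [inv_inv, sub_eq_add_neg, exp_add_derived hW _ hzd] at h2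
    rw [h1, mul_assoc, h2, mul_assoc, inv_mul_cancel_left]
    exact mul_mem (exp_mem_fibreSubgroup_of_derived hW hzd) hh

/-- A unit speed one-parameter subgroup in the fibre direction. -/
theorem exists_unit_line (hW : S.IsCommuting W) (hne : W ≠ ⊥) :
    ∃ w ∈ W, ∀ s : ℝ, 0 < s → ccDist ip (S := S) 1 (exp (s • w)) = s := by
  obtain ⟨w, hw, hw0⟩ := Submodule.exists_mem_ne_zero_of_ne_bot hne
  have h1 : (1 : CarnotGroup S) ≠ exp w := fun h => hw0 (congrArg log h).symm
  have hD := ccDist_pos (ip := ip) h1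
  set D := ccDist ip 1 (exp w) with hDdef
  refine ⟨D⁻¹ • w, Submodule.smul_mem _ _ hw, fun s hs => ?_⟩
  have h2 : exp (s • D⁻¹ • w) = dilation (s * D⁻¹) (exp w : CarnotGroup S) := by
    rw [smul_smul, dilation]
    refine congrArg exp ?_
    have := S.dil_of_mem (s * D⁻¹) (hW.le_layer hw)
    rw [pow_one] at this
    exact this.symm
  have hd1 : dilation (s * D⁻¹) (1 : CarnotGroup S) = 1 := CarnotGroup.ext (map_zero (S.dil _))
  rw [h2, ← hd1, ccDist_dilation (by positivity), ← hDdef]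
  field_simp

theorem exp_smul_mul_exp_smul (hW : S.IsCommuting W) {w : 𝔤} (hw : w ∈ W) (s t : ℝ) :
    (exp (s • w) * exp (t • w) : CarnotGroup S) = exp ((s + t) • w) := by
  apply CarnotGroup.ext
  rw [log_mul]
  change S.bch (s • w) (t • w) = (s + t) • w
  have h : ∀ c : ℝ, c • w ∈ LieSubalgebra.lieSpan ℝ 𝔤 (W : Set 𝔤) :=
    fun c => LieSubalgebra.subset_lieSpan (Submodule.smul_mem _ c hw)
  rw [hW.bch_apply (h s) (h t), map_smul, map_smul]
  simp [add_smul]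

theorem exists_norm_proj_one_le : ∃ C : ℝ, 0 < C ∧ ∀ g : CarnotGroup S,
    ‖S.proj 1 g.log‖ ≤ C * ccDist ip 1 g := by
  obtain ⟨C, hC, h⟩ := exists_sqNorm_le ip
  refine ⟨√C, Real.sqrt_pos.2 hC, fun g => ?_⟩
  have := S.norm_proj_le_of_sqNorm_le (τ := √C * ccDist ip 1 g) (X := g.log)
    (mul_nonneg (Real.sqrt_nonneg _) (ccDist_nonneg _ _))
    (by rw [mul_pow, Real.sq_sqrt hC.le]; exact h g) 1
  simpa using this

/-- On `V₁` the square of the quasi-norm is at most the square of the norm, as the other components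
vanish. -/
theorem exists_ccDist_exp_le : ∃ C : ℝ, 0 < C ∧ ∀ w ∈ S.layer 1,
    ccDist ip (S := S) 1 (exp w) ≤ C * ‖w‖ := by
  obtain ⟨C, hC, h⟩ := exists_sq_ccDist_le ip
  refine ⟨√C, Real.sqrt_pos.2 hC, fun w hw => ?_⟩
  have h1 : S.sqNorm w ≤ ‖w‖ ^ 2 := by
    rw [Stratification.sqNorm]
    have : ∀ i ∈ Finset.range S.step, ‖S.proj (i + 1) w‖ ^ (2 / ((i : ℝ) + 1))
        = if i = 0 then ‖w‖ ^ 2 else 0 := by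
      intro i _
      rw [S.proj_of_mem hw]
      by_cases hi : i = 0
      · subst hi; simp
      · rw [if_neg (by omega), if_neg hi, norm_zero, Real.zero_rpow (by positivity)]
    rw [Finset.sum_congr rfl this, Finset.sum_ite_eq']
    split_ifs
    · exact le_rfl
    · positivity
  have h2 := (h (exp w)).trans (mul_le_mul_of_nonneg_left h1 hC.le)
  refine abs_le_of_sq_le_sq' ?_ (by positivity) |>.2
  rwa [mul_pow, Real.sq_sqrt hC.le]

end

end CarnotGroup

end

/-! ### Controlled maps and the stretch along fibres -/

noncomputable section
set_option linter.unusedSectionVars false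
attribute [local instance] lieNorm
attribute [local instance] lieNormedSpace

/-- A control function for ratios of distances: it is positive and tends to `0` at `0`. -/
structure IsGauge (θ : ℝ → ℝ) : Prop where
  pos : ∀ s, 0 < s → 0 < θ s
  small : ∀ ε, 0 < ε → ∃ δ, 0 < δ ∧ ∀ s, 0 < s → s ≤ δ → θ s ≤ ε

namespace CarnotGroup

variable {𝔤 : Type*} [LieRing 𝔤] [LieAlgebra ℝ 𝔤] [FiniteDimensional ℝ 𝔤]
variable {S : Stratification 𝔤} (ip : InnerProductSpace.Core ℝ (S.layer 1))

/-- `f` and its inverse distort ratios of distances by at most `θ`, and `f` maps left cosets of `H`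
to left cosets of `H`. -/
structure IsControlled (H : Subgroup (CarnotGroup S)) (θ : ℝ → ℝ)
    (f : OpenPartialHomeomorph (CarnotGroup S) (CarnotGroup S)) : Prop where
  map : ∀ p ∈ f.source, ∀ y ∈ f.source, ∀ z ∈ f.source, ∀ s, 0 < s →
    ccDist ip p y ≤ s * ccDist ip p z → ccDist ip (f p) (f y) ≤ θ s * ccDist ip (f p) (f z)
  map_symm : ∀ p ∈ f.target, ∀ y ∈ f.target, ∀ z ∈ f.target, ∀ s, 0 < s →
    ccDist ip p y ≤ s * ccDist ip p z →
      ccDist ip (f.symm p) (f.symm y) ≤ θ s * ccDist ip (f.symm p) (f.symm z)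
  fibre : ∀ p ∈ f.source, ∀ q ∈ f.source, p⁻¹ * q ∈ H ↔ (f p)⁻¹ * f q ∈ H

variable {ip}

theorem IsControlled.symm {H : Subgroup (CarnotGroup S)} {θ : ℝ → ℝ}
    {f : OpenPartialHomeomorph (CarnotGroup S) (CarnotGroup S)} (hf : IsControlled ip H θ f) :
    IsControlled ip H θ f.symm where
  map := hf.map_symm
  map_symm := hf.map
  fibre p hp q hq := by
    have := hf.fibre _ (f.map_target hp) _ (f.map_target hq)
    rw [f.right_inv hp, f.right_inv hq] at this
    exact this.symm

theorem t2Space : T2Space (CarnotGroup S) :=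
  T2Space.of_injective_continuous (f := log) (fun _ _ h => CarnotGroup.ext h) continuous_log

theorem ccDist_mul_right_one (p h : CarnotGroup S) : ccDist ip p (p * h) = ccDist ip 1 h := by
  rw [ccDist_eq_one_left, inv_mul_cancel_left]

variable (ip) in
/-- `w` spans a one-parameter subgroup of unit speed. -/
def IsUnitDirection (w : 𝔤) : Prop :=
  ∀ s : ℝ, 0 < s → ccDist ip (S := S) 1 (exp (s • w)) = s

theorem IsUnitDirection.ccDist_eq {w : 𝔤} (hw : IsUnitDirection ip w) (p : CarnotGroup S) {a : ℝ}
    (ha : 0 < a) : ccDist ip p (p * exp (a • w)) = a := by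
  rw [ccDist_mul_right_one, hw a ha]

variable (ip) in
/-- The distance of the images of `p` and of the point at distance `a` from `p` in the
direction `w`. -/
def stretch (f : CarnotGroup S → CarnotGroup S) (w : 𝔤) (a : ℝ) (p : CarnotGroup S) : ℝ :=
  ccDist ip (f p) (f (p * exp (a • w)))

variable {W : Submodule ℝ 𝔤} {θ : ℝ → ℝ} {w₀ : 𝔤}
  {f : OpenPartialHomeomorph (CarnotGroup S) (CarnotGroup S)}

theorem stretch_pos (hw : IsUnitDirection ip w₀) {p : CarnotGroup S} {a : ℝ} (ha : 0 < a)
    (hp : p ∈ f.source) (hpa : p * exp (a • w₀) ∈ f.source) : 0 < stretch ip f w₀ a p := by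
  refine ccDist_pos fun h => ?_
  have h1 := f.injOn hp hpa h
  have h2 := hw.ccDist_eq p ha
  rw [← h1, ccDist_self] at h2
  exact ha.ne h2

/-- A connectedness argument. Points at distance at least `ρ` from `q` in the closed ball are sent
to distance at least `stretch / θ 1` from `f q`. The connected ball of that radius around `f q` thus
avoids the image of the sphere, and being covered by the image of the open ball and the complement
of the image of the closed ball, it lies in the former. -/
theorem IsControlled.mem_target {H : Subgroup (CarnotGroup S)} (hf : IsControlled ip H θ f)
    (hθ : IsGauge θ) (hw : IsUnitDirection ip w₀) {q : CarnotGroup S} {ρ : ℝ} (hρ : 0 < ρ)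
    (hball : ∀ y, ccDist ip q y ≤ ρ → y ∈ f.source) {z : CarnotGroup S}
    (hz : θ 1 * ccDist ip (f q) z < stretch ip f w₀ ρ q) :
    z ∈ f.target ∧ ccDist ip q (f.symm z) < ρ := by
  have := t2Space (S := S)
  have hθ1 := hθ.pos 1 one_pos
  have hq : q ∈ f.source := hball q (by rw [ccDist_self]; exact hρ.le)
  have hqρ := hw.ccDist_eq q hρ
  have hqw : q * exp (ρ • w₀) ∈ f.source := hball _ hqρ.le
  set m := stretch ip f w₀ ρ q / θ 1 with hm
  have hzm : ccDist ip (f q) z < m := by rwa [hm, lt_div_iff₀' hθ1]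
  have hK : IsClosed (f '' {y | ccDist ip q y ≤ ρ}) :=
    ((isCompact_ccDist_le q ρ).image_of_continuousOn (f.continuousOn.mono hball)).isClosed
  have hV : IsOpen (f '' ccBall ip q ρ) :=
    f.isOpen_image_of_subset_source (isOpen_ccBall q ρ) fun y hy => hball y (le_of_lt hy)
  have hsub : ccBall ip (f q) m ⊆ f '' ccBall ip q ρ := by
    refine (isPreconnected_ccBall (f q) m).subset_left_of_subset_union hV hK.isOpen_compl
      ?_ ?_ ?_
    · rw [disjoint_compl_right_iff_subset]
      exact image_mono fun y (hy : ccDist ip q y < ρ) => hy.le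
    · intro y' hy'
      by_cases h : y' ∈ f '' {y | ccDist ip q y ≤ ρ}
      · left
        obtain ⟨y, hy, rfl⟩ := h
        refine ⟨y, show ccDist ip q y < ρ from lt_of_not_ge fun hge => ?_, rfl⟩
        have h1 := hf.map q hq _ hqw y (hball y hy) 1 one_pos (by rw [hqρ, one_mul]; exact hge)
        have h2 : ccDist ip (f q) (f y) < m := hy'
        rw [hm, lt_div_iff₀' hθ1] at h2
        exact absurd h1 (not_le.2 h2)
      · exact Or.inr h
    · refine ⟨f q, ?_, q, ?_, rfl⟩
      · change ccDist ip (f q) (f q) < m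
        rw [ccDist_self]
        exact (ccDist_nonneg _ _).trans_lt hzm
      · change ccDist ip q q < ρ
        rwa [ccDist_self]
  obtain ⟨y, hy, rfl⟩ := hsub hzm
  have hys : y ∈ f.source := hball y (le_of_lt hy)
  exact ⟨f.map_source hys, by rw [f.left_inv hys]; exact hy⟩

/-- Along a fibre, `f` distorts the scale `a` by a factor whose square is comparable to the norm
of an affine function (plus a constant) in the image. -/
theorem exists_stretch_comparison (hW : S.IsCommuting W) (hlt : W < S.layer 1)
    (hθ : IsGauge θ) (hw : IsUnitDirection ip w₀) : ∃ C κ : ℝ, 1 ≤ C ∧ 0 < κ ∧ κ ≤ 1 ∧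
    ∀ f : OpenPartialHomeomorph (CarnotGroup S) (CarnotGroup S),
      IsControlled ip (fibreSubgroup S W) θ f →
    ∀ (x : CarnotGroup S) (r : ℝ), (∀ y, ccDist ip x y < 8 * r → y ∈ f.source) →
    ∀ p, ccDist ip x p < 4 * r → ∀ a, 0 < a → a ≤ κ * r →
    ∃ E : ℝ, 0 ≤ E ∧ ∃ Y : 𝔤, ∃ T : 𝔤 →ₗ[ℝ] 𝔤, ∀ q, ccDist ip x q < 4 * r →
      p⁻¹ * q ∈ fibreSubgroup S W →
      E + ‖Y + T (S.proj 1 ((f p)⁻¹ * f q).log)‖ ≤ C * stretch ip f w₀ a q ^ 2 ∧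
      stretch ip f w₀ a q ^ 2 ≤ C * (E + ‖Y + T (S.proj 1 ((f p)⁻¹ * f q).log)‖) := by
  obtain ⟨C₀, hC₀, hdist⟩ := exists_fibre_dist ip hW
  obtain ⟨N₀, N₁, hN₀, hN₁, hpar⟩ := exists_parallel (ip := ip) hW hlt
  have hθ1 := hθ.pos 1 one_pos
  have hθN := hθ.pos N₁ hN₁
  -- `θ 1 ^ 2` and `θ N₀⁻¹` serve the two cases, nearest point outside or inside the target. The
  -- factor `κ` below keeps `q k` and `q exp (a w₀)` within `r` of `q`.
  set B := max (θ 1 ^ 2) (θ N₀⁻¹) with hB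
  have hBp : 0 < B := lt_max_of_lt_left (by positivity)
  refine ⟨1 + C₀ * θ N₁ ^ 2 + C₀ * B ^ 2, min 1 N₁⁻¹, by
    have : 0 ≤ C₀ * θ N₁ ^ 2 + C₀ * B ^ 2 := by positivity
    linarith, by positivity, min_le_left _ _, ?_⟩
  intro f hf x r hsub p hp a ha har
  have hr : 0 < r := by
    by_contra h
    have : ccDist ip x p < 0 := by linarith
    exact absurd (ccDist_nonneg x p) (not_le.2 this)
  have har1 : a ≤ r := har.trans (mul_le_of_le_one_left hr.le (min_le_left _ _))
  have har2 : N₁ * a ≤ r := by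
    have h1 : a ≤ N₁⁻¹ * r := har.trans (mul_le_mul_of_nonneg_right (min_le_right _ _) hr.le)
    rwa [inv_mul_eq_div, le_div_iff₀' hN₁] at h1
  obtain ⟨k, hk1, hk2, hk3⟩ := hpar a ha
  have hmem : ∀ q h, ccDist ip x q < 4 * r → ccDist ip 1 h ≤ r → q * h ∈ f.source := by
    intro q h hq hh
    refine hsub _ ?_
    have := ccDist_triangle (ip := ip) x q (q * h)
    rw [ccDist_mul_right_one] at this
    linarith
  have hps : p ∈ f.source := hsub p (by linarith)
  have hpk : p * k ∈ f.source := hmem p k hp (by rw [hk1]; exact har2)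
  -- The affine data of the image of the parallel fibre `p k H`, seen from `f p`.
  obtain ⟨E, hE, Y, T, hT⟩ := hdist ((f p)⁻¹ * f (p * k))
  refine ⟨E, hE, Y, T, fun q hq hqH => ?_⟩
  have hqs : q ∈ f.source := hsub q (by linarith)
  have hqk : q * k ∈ f.source := hmem q k hq (by rw [hk1]; exact har2)
  have hqa : q * exp (a • w₀) ∈ f.source := hmem q _ hq (by rw [hw a ha]; exact har1)
  have hqr : q * exp (r • w₀) ∈ f.source := hmem q _ hq (by rw [hw r hr])
  have hda := hw.ccDist_eq q ha
  have hdr := hw.ccDist_eq q hr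
  set h := (f p)⁻¹ * f q with hh
  have hhH : h ∈ fibreSubgroup S W := (hf.fibre p hps q hqs).1 hqH
  obtain ⟨hlow, h', hh', hup⟩ := hT h hhH
  set A := E + ‖Y + T (S.proj 1 h.log)‖ with hA
  have hA0 : 0 ≤ A := add_nonneg hE (norm_nonneg _)
  set μ := stretch ip f w₀ a q with hμ
  have hμ0 : 0 ≤ μ := ccDist_nonneg _ _
  constructor
  -- As `k` normalises, `q k` lies on the fibre of `p k` at distance `N₁ a` from `q`. Its image is a
  -- competitor for the distance from `f q` to the image fibre.
  · have h1 : (p * k)⁻¹ * (q * k) ∈ fibreSubgroup S W := by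
      have := hk3 _ hqH
      convert this using 1
      group
    have h2 := hlow _ ((hf.fibre _ hpk _ hqk).1 h1)
    rw [show (f p)⁻¹ * f (p * k) * ((f (p * k))⁻¹ * f (q * k)) = (f p)⁻¹ * f (q * k) by group,
      hh, ccDist_mul_left] at h2
    have h3 := hf.map q hqs _ hqk _ hqa N₁ hN₁
      (by rw [hda, ccDist_mul_right_one, hk1])
    have h4 : ccDist ip (f q) (f (q * k)) ^ 2 ≤ (θ N₁ * μ) ^ 2 :=
      pow_le_pow_left₀ (ccDist_nonneg _ _) h3 2
    calc A ≤ C₀ * (θ N₁ * μ) ^ 2 := h2.trans (by gcongr)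
      _ = C₀ * θ N₁ ^ 2 * μ ^ 2 := by ring
      _ ≤ _ := by
        have : 0 ≤ (1 + C₀ * B ^ 2) * μ ^ 2 := by positivity
        nlinarith
  -- Conversely, let `y'` almost realise the distance from `f q` to the image fibre. Either its
  -- preimage lies on the parallel fibre, hence at distance at least `N₀ a` from `q`, or `y'` is
  -- outside the target, hence beyond the image of the ball of radius `r`.
  · set y' := f p * ((f p)⁻¹ * f (p * k) * h') with hy'
    have hd : ccDist ip h ((f p)⁻¹ * f (p * k) * h') = ccDist ip (f q) y' := by
      rw [← ccDist_mul_left (f p), hh, mul_inv_cancel_left]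
    rw [hd] at hup
    have key : μ ≤ B * ccDist ip (f q) y' := by
      by_cases hyt : y' ∈ f.target
      · set y := f.symm y' with hy
        have hys : y ∈ f.source := f.map_target hyt
        have hfy : f y = y' := f.right_inv hyt
        have h1 : (p * k)⁻¹ * y ∈ fibreSubgroup S W := by
          rw [hf.fibre _ hpk _ hys, hfy, hy']
          convert hh' using 1
          group
        have h2 : k⁻¹ * (q⁻¹ * y) ∈ fibreSubgroup S W := by
          have h3 := hk3 _ (inv_mem hqH)
          have h4 := mul_mem h3 h1
          convert h4 using 1
          group
        have h3 := hk2 _ h2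
        rw [mul_inv_cancel_left, ← ccDist_eq_one_left] at h3
        have h4 := hf.map q hqs _ hqa y hys N₀⁻¹ (inv_pos.2 hN₀)
          (by rw [hda, inv_mul_eq_div, le_div_iff₀' hN₀]; exact h3)
        rw [hfy] at h4
        exact h4.trans (mul_le_mul_of_nonneg_right (le_max_right _ _) (ccDist_nonneg _ _))
      · have h1 : stretch ip f w₀ r q ≤ θ 1 * ccDist ip (f q) y' := by
          by_contra hcon
          refine hyt (hf.mem_target hθ hw hr (fun y hy => hsub y ?_) (not_le.1 hcon)).1
          have := ccDist_triangle (ip := ip) x q y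
          linarith
        have h2 := hf.map q hqs _ hqa _ hqr 1 one_pos (by rw [hda, hdr, one_mul]; exact har1)
        calc μ ≤ θ 1 * stretch ip f w₀ r q := h2
          _ ≤ θ 1 * (θ 1 * ccDist ip (f q) y') := by gcongr
          _ = θ 1 ^ 2 * ccDist ip (f q) y' := by ring
          _ ≤ _ := mul_le_mul_of_nonneg_right (le_max_left _ _) (ccDist_nonneg _ _)
    calc μ ^ 2 ≤ (B * ccDist ip (f q) y') ^ 2 := pow_le_pow_left₀ hμ0 key 2
      _ = B ^ 2 * ccDist ip (f q) y' ^ 2 := by ring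
      _ ≤ B ^ 2 * (C₀ * A) := by gcongr
      _ ≤ _ := by
        have : 0 ≤ (1 + C₀ * θ N₁ ^ 2) * A := by positivity
        nlinarith

end CarnotGroup

end

/-! ### Almost maximal points of the stretch -/

noncomputable section
set_option linter.unusedSectionVars false
attribute [local instance] lieNorm
attribute [local instance] lieNormedSpace

namespace CarnotGroup

variable {𝔤 : Type*} [LieRing 𝔤] [LieAlgebra ℝ 𝔤] [FiniteDimensional ℝ 𝔤]
variable {S : Stratification 𝔤} {ip : InnerProductSpace.Core ℝ (S.layer 1)}
variable {W : Submodule ℝ 𝔤} {θ : ℝ → ℝ} {w₀ : 𝔤}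

/-- On a piece of a fibre there is a point at which the stretch is almost maximal, and it is not
much smaller at a certain point between this point and the centre. -/
theorem exists_almost_maximal (hW : S.IsCommuting W) (hlt : W < S.layer 1)
    (hθ : IsGauge θ) (hw : IsUnitDirection ip w₀) :
    ∃ c κ C : ℝ, 0 < c ∧ c ≤ 1 ∧ 0 < κ ∧ κ ≤ 1 / 2 ∧ 1 ≤ C ∧
    ∀ f : OpenPartialHomeomorph (CarnotGroup S) (CarnotGroup S),
      IsControlled ip (fibreSubgroup S W) θ f →
    ∀ (x : CarnotGroup S) (r : ℝ), (∀ y, ccDist ip x y < 8 * r → y ∈ f.source) →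
    ∀ p, ccDist ip x p < 2 * r → ∀ D, D ≤ κ * r → ∀ a, 0 < a → a ≤ D →
    ∃ q, p⁻¹ * q ∈ fibreSubgroup S W ∧ ccDist ip p q ≤ D ∧
      (∀ q₁, p⁻¹ * q₁ ∈ fibreSubgroup S W → ccDist ip p q₁ ≤ D →
        stretch ip f w₀ a q₁ ≤ 2 * stretch ip f w₀ a q) ∧
      ccDist ip p (q * exp (-(c • S.proj 1 (p⁻¹ * q).log))) ≤ 2 * D ∧
      stretch ip f w₀ a q
        ≤ C * stretch ip f w₀ a (q * exp (-(c • S.proj 1 (p⁻¹ * q).log))) := by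
  obtain ⟨C₁, κ₁, hC₁, hκ₁, hκ₁1, hcomp⟩ := exists_stretch_comparison hW hlt hθ hw
  obtain ⟨Ce, hCe, hexp⟩ := exists_ccDist_exp_le (ip := ip)
  obtain ⟨Cp, hCp, hproj⟩ := exists_norm_proj_one_le (ip := ip)
  have hθ1 := hθ.pos 1 one_pos
  have hθ2 := hθ.pos 2 two_pos
  -- For `‖u‖ ≤ c₁ D'` the point `f p · exp u` still lies in the image of the ball of radius `D`
  -- around `p`.
  set c₁ := 1 / (2 * Ce * θ 1) with hc₁
  have hc₁p : 0 < c₁ := by positivity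
  have hC₁p : 0 < C₁ := by linarith
  -- Chosen so that the affine function changes by at most `m ^ 2 / (2 C₁)` between `q` and `q'`,
  -- half of its lower bound at `q`.
  set ε := c₁ / (16 * C₁ ^ 2 * Cp * (θ 1 + θ 2)) with hε
  have hεp : 0 < ε := by positivity
  obtain ⟨σ, hσ, hσε⟩ := hθ.small ε hεp
  set σ' := min σ 1 with hσ'
  have hσ'p : 0 < σ' := by positivity
  have hσ'ε := hσε σ' hσ'p (min_le_left _ _)
  -- The step `c v` is so short that `d (q, q') ≤ σ' D`, where `θ σ' ≤ ε`.
  set c := min 1 (σ' / (Ce * Cp)) with hc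
  have hcp : 0 < c := by positivity
  have hcσ : c * (Ce * Cp) ≤ σ' := by
    rw [← le_div_iff₀ (by positivity)]
    exact min_le_right _ _
  refine ⟨c, min κ₁ (1 / 2), 2 * C₁, hcp, min_le_left _ _, by positivity, min_le_right _ _,
    by linarith, ?_⟩
  intro f hf x r hsub p hp D hD a ha haD
  have hr : 0 < r := by
    by_contra h
    have : ccDist ip x p < 0 := by linarith
    exact absurd (ccDist_nonneg x p) (not_le.2 this)
  have hDp : 0 < D := ha.trans_le haD
  have hD1 : D ≤ κ₁ * r := hD.trans (mul_le_mul_of_nonneg_right (min_le_left _ _) hr.le)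
  have hD2 : 2 * D ≤ r := by
    have := hD.trans (mul_le_mul_of_nonneg_right (min_le_right κ₁ (1 / 2)) hr.le)
    linarith
  obtain ⟨E, hE, Y, T, hT⟩ := hcomp f hf x r hsub p (by linarith) a ha (haD.trans hD1)
  have hnear : ∀ q, ccDist ip p q ≤ 3 * D → ccDist ip x q < 4 * r := fun q hq => by
    have := ccDist_triangle (ip := ip) x p q
    linarith
  have hsrc : ∀ q, ccDist ip p q ≤ 3 * D → q ∈ f.source := fun q hq =>
    hsub q (by have := hnear q hq; linarith)
  have hline : ∀ q b, 0 < b → ccDist ip p (q * exp (b • w₀)) ≤ ccDist ip p q + b := by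
    intro q b hb
    have := ccDist_triangle (ip := ip) p q (q * exp (b • w₀))
    rwa [hw.ccDist_eq q hb] at this
  have hpp : ccDist ip p p = 0 := ccDist_self p
  have hps : p ∈ f.source := hsrc p (by rw [hpp]; positivity)
  have hpD : p * exp (D • w₀) ∈ f.source := hsrc _ (by
    have := hline p D hDp; rw [hpp] at this; linarith)
  have hpa : p * exp (a • w₀) ∈ f.source := hsrc _ (by
    have := hline p a ha; rw [hpp] at this; linarith)
  have hdD := hw.ccDist_eq p hDp
  set μ := stretch ip f w₀ a with hμ
  set D' := stretch ip f w₀ D p with hD'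
  have hD'p : 0 < D' := stretch_pos hw hDp hps hpD
  have hμp : 0 < μ p := stretch_pos hw ha hps hpa
  have hone : p⁻¹ * p ∈ fibreSubgroup S W := by rw [inv_mul_cancel]; exact one_mem _
  have himg1 : ∀ q, ccDist ip p q ≤ D → ccDist ip (f p) (f q) ≤ θ 1 * D' := fun q hq =>
    hf.map p hps q (hsrc q (by linarith)) _ hpD 1 one_pos (by rw [hdD]; linarith)
  have himg2 : ∀ q, ccDist ip p q ≤ 2 * D → ccDist ip (f p) (f q) ≤ θ 2 * D' := fun q hq =>
    hf.map p hps q (hsrc q (by linarith)) _ hpD 2 two_pos (by rw [hdD]; linarith)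
  have hstr : ∀ q, ccDist ip p q ≤ D → ∀ b, 0 < b → b ≤ D →
      stretch ip f w₀ b q ≤ (θ 1 + θ 2) * D' := by
    intro q hq b hb hbD
    have h1 := ccDist_triangle (ip := ip) (f q) (f p) (f (q * exp (b • w₀)))
    rw [ccDist_comm (f q) (f p)] at h1
    have h2 := himg1 q hq
    have h3 := himg2 (q * exp (b • w₀)) (by have := hline q b hb; linarith)
    unfold stretch
    linarith
  -- the almost maximal point
  obtain ⟨q, hqH, hqD, hmax⟩ : ∃ q, p⁻¹ * q ∈ fibreSubgroup S W ∧ ccDist ip p q ≤ D ∧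
      ∀ q₁, p⁻¹ * q₁ ∈ fibreSubgroup S W → ccDist ip p q₁ ≤ D → μ q₁ ≤ 2 * μ q := by
    set I := μ '' {q | p⁻¹ * q ∈ fibreSubgroup S W ∧ ccDist ip p q ≤ D} with hI
    have hbdd : BddAbove I := by
      refine ⟨(θ 1 + θ 2) * D', ?_⟩
      rintro _ ⟨q, ⟨-, hq⟩, rfl⟩
      exact hstr q hq a ha haD
    have hpI : μ p ∈ I := ⟨p, ⟨hone, by rw [hpp]; exact hDp.le⟩, rfl⟩
    have hsup : 0 < sSup I := hμp.trans_le (le_csSup hbdd hpI)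
    -- The supremum need not be attained; half of it is exceeded, hence the factor `2`.
    obtain ⟨_, ⟨q, ⟨hq1, hq2⟩, rfl⟩, hq3⟩ := exists_lt_of_lt_csSup ⟨_, hpI⟩ (half_lt_self hsup)
    refine ⟨q, hq1, hq2, fun q₁ h1 h2 => ?_⟩
    have := le_csSup hbdd ⟨q₁, ⟨h1, h2⟩, rfl⟩
    linarith
  refine ⟨q, hqH, hqD, hmax, ?_⟩
  set m := μ q with hm
  have hm0 : 0 < m := by
    have := hmax p hone (by rw [hpp]; exact hDp.le)
    linarith
  set v := S.proj 1 (p⁻¹ * q).log with hv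
  have hvW : v ∈ W := (hW.proj_one_mem ((mem_fibreSubgroup hW).1 hqH)).1
  have hvn : ‖v‖ ≤ Cp * D := by
    have := hproj (p⁻¹ * q)
    rw [← ccDist_eq_one_left] at this
    exact this.trans (by gcongr)
  set q' := q * exp (-(c • v)) with hq'
  have hqq' : ccDist ip q q' ≤ σ' * D := by
    rw [hq', ccDist_mul_right_one]
    refine (hexp _ (neg_mem (Submodule.smul_mem _ _ (hW.le_layer hvW)))).trans ?_
    rw [norm_neg, norm_smul, Real.norm_of_nonneg hcp.le]
    calc Ce * (c * ‖v‖) ≤ Ce * (c * (Cp * D)) := by gcongr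
      _ = c * (Ce * Cp) * D := by ring
      _ ≤ σ' * D := by gcongr
  have hpq' : ccDist ip p q' ≤ 2 * D := by
    have h1 := ccDist_triangle (ip := ip) p q q'
    have h2 : σ' * D ≤ 1 * D := by gcongr; exact min_le_right _ _
    linarith
  refine ⟨hpq', ?_⟩
  have hq'H : p⁻¹ * q' ∈ fibreSubgroup S W := by
    rw [hq', ← mul_assoc]
    exact mul_mem hqH (exp_mem_fibreSubgroup (neg_mem (Submodule.smul_mem _ _ hvW)))
  have hqs : q ∈ f.source := hsrc q (by linarith)
  have hq's : q' ∈ f.source := hsrc q' (by linarith)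
  have hqDs : q * exp (D • w₀) ∈ f.source := hsrc _ (by have := hline q D hDp; linarith)
  -- the linear part of the affine function
  have hTsmall : ∀ u ∈ W, ‖u‖ ≤ c₁ * D' → ‖T u‖ ≤ 8 * C₁ * m ^ 2 := by
    -- Such a `u` comes from a point of the same fibre piece, where the stretch is at most `2 m`,
    -- and this bounds the affine function.
    have hval : ∀ u ∈ W, ‖u‖ ≤ c₁ * D' → ‖Y + T u‖ ≤ 4 * C₁ * m ^ 2 := by
      intro u hu hun
      have hd : ccDist ip (f p) (f p * exp u) ≤ Ce * (c₁ * D') := by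
        rw [ccDist_mul_right_one]
        exact (hexp u (hW.le_layer hu)).trans (by gcongr)
      have hlt' : θ 1 * ccDist ip (f p) (f p * exp u) < stretch ip f w₀ D p := by
        have h1 : θ 1 * (Ce * (c₁ * D')) = D' / 2 := by
          rw [hc₁]; field_simp
        have h2 : θ 1 * ccDist ip (f p) (f p * exp u) ≤ θ 1 * (Ce * (c₁ * D')) := by gcongr
        linarith
      obtain ⟨hz1, hz2⟩ := hf.mem_target hθ hw hDp (fun y hy => hsrc y (by linarith)) hlt'
      set q₁ := f.symm (f p * exp u) with hq₁
      have hq₁s : q₁ ∈ f.source := f.map_target hz1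
      have hfq : f q₁ = f p * exp u := f.right_inv hz1
      have hfq' : (f p)⁻¹ * f q₁ = exp u := by rw [hfq, inv_mul_cancel_left]
      have hq₁H : p⁻¹ * q₁ ∈ fibreSubgroup S W := by
        rw [hf.fibre p hps q₁ hq₁s, hfq']
        exact exp_mem_fibreSubgroup hu
      have h1 := (hT q₁ (hnear q₁ (by linarith)) hq₁H).1
      rw [hfq', S.proj_of_mem (hW.le_layer hu), if_pos rfl] at h1
      have h2 := hmax q₁ hq₁H hz2.le
      have h3 : stretch ip f w₀ a q₁ ^ 2 ≤ (2 * m) ^ 2 :=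
        pow_le_pow_left₀ (ccDist_nonneg _ _) h2 2
      have h4 : C₁ * stretch ip f w₀ a q₁ ^ 2 ≤ C₁ * (2 * m) ^ 2 := by gcongr
      linarith
    intro u hu hun
    have h1 := hval u hu hun
    -- Comparison with the value at `u = 0` removes the constant term `Y`.
    have h2 := hval 0 (zero_mem _) (by rw [norm_zero]; positivity)
    rw [map_zero, add_zero] at h2
    have h3 : ‖T u‖ ≤ ‖Y + T u‖ + ‖Y‖ := by
      have := norm_sub_le (Y + T u) Y
      rwa [add_sub_cancel_left] at this
    linarith
  have hTbound : ∀ u ∈ W, ‖T u‖ * (c₁ * D') ≤ 8 * C₁ * m ^ 2 * ‖u‖ := by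
    intro u hu
    rcases eq_or_ne u 0 with rfl | hu0
    · simp
    have hun : 0 < ‖u‖ := norm_pos_iff.2 hu0
    have hk : 0 ≤ c₁ * D' / ‖u‖ := by positivity
    have h1 := hTsmall ((c₁ * D' / ‖u‖) • u) (Submodule.smul_mem _ _ hu) (by
      rw [norm_smul, Real.norm_of_nonneg hk, div_mul_cancel₀ _ hun.ne'])
    rw [map_smul, norm_smul, Real.norm_of_nonneg hk, div_mul_eq_mul_div, div_le_iff₀ hun] at h1
    linarith
  set u := S.proj 1 ((f q)⁻¹ * f q').log with hu
  have hqq'H : q⁻¹ * q' ∈ fibreSubgroup S W := by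
    rw [hq', inv_mul_cancel_left]
    exact exp_mem_fibreSubgroup (neg_mem (Submodule.smul_mem _ _ hvW))
  have huW : u ∈ W :=
    (hW.proj_one_mem ((mem_fibreSubgroup hW).1 ((hf.fibre q hqs q' hq's).1 hqq'H))).1
  have hun : ‖u‖ ≤ Cp * (ε * ((θ 1 + θ 2) * D')) := by
    have h1 := hproj ((f q)⁻¹ * f q')
    rw [← ccDist_eq_one_left] at h1
    have h2 := hf.map q hqs q' hq's _ hqDs σ' hσ'p (by rw [hw.ccDist_eq q hDp]; exact hqq')
    have h3 := hstr q hqD D hDp le_rfl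
    refine h1.trans ?_
    gcongr
    refine h2.trans ?_
    exact mul_le_mul hσ'ε h3 (ccDist_nonneg _ _) hεp.le
  have hTu : ‖T u‖ ≤ m ^ 2 / (2 * C₁) := by
    have h1 := hTbound u huW
    have h2 : 8 * C₁ * m ^ 2 * ‖u‖ ≤ 8 * C₁ * m ^ 2 * (Cp * (ε * ((θ 1 + θ 2) * D'))) := by
      gcongr
    have h3 : 8 * C₁ * m ^ 2 * (Cp * (ε * ((θ 1 + θ 2) * D'))) = m ^ 2 / (2 * C₁) * (c₁ * D') := by
      rw [hε]; field_simp; ring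
    exact le_of_mul_le_mul_right ((h1.trans h2).trans_eq h3) (by positivity)
  -- The first layer of the logarithm is additive, so passing from `q` to `q'` adds `T u` to the
  -- value of the affine function.
  have hadd : S.proj 1 ((f p)⁻¹ * f q').log = S.proj 1 ((f p)⁻¹ * f q).log + u := by
    rw [hu, ← S.proj_one_bch, ← log_mul]
    congr 2
    group
  have h1 := (hT q (hnear q (by linarith)) hqH).2
  have h2 := (hT q' (hnear q' (by linarith)) hq'H).1
  rw [hadd, map_add, ← add_assoc] at h2
  set A := Y + T (S.proj 1 ((f p)⁻¹ * f q).log) with hA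
  have h3 : ‖A‖ ≤ ‖A + T u‖ + ‖T u‖ := by
    have := norm_sub_le (A + T u) (T u)
    rwa [add_sub_cancel_right] at this
  have h4 : m ^ 2 / C₁ ≤ E + ‖A‖ := by rw [div_le_iff₀' hC₁p]; exact h1
  have h5 : m ^ 2 / (2 * C₁) = m ^ 2 / C₁ / 2 := by field_simp
  have h6 : m ^ 2 / C₁ / 2 ≤ C₁ * μ q' ^ 2 := by linarith
  have h7 : m ^ 2 ≤ (2 * C₁ * μ q') ^ 2 := by
    rw [div_div, div_le_iff₀ (by positivity)] at h6
    have : 0 ≤ C₁ ^ 2 * μ q' ^ 2 := by positivity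
    nlinarith
  exact (abs_le_of_sq_le_sq' h7 (mul_nonneg (by positivity) (ccDist_nonneg _ _))).2

end CarnotGroup

end

/-! ### The stretch on a fibre and the ratio of stretch to scale -/

noncomputable section
set_option linter.unusedSectionVars false
attribute [local instance] lieNorm
attribute [local instance] lieNormedSpace

namespace CarnotGroup

variable {𝔤 : Type*} [LieRing 𝔤] [LieAlgebra ℝ 𝔤] [FiniteDimensional ℝ 𝔤]
variable {S : Stratification 𝔤} {ip : InnerProductSpace.Core ℝ (S.layer 1)}
variable {W : Submodule ℝ 𝔤} {θ : ℝ → ℝ} {w₀ : 𝔤}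

/-- On a piece of a fibre, the stretch at any point is controlled by the stretch at the centre. -/
theorem exists_stretch_le_on_fibre (hW : S.IsCommuting W) (hlt : W < S.layer 1)
    (hθ : IsGauge θ) (hw : IsUnitDirection ip w₀) :
    ∃ K κ : ℝ, 0 < K ∧ 0 < κ ∧ κ ≤ 1 / 2 ∧
    ∀ f : OpenPartialHomeomorph (CarnotGroup S) (CarnotGroup S),
      IsControlled ip (fibreSubgroup S W) θ f →
    ∀ (x : CarnotGroup S) (r : ℝ), (∀ y, ccDist ip x y < 8 * r → y ∈ f.source) →
    ∀ p, ccDist ip x p < 2 * r → ∀ D, D ≤ κ * r → ∀ a, 0 < a → a ≤ D →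
    ∀ q, p⁻¹ * q ∈ fibreSubgroup S W → ccDist ip p q ≤ D →
      stretch ip f w₀ a q ≤ K * stretch ip f w₀ a p := by
  obtain ⟨c, κ, C, hc, hc1, hκ, hκ2, hC, halm⟩ := exists_almost_maximal hW hlt hθ hw
  obtain ⟨C₀, hC₀, hdist⟩ := exists_fibre_dist ip hW
  obtain ⟨N₀, N₁, hN₀, hN₁, hpar⟩ := exists_parallel (ip := ip) hW hlt
  have hθ1 := hθ.pos 1 one_pos
  have hCp : 0 < C := by linarith
  -- The two entries serve the cases in which the point considered near `p` lies outside or inside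
  -- the source.
  set B := max 1 (θ N₀⁻¹) with hB
  have hB1 : 1 ≤ B := le_max_left _ _
  have hBp : 0 < B := by linarith
  -- Small enough that the final chain of estimates yields `c a ^ 2 ≤ c a ^ 2 / 3`.
  set ε := min 1 (c / (6 * B ^ 2 * C₀ ^ 2)) with hε
  have hεp : 0 < ε := by positivity
  have hεB : ε ^ 2 * (6 * B ^ 2 * C₀ ^ 2) ≤ c := by
    have h1 : ε * (6 * B ^ 2 * C₀ ^ 2) ≤ c := by
      rw [← le_div_iff₀ (by positivity)]; exact min_le_right _ _
    have h2 : ε ^ 2 ≤ ε := by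
      have : ε ≤ 1 := min_le_left _ _
      nlinarith
    exact (mul_le_mul_of_nonneg_right h2 (by positivity)).trans h1
  obtain ⟨δ, hδ, hδε⟩ := hθ.small ε hεp
  have hθδ := hδε δ hδ le_rfl
  have hθδp := hθ.pos δ hδ
  -- The first summand makes `N₁ a'` at most `δ` times the stretch at `q` and `q'`. The second keeps
  -- the translates by `k` inside the target; the last one makes the inequalities strict.
  set K := N₁ * C / δ + θ 1 ^ 2 * N₁ * C + 1 with hK
  have hKp : 0 < K := by positivity
  refine ⟨2 * K, κ, by positivity, hκ, hκ2, ?_⟩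
  intro f hf x r hsub p hp D hD a ha haD
  have hr : 0 < r := by
    by_contra h
    have : ccDist ip x p < 0 := by linarith
    exact absurd (ccDist_nonneg x p) (not_le.2 this)
  obtain ⟨q, hqH, hqD, hmax, hq'D, hq'm⟩ := halm f hf x r hsub p hp D hD a ha haD
  have hD2 : 2 * D ≤ r := by
    have := hD.trans (mul_le_mul_of_nonneg_right hκ2 hr.le)
    linarith
  -- It is enough to treat the almost maximal point; this costs the factor `2`.
  suffices hmain : stretch ip f w₀ a q ≤ K * stretch ip f w₀ a p from
    fun q₁ h1 h2 => (hmax q₁ h1 h2).trans (by linarith)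
  by_contra hcon
  rw [not_le] at hcon
  set v := S.proj 1 (p⁻¹ * q).log with hv
  have hvW : v ∈ W := (hW.proj_one_mem ((mem_fibreSubgroup hW).1 hqH)).1
  have hsrc : ∀ q, ccDist ip p q ≤ r → ∀ y, ccDist ip q y ≤ r → y ∈ f.source := by
    intro q hq y hy
    refine hsub y ?_
    have h1 := ccDist_triangle (ip := ip) x p q
    have h2 := ccDist_triangle (ip := ip) x q y
    linarith
  have hsrc' : ∀ q, ccDist ip p q ≤ r → q ∈ f.source := fun q hq =>
    hsrc q hq q (by rw [ccDist_self]; exact hr.le)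
  have hps : p ∈ f.source := hsrc' p (by rw [ccDist_self]; exact hr.le)
  have hline : ∀ q b, 0 < b → b ≤ r → ccDist ip p q ≤ r → q * exp (b • w₀) ∈ f.source :=
    fun q b hb hbr hq => hsrc q hq _ (by rw [hw.ccDist_eq q hb]; exact hbr)
  have har : a ≤ r := by linarith
  have hpa := hline p a ha har (by rw [ccDist_self]; exact hr.le)
  set a' := stretch ip f w₀ a p with ha'
  have ha'p : 0 < a' := stretch_pos hw ha hps hpa
  -- A parallel fibre in the image, at the scale `a'` of the stretch at `p`.
  obtain ⟨k, hk1, hk2, hk3⟩ := hpar a' ha'p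
  -- the preimages of points of the parallel fibre
  have hpre : ∀ q₁, ccDist ip p q₁ ≤ r → stretch ip f w₀ a q ≤ C * stretch ip f w₀ a q₁ →
      f q₁ * k ∈ f.target ∧ ccDist ip q₁ (f.symm (f q₁ * k)) ≤ ε * a := by
    intro q₁ hq₁ hm
    have hq₁s := hsrc' q₁ hq₁
    have hq₁a := hline q₁ a ha har hq₁
    have hq₁r := hline q₁ r hr le_rfl hq₁
    have h1 : stretch ip f w₀ a q₁ ≤ θ 1 * stretch ip f w₀ r q₁ :=
      hf.map q₁ hq₁s _ hq₁a _ hq₁r 1 one_pos (by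
        rw [hw.ccDist_eq q₁ ha, hw.ccDist_eq q₁ hr, one_mul]; exact har)
    have hlt1 : K * a' < C * stretch ip f w₀ a q₁ := hcon.trans_le hm
    have e1 : K * a' = C * (N₁ * a' / δ) + C * (θ 1 ^ 2 * N₁ * a') + a' := by
      rw [hK]; ring
    have p1 : 0 < C * (N₁ * a' / δ) := by positivity
    have p2 : 0 < C * (θ 1 ^ 2 * N₁ * a') := by positivity
    have h2 : N₁ * a' / δ ≤ stretch ip f w₀ a q₁ := le_of_mul_le_mul_left (by linarith) hCp
    have h3 : θ 1 ^ 2 * N₁ * a' < stretch ip f w₀ a q₁ :=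
      lt_of_mul_lt_mul_left (by linarith) hCp.le
    rw [div_le_iff₀' hδ] at h2
    have hdk : ccDist ip (f q₁) (f q₁ * k) = N₁ * a' := by rw [ccDist_mul_right_one, hk1]
    have ht : f q₁ * k ∈ f.target := by
      refine (hf.mem_target hθ hw hr (hsrc q₁ hq₁) ?_).1
      rw [hdk]
      refine lt_of_mul_lt_mul_left ?_ hθ1.le
      calc θ 1 * (θ 1 * (N₁ * a')) = θ 1 ^ 2 * N₁ * a' := by ring
        _ < _ := h3.trans_le h1
    refine ⟨ht, ?_⟩
    have h4 := hf.map_symm _ (f.map_source hq₁s) _ ht _ (f.map_source hq₁a) δ hδ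
      (by rw [hdk]; exact h2)
    rw [f.left_inv hq₁s, f.left_inv hq₁a, hw.ccDist_eq q₁ ha] at h4
    exact h4.trans (by gcongr)
  have hqr : ccDist ip p q ≤ r := by
    have := ccDist_nonneg (ip := ip) p q
    linarith
  set q' := q * exp (-(c • v)) with hq'
  have hq'r : ccDist ip p q' ≤ r := by linarith
  have hqs := hsrc' q hqr
  have hq's := hsrc' q' hq'r
  have hqq'H : q⁻¹ * q' ∈ fibreSubgroup S W := by
    rw [hq', inv_mul_cancel_left]
    exact exp_mem_fibreSubgroup (neg_mem (Submodule.smul_mem _ _ hvW))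
  have hq'H : p⁻¹ * q' ∈ fibreSubgroup S W := by
    have := mul_mem hqH hqq'H
    rwa [mul_assoc, mul_inv_cancel_left] at this
  obtain ⟨ht, hd⟩ := hpre q hqr (le_mul_of_one_le_left (ccDist_nonneg _ _) hC)
  obtain ⟨ht', hd'⟩ := hpre q' hq'r hq'm
  set y := f.symm (f q * k) with hy
  set y' := f.symm (f q' * k) with hy'
  have hys : y ∈ f.source := f.map_target ht
  have hy's : y' ∈ f.source := f.map_target ht'
  have hfy : f y = f q * k := f.right_inv ht
  have hfy' : f y' = f q' * k := f.right_inv ht'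
  have hyy' : y⁻¹ * y' ∈ fibreSubgroup S W := by
    rw [hf.fibre y hys y' hy's, hfy, hfy']
    have := hk3 _ ((hf.fibre q hqs q' hq's).1 hqq'H)
    convert this using 1
    group
  -- The preimages `y` and `y'` lie on one fibre, and these are its affine data seen from `p`. The
  -- fibre is within `ε a` of both `q` and `q'`.
  obtain ⟨E, hE, Y, T, hT⟩ := hdist (p⁻¹ * y)
  obtain ⟨h', hh', hup⟩ := (hT 1 (one_mem _)).2
  have hq1 := (hT (p⁻¹ * q) hqH).1 1 (one_mem _)
  have hq2 := (hT (p⁻¹ * q') hq'H).1 (y⁻¹ * y') hyy'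
  rw [mul_one, ccDist_mul_left] at hq1
  rw [mul_assoc, mul_inv_cancel_left, ccDist_mul_left] at hq2
  rw [log_one, map_zero, map_zero, add_zero, ← ccDist_mul_left p, mul_one, mul_assoc,
    mul_inv_cancel_left] at hup
  have hvq' : S.proj 1 (p⁻¹ * q').log = v - c • v := by
    rw [hq', ← mul_assoc, log_mul, S.proj_one_bch, ← hv,
      S.proj_of_mem (hW.le_layer (neg_mem (Submodule.smul_mem _ _ hvW))), if_pos rfl,
      ← sub_eq_add_neg]
  rw [← hv] at hq1
  rw [hvq'] at hq2
  -- Quasisymmetry at `p`: the image fibre is at distance at least `N₀ a'` from `f p`, so the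
  -- preimage fibre cannot come much closer to `p` than `a`.
  have key : a ≤ B * ccDist ip p (y * h') := by
    by_cases hz : y * h' ∈ f.source
    · have h1 : (f y)⁻¹ * f (y * h') ∈ fibreSubgroup S W := by
        rw [← hf.fibre y hys _ hz, inv_mul_cancel_left]
        exact hh'
      rw [hfy] at h1
      have h2 : k⁻¹ * ((f p)⁻¹ * f (y * h')) ∈ fibreSubgroup S W := by
        have h4 := mul_mem (hk3 _ ((hf.fibre p hps q hqs).1 hqH)) h1
        convert h4 using 1
        group
      have h3 := hk2 _ h2
      rw [mul_inv_cancel_left, ← ccDist_eq_one_left] at h3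
      have h4 := hf.map_symm _ (f.map_source hps) _ (f.map_source hpa) _ (f.map_source hz)
        N₀⁻¹ (inv_pos.2 hN₀) (by rw [inv_mul_eq_div, le_div_iff₀' hN₀]; exact h3)
      rw [f.left_inv hps, f.left_inv hpa, f.left_inv hz, hw.ccDist_eq p ha] at h4
      exact h4.trans (mul_le_mul_of_nonneg_right (le_max_right _ _) (ccDist_nonneg _ _))
    · have h1 : r < ccDist ip p (y * h') := not_le.1 fun h => hz (hsrc' _ h)
      exact (har.trans h1.le).trans (le_mul_of_one_le_left (ccDist_nonneg _ _) hB1)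
  set M := C₀ * (ε * a) ^ 2 with hM
  have b1 : E + ‖Y + T v‖ ≤ M := hq1.trans (mul_le_mul_of_nonneg_left
    (pow_le_pow_left₀ (ccDist_nonneg _ _) hd 2) hC₀.le)
  have b2 : E + ‖Y + T (v - c • v)‖ ≤ M := hq2.trans (mul_le_mul_of_nonneg_left
    (pow_le_pow_left₀ (ccDist_nonneg _ _) hd' 2) hC₀.le)
  -- Extrapolation: the value over `0` is a linear combination of the values over `v` and `(1 - c)
  -- v`.
  have hcY : c • Y = (Y + T (v - c • v)) - (1 - c) • (Y + T v) := by
    rw [map_sub, map_smul]; module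
  have b3 : c * ‖Y‖ ≤ ‖Y + T (v - c • v)‖ + (1 - c) * ‖Y + T v‖ := by
    have h1 := norm_sub_le (Y + T (v - c • v)) ((1 - c) • (Y + T v))
    rwa [← hcY, norm_smul, norm_smul, Real.norm_of_nonneg hc.le,
      Real.norm_of_nonneg (sub_nonneg.2 hc1)] at h1
  have b4 : c * (E + ‖Y‖) ≤ 2 * M := by
    have h1 : (1 - c) * (E + ‖Y + T v‖) ≤ (1 - c) * M :=
      mul_le_mul_of_nonneg_left b1 (sub_nonneg.2 hc1)
    have h2 : 0 ≤ c * M := by positivity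
    have h3 : 0 ≤ (1 - c) * E := mul_nonneg (sub_nonneg.2 hc1) hE
    linarith
  have b5 : a ^ 2 ≤ B ^ 2 * (C₀ * (E + ‖Y‖)) := by
    calc a ^ 2 ≤ (B * ccDist ip p (y * h')) ^ 2 := pow_le_pow_left₀ ha.le key 2
      _ = B ^ 2 * ccDist ip p (y * h') ^ 2 := by ring
      _ ≤ _ := by gcongr
  have b6 : c * a ^ 2 ≤ (ε ^ 2 * (6 * B ^ 2 * C₀ ^ 2)) * a ^ 2 / 3 := by
    calc c * a ^ 2 ≤ c * (B ^ 2 * (C₀ * (E + ‖Y‖))) := by gcongr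
      _ = B ^ 2 * C₀ * (c * (E + ‖Y‖)) := by ring
      _ ≤ B ^ 2 * C₀ * (2 * M) := by gcongr
      _ = _ := by rw [hM]; ring
  have b7 : (ε ^ 2 * (6 * B ^ 2 * C₀ ^ 2)) * a ^ 2 / 3 ≤ c * a ^ 2 / 3 := by gcongr
  have b8 : 0 < c * a ^ 2 := by positivity
  linarith

/-- The ratio of the stretch and the scale is controlled by the same ratio at smaller scales. -/
theorem exists_stretch_ratio_le (hW : S.IsCommuting W) (hlt : W < S.layer 1)
    (hθ : IsGauge θ) (hw₀ : w₀ ∈ W) (hw : IsUnitDirection ip w₀) :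
    ∃ C κ : ℝ, 0 < C ∧ 0 < κ ∧ κ ≤ 1 / 2 ∧
    ∀ f : OpenPartialHomeomorph (CarnotGroup S) (CarnotGroup S),
      IsControlled ip (fibreSubgroup S W) θ f →
    ∀ (x : CarnotGroup S) (r : ℝ), (∀ y, ccDist ip x y < 8 * r → y ∈ f.source) →
    ∀ p, ccDist ip x p < 2 * r → ∀ D, D ≤ κ * r → ∀ a, 0 < a → a ≤ D →
      a * stretch ip f w₀ D p ≤ C * D * stretch ip f w₀ a p := by
  obtain ⟨K, κ, hK, hκ, hκ2, hfib⟩ := exists_stretch_le_on_fibre hW hlt hθ hw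
  have hθ2 := hθ.pos 2 two_pos
  refine ⟨θ 2 * K, κ, by positivity, hκ, hκ2, ?_⟩
  intro f hf x r hsub p hp D hD a ha haD
  have hr : 0 < r := by
    by_contra h
    have : ccDist ip x p < 0 := by linarith
    exact absurd (ccDist_nonneg x p) (not_le.2 this)
  have hDp : 0 < D := ha.trans_le haD
  have hD2 : 2 * D ≤ r := by
    have := hD.trans (mul_le_mul_of_nonneg_right hκ2 hr.le)
    linarith
  -- The segment is divided into `N` steps of length `a`. As `D ≤ 2 N a`, the remainder costs only a
  -- factor `θ 2`.
  set N := ⌊D / a⌋₊ with hN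
  have hNa : N * a ≤ D := by
    rw [← le_div_iff₀ ha]
    exact Nat.floor_le (by positivity)
  have hN1 : 1 ≤ N := (Nat.one_le_floor_iff _).2 ((one_le_div ha).2 haD)
  have hN1' : (1 : ℝ) ≤ N := by exact_mod_cast hN1
  have hND : D ≤ 2 * (N * a) := by
    have h1 := Nat.lt_floor_add_one (D / a)
    rw [div_lt_iff₀ ha, ← hN] at h1
    nlinarith
  have hline : ∀ b : ℝ, 0 ≤ b → ccDist ip p (p * exp (b • w₀)) = b := by
    intro b hb
    rcases hb.eq_or_lt with rfl | hb
    · rw [zero_smul, exp_zero, mul_one, ccDist_self]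
    · exact hw.ccDist_eq p hb
  have hsrc : ∀ b : ℝ, 0 ≤ b → b ≤ D → p * exp (b • w₀) ∈ f.source := by
    intro b hb hbD
    refine hsub _ ?_
    have := ccDist_triangle (ip := ip) x p (p * exp (b • w₀))
    rw [hline b hb] at this
    linarith
  have hps : p ∈ f.source := hsub p (by linarith)
  have hchain : ∀ n : ℕ, n ≤ N →
      ccDist ip (f p) (f (p * exp ((n * a) • w₀))) ≤ n * (K * stretch ip f w₀ a p) := by
    intro n
    induction n with
    | zero =>
      intro _
      simp [exp_zero, ccDist_self]
    | succ n ih =>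
      intro hn
      have h0 : (n : ℝ) * a ≤ D := by
        have : (n : ℝ) ≤ N := by exact_mod_cast (by omega : n ≤ N)
        nlinarith
      have h1 := ih (by omega)
      -- Every step starts on the fibre of `p` within distance `D`, so its image has length at most
      -- `K` times the stretch at `p`.
      have h2 := hfib f hf x r hsub p hp D hD a ha haD (p * exp ((n * a) • w₀))
        (by rw [inv_mul_cancel_left]; exact exp_mem_fibreSubgroup (Submodule.smul_mem _ _ hw₀))
        (by rw [hline _ (by positivity)]; exact h0)
      have h3 := ccDist_triangle (ip := ip) (f p) (f (p * exp ((n * a) • w₀)))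
        (f (p * exp (((n + 1 : ℕ) * a) • w₀)))
      have h4 : ccDist ip (f (p * exp ((n * a) • w₀))) (f (p * exp (((n + 1 : ℕ) * a) • w₀)))
          = stretch ip f w₀ a (p * exp ((n * a) • w₀)) := by
        rw [stretch, mul_assoc, exp_smul_mul_exp_smul hW hw₀]
        congr 5
        push_cast
        ring
      push_cast at h3 h4 ⊢
      rw [h4] at h3
      linarith
  have h1 : stretch ip f w₀ D p ≤ θ 2 * ccDist ip (f p) (f (p * exp ((N * a) • w₀))) :=
    hf.map p hps _ (hsrc D hDp.le le_rfl) _ (hsrc _ (by positivity) hNa) 2 two_pos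
      (by rw [hline D hDp.le, hline _ (by positivity)]; exact hND)
  have h2 := hchain N le_rfl
  have h3 : 0 ≤ stretch ip f w₀ a p := ccDist_nonneg _ _
  calc a * stretch ip f w₀ D p ≤ a * (θ 2 * (N * (K * stretch ip f w₀ a p))) := by
        gcongr
        exact h1.trans (by gcongr)
    _ = θ 2 * K * (N * a) * stretch ip f w₀ a p := by ring
    _ ≤ _ := by gcongr

end CarnotGroup

end

/-! ### The bilipschitz estimate -/

noncomputable section
set_option linter.unusedSectionVars false
attribute [local instance] lieNorm
attribute [local instance] lieNormedSpace

namespace CarnotGroup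

variable {𝔤 : Type*} [LieRing 𝔤] [LieAlgebra ℝ 𝔤] [FiniteDimensional ℝ 𝔤]
variable {S : Stratification 𝔤} {ip : InnerProductSpace.Core ℝ (S.layer 1)}
variable {W : Submodule ℝ 𝔤} {θ : ℝ → ℝ} {w₀ : 𝔤}

/-- Both `f y` and `f (y exp (R w₀))` are compared with `f x`, at relative distances `1` and `2`. -/
theorem IsControlled.stretch_le {H : Subgroup (CarnotGroup S)}
    {f : OpenPartialHomeomorph (CarnotGroup S) (CarnotGroup S)} (hf : IsControlled ip H θ f)
    (hw : IsUnitDirection ip w₀) {x y : CarnotGroup S} {R : ℝ} (hR : 0 < R)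
    (hxy : ccDist ip x y ≤ R) (hx : ∀ z, ccDist ip x z ≤ 2 * R → z ∈ f.source) :
    stretch ip f w₀ R y ≤ (θ 1 + θ 2) * stretch ip f w₀ R x := by
  have hyR : ccDist ip x (y * exp (R • w₀)) ≤ 2 * R := by
    have := ccDist_triangle (ip := ip) x y (y * exp (R • w₀))
    rw [hw.ccDist_eq y hR] at this
    linarith
  have hxx : x ∈ f.source := hx x (by rw [ccDist_self]; positivity)
  have hxR := hx (x * exp (R • w₀)) (by rw [hw.ccDist_eq x hR]; linarith)
  have h1 := hf.map x hxx y (hx y (by linarith)) _ hxR 1 one_pos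
    (by rw [hw.ccDist_eq x hR, one_mul]; exact hxy)
  have h2 := hf.map x hxx _ (hx _ hyR) _ hxR 2 two_pos (by rw [hw.ccDist_eq x hR]; exact hyR)
  have h3 := ccDist_triangle (ip := ip) (f y) (f x) (f (y * exp (R • w₀)))
  rw [ccDist_comm (f y) (f x)] at h3
  unfold stretch
  linarith

/-- Controlled maps which preserve the fibres are bilipschitz after a dilation. -/
theorem exists_bilipschitz_of_isControlled (hW : S.IsCommuting W) (hne : W ≠ ⊥)
    (hlt : W < S.layer 1) (hθ : IsGauge θ) : ∃ L : ℝ, 1 ≤ L ∧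
    ∀ f : OpenPartialHomeomorph (CarnotGroup S) (CarnotGroup S),
      IsControlled ip (fibreSubgroup S W) θ f →
    ∀ (x : CarnotGroup S) (r : ℝ), 0 < r → (∀ y, ccDist ip x y < 8 * r → y ∈ f.source) →
    ∃ t : ℝ, 0 < t ∧ IsBilipschitzOn ip L (dilation t ∘ f) (ccBall ip x (8 * r / L)) := by
  obtain ⟨w₀, hw₀, hw⟩ := exists_unit_line (ip := ip) hW hne
  replace hw : IsUnitDirection ip w₀ := hw
  obtain ⟨C, κ, hC, hκ, hκ2, hratio⟩ := exists_stretch_ratio_le hW hlt hθ hw₀ hw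
  have hθ1 := hθ.pos 1 one_pos
  have hθ2 := hθ.pos 2 two_pos
  have hθ3 := hθ.pos (8 * θ 1 / κ) (by positivity)
  set θ₃ := θ (8 * θ 1 / κ) with hθ₃
  obtain ⟨δ, hδ, hδε⟩ := hθ.small (κ / (8 * θ 1)) (by positivity)
  have hθδ := hδε δ hδ le_rfl
  set C₁ := θ₃ * C * κ * (θ 1 + θ 2) with hC₁
  set C₂ := C * θ 1 * (θ 1 + θ 2) with hC₂
  have hC₁p : 0 < C₁ := by positivity
  have hC₂p : 0 < C₂ := by positivity
  have hk1 : 0 < 16 / κ := by positivity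
  have hk2 : 0 < 16 / (δ * κ) := by positivity
  -- `C₁` and `C₂` are the two bilipschitz constants. The terms `16 / κ` and `16 / (δ κ)` make
  -- distances in the small ball at most `R` and `δ R`.
  set L := C₁ + C₂ + 16 / κ + 16 / (δ * κ) + 4 with hL
  have hLp : 0 < L := by positivity
  refine ⟨L, by linarith, ?_⟩
  intro f hf x r hr hsub
  set R := κ * r with hR
  have hRp : 0 < R := by positivity
  have hRr : 2 * R ≤ r := by
    have := mul_le_mul_of_nonneg_right hκ2 hr.le
    linarith
  have hsmall1 : 16 * r / L ≤ R := by
    rw [div_le_iff₀ hLp]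
    calc 16 * r = R * (16 / κ) := by rw [hR]; field_simp
      _ ≤ R * L := by gcongr; linarith
  have hsmall2 : 16 * r / L ≤ δ * R := by
    rw [div_le_iff₀ hLp]
    calc 16 * r = δ * R * (16 / (δ * κ)) := by rw [hR]; field_simp
      _ ≤ δ * R * L := by gcongr; linarith
  have hxs : x ∈ f.source := hsub x (by rw [ccDist_self]; positivity)
  have hxR : x * exp (R • w₀) ∈ f.source := hsub _ (by rw [hw.ccDist_eq x hRp]; linarith)
  set m := stretch ip f w₀ R x with hm
  have hmp : 0 < m := stretch_pos hw hRp hxs hxR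
  -- After this dilation the stretch at `x` at scale `R` equals `R`.
  refine ⟨R / m, by positivity, fun y hy z hz => ?_⟩
  rw [Function.comp_apply, Function.comp_apply, ccDist_dilation (by positivity)]
  rcases eq_or_ne y z with rfl | hyz
  · simp [ccDist_self]
  change ccDist ip x y < 8 * r / L at hy
  change ccDist ip x z < 8 * r / L at hz
  have h16 : 8 * r / L = 16 * r / L / 2 := by ring
  have hyR : ccDist ip x y ≤ R := by linarith
  have hzR : ccDist ip x z ≤ R := by linarith
  have hys : y ∈ f.source := hsub y (by linarith)
  have hzs : z ∈ f.source := hsub z (by linarith)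
  set a := ccDist ip y z with ha
  set b := ccDist ip (f y) (f z) with hb
  have hap : 0 < a := ccDist_pos hyz
  have hbp : 0 < b := ccDist_pos fun h => hyz (f.injOn hys hzs h)
  have haL : a ≤ 16 * r / L := by
    have := ccDist_triangle (ip := ip) y x z
    rw [ccDist_comm y x] at this
    linarith
  have hnear : ∀ u, ccDist ip y u ≤ 2 * R → u ∈ f.source := fun u hu => hsub u (by
    have := ccDist_triangle (ip := ip) x y u
    linarith)
  have hya : y * exp (a • w₀) ∈ f.source := hnear _ (by rw [hw.ccDist_eq y hap]; linarith)
  have hyRs : y * exp (R • w₀) ∈ f.source := hnear _ (by rw [hw.ccDist_eq y hRp]; linarith)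
  set n := stretch ip f w₀ R y with hn
  have hnp : 0 < n := stretch_pos hw hRp hys hyRs
  have hnm : n ≤ (θ 1 + θ 2) * m := hf.stretch_le hw hRp hyR fun u hu => hsub u (by linarith)
  have hmn : m ≤ (θ 1 + θ 2) * n :=
    hf.stretch_le hw hRp (by rw [ccDist_comm]; exact hyR) hnear
  -- Lower bound: the ratio estimate for `f` at `y` between the scales `a` and `R`.
  have hlow : a * n ≤ C * R * (θ 1 * b) := by
    refine (hratio f hf x r hsub y (by linarith) R le_rfl a hap (haL.trans hsmall1)).trans ?_
    gcongr
    exact hf.map y hys _ hya z hzs 1 one_pos (by rw [hw.ccDist_eq y hap, one_mul])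
  -- The image distance `b` has to be at most the scale `D` at which the inverse is examined; this
  -- is what `δ` was chosen for.
  have hbn : b ≤ κ / (8 * θ 1) * n := by
    have h1 := hf.map y hys z hzs _ hyRs δ hδ
      (by rw [hw.ccDist_eq y hRp]; exact haL.trans hsmall2)
    exact h1.trans (mul_le_mul_of_nonneg_right hθδ hnp.le)
  have htar : ∀ u, ccDist ip (f y) u < 8 * (n / (8 * θ 1)) → u ∈ f.target := by
    intro u hu
    refine (hf.mem_target hθ hw hRp (fun z hz => hnear z (by linarith)) ?_).1
    have : 8 * (n / (8 * θ 1)) = n / θ 1 := by field_simp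
    rwa [this, lt_div_iff₀' hθ1] at hu
  set R' := n / (8 * θ 1) with hR'
  have hR'p : 0 < R' := by positivity
  set D := κ * R' with hD
  have hDp : 0 < D := by positivity
  have hDR' : D ≤ R' := mul_le_of_le_one_left hR'p.le (by linarith)
  have hbD : b ≤ D := by
    refine hbn.trans_eq ?_
    rw [hD, hR']; ring
  -- Upper bound: the same ratio estimate for the inverse at `f y`, between the scales `b` and `D`.
  have hup := hratio f.symm hf.symm (f y) R' htar (f y) (by rw [ccDist_self]; positivity) D le_rfl
    b hbp hbD
  have hyt := f.map_source hys
  have htb : f y * exp (b • w₀) ∈ f.target := htar _ (by rw [hw.ccDist_eq _ hbp]; linarith)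
  have htD : f y * exp (D • w₀) ∈ f.target := htar _ (by rw [hw.ccDist_eq _ hDp]; linarith)
  have h1 : stretch ip f.symm w₀ b (f y) ≤ θ 1 * a := by
    have := hf.map_symm _ hyt _ htb _ (f.map_source hzs) 1 one_pos
      (by rw [hw.ccDist_eq _ hbp, one_mul])
    unfold stretch
    rw [f.left_inv hzs, f.left_inv hys] at this
    rwa [f.left_inv hys]
  -- The factor `8 θ 1 / κ` is exactly `n / D`, the ratio of the stretch at `y` to the scale `D`.
  have h2 : R ≤ θ₃ * stretch ip f.symm w₀ D (f y) := by
    have := hf.map_symm _ hyt _ (f.map_source hyRs) _ htD (8 * θ 1 / κ) (by positivity) (by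
      rw [hw.ccDist_eq _ hDp]
      refine le_of_eq ?_
      change n = _
      rw [hD, hR']
      field_simp)
    unfold stretch
    rw [f.left_inv hyRs, f.left_inv hys, hw.ccDist_eq y hRp] at this
    rwa [f.left_inv hys]
  have hupp : b * R ≤ θ₃ * C * κ * n * a := by
    calc b * R ≤ b * (θ₃ * stretch ip f.symm w₀ D (f y)) := by gcongr
      _ = θ₃ * (b * stretch ip f.symm w₀ D (f y)) := by ring
      _ ≤ θ₃ * (C * D * (θ 1 * a)) :=
        mul_le_mul_of_nonneg_left (hup.trans (by gcongr)) hθ3.le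
      _ = θ₃ * C * κ * n * a / 8 := by rw [hD, hR']; field_simp
      _ ≤ _ := by
        have : 0 < θ₃ * C * κ * n * a := by positivity
        linarith
  constructor
  · rw [inv_mul_le_iff₀ hLp]
    have h3 : a * m ≤ C₂ * (R * b) := by
      calc a * m ≤ a * ((θ 1 + θ 2) * n) := by gcongr
        _ = (θ 1 + θ 2) * (a * n) := by ring
        _ ≤ (θ 1 + θ 2) * (C * R * (θ 1 * b)) := by gcongr
        _ = _ := by rw [hC₂]; ring
    have h4 : C₂ * (R * b) ≤ L * (R * b) := by gcongr; linarith
    rw [div_mul_eq_mul_div, mul_div_assoc', le_div_iff₀ hmp]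
    exact h3.trans h4
  · rw [div_mul_eq_mul_div, div_le_iff₀ hmp]
    calc R * b = b * R := mul_comm _ _
      _ ≤ θ₃ * C * κ * n * a := hupp
      _ ≤ θ₃ * C * κ * ((θ 1 + θ 2) * m) * a := by gcongr
      _ = C₁ * (a * m) := by rw [hC₁]; ring
      _ ≤ L * (a * m) := by gcongr; linarith
      _ = L * a * m := by ring

end CarnotGroup

end

/-! ### From quasisymmetry to a control function, and the conclusion -/

noncomputable section
set_option linter.unusedSectionVars false

/-- A continuous injection is strictly monotone or antitone. In the second case its value at `0`
would be the largest, against surjectivity. -/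
theorem Homeomorph.strictMono_nnreal (η : ℝ≥0 ≃ₜ ℝ≥0) : StrictMono η := by
  rcases η.continuous.strictMono_of_inj η.injective with h | h
  · exact h
  · obtain ⟨a, ha⟩ := η.surjective (η 0 + 1)
    have h1 := h.antitone (zero_le (a := a))
    rw [ha] at h1
    exact absurd h1 (not_le.2 (lt_add_of_pos_right _ one_pos))

theorem Homeomorph.map_zero_nnreal (η : ℝ≥0 ≃ₜ ℝ≥0) : η 0 = 0 := by
  obtain ⟨a, ha⟩ := η.surjective 0
  have h1 := η.strictMono_nnreal.monotone (zero_le (a := a))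
  rwa [ha, nonpos_iff_eq_zero] at h1

/-- The control function for an `η`-quasisymmetric homeomorphism and its inverse. -/
def gaugeOf (η : ℝ≥0 ≃ₜ ℝ≥0) (s : ℝ) : ℝ :=
  η s.toNNReal + (η.symm (s⁻¹).toNNReal : ℝ)⁻¹ + if s < 1 then 0 else 1

/-- The first two terms are small for small `s` because `η` and its inverse are increasing
bijections. The third is a step that vanishes for `s < 1`. -/
theorem isGauge_gaugeOf (η : ℝ≥0 ≃ₜ ℝ≥0) : IsGauge (gaugeOf η) where
  pos s hs := by
    have h1 : 0 < η s.toNNReal := by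
      rw [← η.map_zero_nnreal]
      exact η.strictMono_nnreal (Real.toNNReal_pos.2 hs)
    have h2 : (0 : ℝ) < η s.toNNReal := h1
    have h3 : (0 : ℝ) ≤ if s < 1 then 0 else 1 := by split_ifs <;> norm_num
    have h4 : (0 : ℝ) ≤ (η.symm (s⁻¹).toNNReal : ℝ)⁻¹ := by positivity
    unfold gaugeOf
    linarith
  small ε hε := by
    set e := (ε / 2).toNNReal with he
    have hep : 0 < e := Real.toNNReal_pos.2 (by positivity)
    have hee : (e : ℝ) = ε / 2 := Real.coe_toNNReal _ (by positivity)
    have hs0 : 0 < η.symm e := by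
      rw [← η.symm.map_zero_nnreal]
      exact η.symm.strictMono_nnreal hep
    have hs1 : 0 < η e⁻¹ := by
      rw [← η.map_zero_nnreal]
      exact η.strictMono_nnreal (inv_pos.2 hep)
    refine ⟨min (1 / 2) (min (η.symm e) (η e⁻¹)⁻¹), by positivity, fun s hs hsδ => ?_⟩
    have h1 : s < 1 := (hsδ.trans (min_le_left _ _)).trans_lt (by norm_num)
    have h2 : s.toNNReal ≤ η.symm e := Real.toNNReal_le_iff_le_coe.2
      (hsδ.trans ((min_le_right _ _).trans (min_le_left _ _)))
    have h3 : η s.toNNReal ≤ e := by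
      have := η.strictMono_nnreal.monotone h2
      rwa [η.apply_symm_apply] at this
    have h4 : s ≤ (η e⁻¹ : ℝ)⁻¹ := hsδ.trans ((min_le_right _ _).trans (min_le_right _ _))
    have h5 : η e⁻¹ ≤ (s⁻¹).toNNReal := by
      rw [Real.le_toNNReal_iff_coe_le (by positivity)]
      exact (le_inv_comm₀ hs (NNReal.coe_pos.2 hs1)).1 h4
    have h6 : e⁻¹ ≤ η.symm (s⁻¹).toNNReal := by
      have := η.symm.strictMono_nnreal.monotone h5
      rwa [η.symm_apply_apply] at this
    have h7 : (η.symm (s⁻¹).toNNReal)⁻¹ ≤ e := inv_le_of_inv_le₀ hep h6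
    have h8 : ((η.symm (s⁻¹).toNNReal : ℝ))⁻¹ ≤ e := by exact_mod_cast h7
    have h9 : (η s.toNNReal : ℝ) ≤ e := h3
    unfold gaugeOf
    rw [if_pos h1]
    linarith

theorem le_gaugeOf (η : ℝ≥0 ≃ₜ ℝ≥0) (s : ℝ) :
    η s.toNNReal ≤ gaugeOf η s ∧ (η.symm (s⁻¹).toNNReal : ℝ)⁻¹ ≤ gaugeOf η s ∧
      (1 ≤ s → 1 ≤ gaugeOf η s) := by
  have h1 : (0 : ℝ) ≤ η s.toNNReal := NNReal.coe_nonneg _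
  have h2 : (0 : ℝ) ≤ (η.symm (s⁻¹).toNNReal : ℝ)⁻¹ := by positivity
  have h3 : (0 : ℝ) ≤ if s < 1 then 0 else 1 := by split_ifs <;> norm_num
  unfold gaugeOf
  refine ⟨by linarith, by linarith, fun hs => ?_⟩
  rw [if_neg (not_lt.2 hs)]
  linarith

attribute [local instance] lieNorm
attribute [local instance] lieNormedSpace

namespace CarnotGroup

variable {𝔤 : Type*} [LieRing 𝔤] [LieAlgebra ℝ 𝔤] [FiniteDimensional ℝ 𝔤]
variable {S : Stratification 𝔤} {ip : InnerProductSpace.Core ℝ (S.layer 1)}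

/-- The implication from right to left uses that the image of a coset is the whole trace of a coset
on the target, together with injectivity. -/
theorem PreservesCosetFoliation.fibre_iff {H : Subgroup (CarnotGroup S)}
    {f : OpenPartialHomeomorph (CarnotGroup S) (CarnotGroup S)} (hf : PreservesCosetFoliation f H)
    {p q : CarnotGroup S} (hp : p ∈ f.source) (hq : q ∈ f.source) :
    p⁻¹ * q ∈ H ↔ (f p)⁻¹ * f q ∈ H := by
  obtain ⟨g, hg⟩ := hf p
  have hmem : ∀ a b : CarnotGroup S, b ∈ a • (H : Set (CarnotGroup S)) ↔ a⁻¹ * b ∈ H :=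
    fun a b => by rw [mem_smul_set_iff_inv_smul_mem, smul_eq_mul, SetLike.mem_coe]
  have hfp : f p ∈ f.target ∩ g • (H : Set (CarnotGroup S)) := by
    rw [← hg]
    exact ⟨p, ⟨hp, (hmem _ _).2 (by rw [inv_mul_cancel]; exact one_mem _)⟩, rfl⟩
  have hgp := (hmem _ _).1 hfp.2
  constructor
  · intro h
    have hfq : f q ∈ f.target ∩ g • (H : Set (CarnotGroup S)) := by
      rw [← hg]
      exact ⟨q, ⟨hq, (hmem _ _).2 h⟩, rfl⟩
    have := mul_mem (inv_mem hgp) ((hmem _ _).1 hfq.2)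
    convert this using 1
    group
  · intro h
    have hfq : f q ∈ f.target ∩ g • (H : Set (CarnotGroup S)) := by
      refine ⟨f.map_source hq, (hmem _ _).2 ?_⟩
      have := mul_mem hgp h
      rwa [mul_assoc, mul_inv_cancel_left] at this
    rw [← hg] at hfq
    obtain ⟨q', ⟨hq's, hq'⟩, he⟩ := hfq
    rw [f.injOn hq's hq he] at hq'
    exact (hmem _ _).1 hq'

/-- For the inverse, quasisymmetry is applied to `p, z, y` with the last two exchanged, and `η⁻¹` is
taken. Quasisymmetry says nothing about `y = z`; there the step in the control function, which makes
it at least `1` for `s ≥ 1`, is used. -/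
theorem IsQuasisymmetricOn.isControlled {η : ℝ≥0 ≃ₜ ℝ≥0} {H : Subgroup (CarnotGroup S)}
    {f : OpenPartialHomeomorph (CarnotGroup S) (CarnotGroup S)}
    (hf : IsQuasisymmetricOn ip η f f.source) (hH : PreservesCosetFoliation f H) :
    IsControlled ip H (gaugeOf η) f where
  fibre p hp q hq := hH.fibre_iff hp hq
  map p hp y hy z hz s hs h := by
    have hg := (isGauge_gaugeOf η).pos s hs
    by_cases hpy : p = y
    · rw [← hpy, ccDist_self]
      exact mul_nonneg hg.le (ccDist_nonneg _ _)
    have hdy := ccDist_pos (ip := ip) hpy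
    by_cases hpz : p = z
    · rw [← hpz, ccDist_self, mul_zero] at h
      exact absurd h (not_le.2 hdy)
    have hdz := ccDist_pos (ip := ip) hpz
    by_cases hyz : y = z
    · subst hyz
      exact le_mul_of_one_le_left (ccDist_nonneg _ _)
        ((le_gaugeOf η s).2.2 ((le_mul_iff_one_le_left hdy).1 h))
    have hfz : 0 < ccDist ip (f p) (f z) := ccDist_pos fun h => hpz (f.injOn hp hz h)
    have h1 := hf p hp y hy z hz hpy hpz hyz
    rw [div_le_iff₀ hfz] at h1
    refine h1.trans (mul_le_mul_of_nonneg_right (le_trans ?_ (le_gaugeOf η s).1) hfz.le)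
    exact η.strictMono_nnreal.monotone (Real.toNNReal_le_toNNReal ((div_le_iff₀ hdz).2 h))
  map_symm p' hp' y' hy' z' hz' s hs h := by
    have hg := (isGauge_gaugeOf η).pos s hs
    rw [← f.right_inv hp', ← f.right_inv hy', ← f.right_inv hz'] at h
    have hp := f.map_target hp'
    have hy := f.map_target hy'
    have hz := f.map_target hz'
    set p := f.symm p'
    set y := f.symm y'
    set z := f.symm z'
    by_cases hpy : p = y
    · rw [← hpy, ccDist_self]
      exact mul_nonneg hg.le (ccDist_nonneg _ _)
    have hdy := ccDist_pos (ip := ip) hpy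
    have hfy : 0 < ccDist ip (f p) (f y) := ccDist_pos fun h => hpy (f.injOn hp hy h)
    by_cases hpz : p = z
    · rw [← hpz, ccDist_self, mul_zero] at h
      exact absurd h (not_le.2 hfy)
    have hdz := ccDist_pos (ip := ip) hpz
    by_cases hyz : y = z
    · rw [← hyz] at h ⊢
      exact le_mul_of_one_le_left (ccDist_nonneg _ _)
        ((le_gaugeOf η s).2.2 ((le_mul_iff_one_le_left hfy).1 h))
    have h1 := hf p hp z hz y hy hpz hpy (Ne.symm hyz)
    have h2 : s⁻¹ ≤ ccDist ip (f p) (f z) / ccDist ip (f p) (f y) := by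
      rw [inv_eq_one_div, div_le_div_iff₀ hs hfy]
      linarith
    have h3 : (s⁻¹).toNNReal ≤ η (ccDist ip p z / ccDist ip p y).toNNReal :=
      Real.toNNReal_le_iff_le_coe.2 (h2.trans h1)
    have h4 := η.symm.strictMono_nnreal.monotone h3
    rw [η.symm_apply_apply, Real.le_toNNReal_iff_coe_le (by positivity)] at h4
    have h5 : 0 < η.symm (s⁻¹).toNNReal := by
      rw [← η.symm.map_zero_nnreal]
      exact η.symm.strictMono_nnreal (Real.toNNReal_pos.2 (inv_pos.2 hs))
    have h6 : (0 : ℝ) < η.symm (s⁻¹).toNNReal := h5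
    rw [le_div_iff₀ hdy, ← le_div_iff₀' h6, div_eq_inv_mul] at h4
    exact h4.trans (mul_le_mul_of_nonneg_right (le_gaugeOf η s).2.1 hdz.le)

theorem exists_bilipschitz_of_isQuasisymmetricOn (ip : InnerProductSpace.Core ℝ (S.layer 1))
    (W : Submodule ℝ 𝔤) (hne : W ≠ ⊥) (hlt : W < S.layer 1)
    (hcomm : ∀ i, 2 ≤ i → ∀ w ∈ W, ∀ v ∈ S.layer i, ⁅w, v⁆ = 0) (η : ℝ≥0 ≃ₜ ℝ≥0) :
    ∃ L : ℝ, 1 ≤ L ∧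
      ∀ (x : CarnotGroup S) (r : ℝ), 0 < r →
      ∀ f : OpenPartialHomeomorph (CarnotGroup S) (CarnotGroup S),
        f.source = ccBall ip x r →
        IsQuasisymmetricOn ip η f (ccBall ip x r) →
        PreservesCosetFoliation f (fibreSubgroup S W) →
        ∃ t : ℝ, 0 < t ∧ IsBilipschitzOn ip L (dilation t ∘ f) (ccBall ip x (r / L)) := by
  obtain ⟨L, hL, h⟩ := exists_bilipschitz_of_isControlled (ip := ip) ⟨hlt.le, hcomm⟩ hne hlt
    (isGauge_gaugeOf η)
  refine ⟨L, hL, fun x r hr f hs hf hH => ?_⟩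
  rw [← hs] at hf
  have h8 : 8 * (r / 8) = r := by ring
  -- The estimate for controlled maps is stated for a source containing the ball of radius `8 r`,
  -- hence the radius `r / 8`.
  have := h f (hf.isControlled hH) x (r / 8) (by positivity) fun y hy => by
    rw [hs]
    rwa [h8] at hy
  rwa [h8] at this

end CarnotGroup

/-- The topology of a finite-dimensional Hausdorff topological vector space is unique. -/
theorem topologicalSpace_eq_of_finiteDimensional {E : Type*} [AddCommGroup E] [Module ℝ E]
    [FiniteDimensional ℝ E] (t₁ t₂ : TopologicalSpace E)
    (a₁ : @IsTopologicalAddGroup E t₁ _) (a₂ : @IsTopologicalAddGroup E t₂ _)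
    (c₁ : @ContinuousSMul ℝ E _ _ t₁) (c₂ : @ContinuousSMul ℝ E _ _ t₂)
    (h₁ : @T2Space E t₁) (h₂ : @T2Space E t₂) : t₁ = t₂ := by
  refine le_antisymm ?_ ?_
  · rw [← continuous_id_iff_le]
    exact @LinearMap.continuous_of_finiteDimensional ℝ _ E _ _ t₁ a₁ c₁ E _ _ t₂ a₂ c₂ _ h₁ _
      LinearMap.id
  · rw [← continuous_id_iff_le]
    exact @LinearMap.continuous_of_finiteDimensional ℝ _ E _ _ t₂ a₂ c₂ E _ _ t₁ a₁ c₁ _ h₂ _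
      LinearMap.id

end

theorem mainTheorem12 {𝔤 : Type*} [LieRing 𝔤] [LieAlgebra ℝ 𝔤] [FiniteDimensional ℝ 𝔤]
    [TopologicalSpace 𝔤] [IsTopologicalAddGroup 𝔤] [ContinuousSMul ℝ 𝔤] [T2Space 𝔤]
    (S : Stratification 𝔤) (ip : InnerProductSpace.Core ℝ (S.layer 1))
    (W : Submodule ℝ 𝔤) (hW_ne : W ≠ ⊥) (hW_lt : W < S.layer 1)
    (hW_comm : ∀ i, 2 ≤ i → ∀ w ∈ W, ∀ v ∈ S.layer i, ⁅w, v⁆ = 0)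
    (η : ℝ≥0 ≃ₜ ℝ≥0) :
    ∃ L : ℝ, 1 ≤ L ∧
      ∀ (x : CarnotGroup S) (r : ℝ), 0 < r →
      ∀ f : OpenPartialHomeomorph (CarnotGroup S) (CarnotGroup S),
        f.source = CarnotGroup.ccBall ip x r →
        CarnotGroup.IsQuasisymmetricOn ip η f (CarnotGroup.ccBall ip x r) →
        CarnotGroup.PreservesCosetFoliation f
          (CarnotGroup.subgroupOf (LieSubalgebra.lieSpan ℝ 𝔤 (W : Set 𝔤))) →
        ∃ t : ℝ, 0 < t ∧
          CarnotGroup.IsBilipschitzOn ip L (CarnotGroup.dilation t ∘ f)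
            (CarnotGroup.ccBall ip x (r / L)) := by
  let n := lieNorm 𝔤
  let ns := lieNormedSpace 𝔤
  -- The given topology is that of the auxiliary Euclidean norm, so the normed version of the
  -- statement applies.
  have ht := topologicalSpace_eq_of_finiteDimensional ‹TopologicalSpace 𝔤›
    n.toUniformSpace.toTopologicalSpace inferInstance inferInstance inferInstance inferInstance
    inferInstance inferInstance
  subst ht
  exact CarnotGroup.exists_bilipschitz_of_isQuasisymmetricOn ip W hW_ne hW_lt hW_comm η
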